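/- **Setting.** Let $D$ be a connected (finite-dimensional, real) Lie group with Lie algebra $\mathfrak d=T_1D$, whose bracket $[\cdot,\cdot]_{\mathfrak d}$ is defined by *right*-invariant vector fields, $[u,v]_{\mathfrak d}=[u^r,v^r](1)$. Let $\langle\cdot,\cdot\rangle_{\mathfrak d}$ be an $\mathrm{Ad}$-invariant, nondegenerate, symmetric bilinear form of signature $(n,n)$ on $\mathfrak d$, where $\dim\mathfrak d=2n$, and let $\mathfrak g\subset\mathfrak d$ be a Lie subalgebra that is also a maximal isotropic subspace. Let $G\subset D$ be a connected closed Lie subgroup with Lie algebra $\mathfrak g$, and let $S=D/G$ be the quotient manifold by right multiplication, with projection $p:D\to S$. Left multiplication induces an action of $D$ on $S$; let $\rho_S:\mathfrak d\to\mathfrak X(S)$, $\rho_S(u)_{p(a)}=dp(u^r_a)$, be the infinitesimal action, and $\rho=\rho_S|_{\mathfrak g}$. An *isotropic connection splitting* is a 1-form $s\in\Omega^1(S,\mathfrak d)$ with $\rho_S(s(X))=X$ and $\langle s(X),s(Y)\rangle_{\mathfrak d}=0$ for all $x\in S$ and $X,Y\in T_xS$. Given such an $s$, put $$\phi_S=\tfrac12\langle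 ds,s\rangle_{\mathfrak d}+\tfrac16\langle[s,s]_{\mathfrak d},s\rangle_{\mathfrak d}\in\Omega^3(S),\qquad \sigma(u)=\langle s(\cdot),u\rangle_{\mathfrak d}\in\Omega^1(S)\quad(u\in\mathfrak g),$$ where the products of forms are wedge products, so that $[s,s]_{\mathfrak d}(X,Y)=2[s(X),s(Y)]_{\mathfrak d}$ and $\langle ds,s\rangle_{\mathfrak d}(X,Y,Z)$ is the cyclic sum of $\langle ds(X,Y),s(Z)\rangle_{\mathfrak d}$. Sections of the trivial bundle $\mathfrak g\times S$ are smooth functions $a:S\to\mathfrak g$; $\rho$ and $\sigma$ are extended to them pointwise, and they carry the action Lie algebroid bracket $[a,b](x)=[a(x),b(x)]_{\mathfrak d}+(\mathcal L_{\rho(a)}b)(x)-(\mathcal L_{\rho(b)}a)(x)$. **Proposition.** For every isotropic connection splitting $s$: 1. The 3-form $\phi_S$ is closed. 2. $\sigma$ satisfies the infinitesimal multiplicativity conditions: for all sections $a,b$ of $\mathfrak g\times S$, $$\text{(IM1)}\quad \langle\sigma(a),\rho(b)\rangle=-\langle\sigma(b),\rho(a)\rangle,$$ $$\text{(IM2)}\quad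 \sigma([a,b])=\mathcal L_{\rho(a)}\sigma(b)-i_{\rho(b)}d\sigma(a)+i_{\rho(b)}i_{\rho(a)}\phi_S .$$ 3. $\dim\mathfrak g=\dim S$, and $\ker(\rho)\cap\ker(\sigma)=\{0\}$ at every point: if $x\in S$, $u\in\mathfrak g$, $\rho(u)_x=0$ and $\sigma(u)_x=0$, then $u=0$. 4. Hence $L_S=\{(\rho(u),\sigma(u))\mid u\in\mathfrak g\}\subset TS\oplus T^*S$ is a $\phi_S$-twisted Dirac structure on $S$: it is a smooth subbundle whose fibres are maximal isotropic for the pairing $\langle(X,\alpha),(Y,\beta)\rangle=\beta(X)+\alpha(Y)$, and its space of smooth sections is closed under the $\phi_S$-twisted Courant bracket $$[\![(X,\alpha),(Y,\beta)]\!]_{\phi_S}=\big([X,Y],\ \mathcal L_X\beta-i_Yd\alpha+i_Yi_X\phi_S\big).$$ -/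

import Mathlib

open scoped Manifold ContDiff Topology

noncomputable section

namespace ManinPairs

/-! ## Alternating forms on a vector space -/

theorem update_castAdd_left {E : Type*} {p q : ℕ} (v : Fin (p + q) → E) (i : Fin p) (z : E) :
    Function.update v (Fin.castAdd q i) z ∘ Fin.castAdd q =
      Function.update (v ∘ Fin.castAdd q) i z :=
  Function.update_comp_eq_of_injective v (Fin.castAdd_injective p q) i z

theorem update_castAdd_right {E : Type*} {p q : ℕ} (v : Fin (p + q) → E) (i : Fin p) (z : E) :
    Function.update v (Fin.castAdd q i) z ∘ Fin.natAdd p = v ∘ Fin.natAdd p := by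
  funext k
  rw [Function.comp_apply, Function.update_of_ne, Function.comp_apply]
  simp only [ne_eq, Fin.ext_iff, Fin.val_natAdd, Fin.val_castAdd]
  omega

theorem update_natAdd_left {E : Type*} {p q : ℕ} (v : Fin (p + q) → E) (j : Fin q) (z : E) :
    Function.update v (Fin.natAdd p j) z ∘ Fin.castAdd q = v ∘ Fin.castAdd q := by
  funext k
  rw [Function.comp_apply, Function.update_of_ne, Function.comp_apply]
  simp only [ne_eq, Fin.ext_iff, Fin.val_natAdd, Fin.val_castAdd]
  omega

theorem update_natAdd_right {E : Type*} {p q : ℕ} (v : Fin (p + q) → E) (j : Fin q) (z : E) :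
    Function.update v (Fin.natAdd p j) z ∘ Fin.natAdd p =
      Function.update (v ∘ Fin.natAdd p) j z :=
  Function.update_comp_eq_of_injective v (Fin.natAdd_injective q p) j z

section Wedge

variable {E V W U : Type*} [AddCommGroup E] [Module ℝ E] [TopologicalSpace E]
  [NormedAddCommGroup V] [NormedSpace ℝ V] [NormedAddCommGroup W] [NormedSpace ℝ W]
  [NormedAddCommGroup U] [NormedSpace ℝ U] {p q : ℕ}

/-- The multilinear map `(v₁, …, v_{p+q}) ↦ β (θ (v₁, …, v_p)) (η (v_{p+1}, …, v_{p+q}))`. -/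
def tensorForm (β : V →L[ℝ] W →L[ℝ] U) (θ : E [⋀^Fin p]→L[ℝ] V) (η : E [⋀^Fin q]→L[ℝ] W) :
    ContinuousMultilinearMap ℝ (fun _ : Fin (p + q) => E) U where
  toFun v := β (θ (v ∘ Fin.castAdd q)) (η (v ∘ Fin.natAdd p))
  map_update_add' := by
    intro inst v i x y
    rw [Subsingleton.elim inst (instDecidableEqFin (p + q))]
    refine Fin.addCases (fun i => ?_) (fun j => ?_) i
    · rw [update_castAdd_left, update_castAdd_left, update_castAdd_left, update_castAdd_right,
        update_castAdd_right, update_castAdd_right, ContinuousAlternatingMap.map_update_add,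
        map_add]
      rfl
    · rw [update_natAdd_left, update_natAdd_left, update_natAdd_left, update_natAdd_right,
        update_natAdd_right, update_natAdd_right, ContinuousAlternatingMap.map_update_add,
        map_add]
  map_update_smul' := by
    intro inst v i c x
    rw [Subsingleton.elim inst (instDecidableEqFin (p + q))]
    refine Fin.addCases (fun i => ?_) (fun j => ?_) i
    · rw [update_castAdd_left, update_castAdd_left, update_castAdd_right, update_castAdd_right,
        ContinuousAlternatingMap.map_update_smul, map_smul]
      rfl
    · rw [update_natAdd_left, update_natAdd_left, update_natAdd_right, update_natAdd_right,
        ContinuousAlternatingMap.map_update_smul, map_smul]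
  cont := by
    refine (β.continuous.comp ?_).clm_apply ?_
    · exact θ.cont.comp (continuous_pi fun i => continuous_apply _)
    · exact η.cont.comp (continuous_pi fun i => continuous_apply _)

/-- The wedge product of vector-valued forms with respect to a bilinear map `β`, in the
determinant convention:
`(θ ∧ η)(v₁, …, v_{p+q}) = 1/(p! q!) ∑_τ sign τ • β (θ (v_{τ 1}, …)) (η (…, v_{τ (p+q)}))`. -/
def wedge (β : V →L[ℝ] W →L[ℝ] U) (θ : E [⋀^Fin p]→L[ℝ] V) (η : E [⋀^Fin q]→L[ℝ] W) :
    E [⋀^Fin (p + q)]→L[ℝ] U :=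
  ((p.factorial : ℝ) * (q.factorial : ℝ))⁻¹ •
    ContinuousMultilinearMap.alternatization (tensorForm β θ η)

/-- A linear map `α : E → V`, viewed as a 1-form. -/
def toForm (α : E →L[ℝ] V) : E [⋀^Fin 1]→L[ℝ] V :=
  ContinuousAlternatingMap.ofSubsingleton ℝ E V (0 : Fin 1) α

/-- The contraction `i_X θ = θ (X, ·)` of a 2-form. -/
def contract (θ : E [⋀^Fin 2]→L[ℝ] V) (X : E) : E →L[ℝ] V :=
  θ.toContinuousLinearMap ![X, 0] 1

/-- The contraction `i_{X ∧ Y} φ = i_Y i_X φ = φ (X, Y, ·)` of a 3-form. -/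
def contract₂ (φ : E [⋀^Fin 3]→L[ℝ] V) (X Y : E) : E →L[ℝ] V :=
  φ.toContinuousLinearMap ![X, Y, 0] 2

theorem contract_apply (θ : E [⋀^Fin 2]→L[ℝ] V) (X Z : E) : contract θ X Z = θ ![X, Z] := by
  simp only [contract, ContinuousAlternatingMap.toContinuousLinearMap_apply]
  congr 1
  funext i
  fin_cases i <;> rfl

theorem contract₂_apply (φ : E [⋀^Fin 3]→L[ℝ] V) (X Y Z : E) :
    contract₂ φ X Y Z = φ ![X, Y, Z] := by
  simp only [contract₂, ContinuousAlternatingMap.toContinuousLinearMap_apply]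
  congr 1
  funext i
  fin_cases i <;> rfl

end Wedge

/-! ## Differential forms and Dirac structures on a manifold

`M` is a manifold without boundary modelled on the vector space `E`. -/

section Manifold

variable {E : Type*} [NormedAddCommGroup E] [NormedSpace ℝ E]
  {M : Type*} [TopologicalSpace M] [ChartedSpace E M]
  {F : Type*} [NormedAddCommGroup F] [NormedSpace ℝ F] {k : ℕ}

/-- The coordinate expression of a (not necessarily smooth) `F`-valued `k`-form on `M` in the
preferred chart around `x₀`: its pullback under the inverse of the chart. -/
def chartRep (θ : ∀ x : M, TangentSpace 𝓘(ℝ, E) x [⋀^Fin k]→L[ℝ] F) (x₀ : M) (y : E) :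
    E [⋀^Fin k]→L[ℝ] F :=
  (θ ((extChartAt 𝓘(ℝ, E) x₀).symm y)).compContinuousLinearMap
    (mfderiv 𝓘(ℝ, E) 𝓘(ℝ, E) (extChartAt 𝓘(ℝ, E) x₀).symm y)

/-- Smoothness on a set `U` (meant to be open) of a `k`-form: all its coordinate expressions
are smooth. -/
def SmoothFormOn (θ : ∀ x : M, TangentSpace 𝓘(ℝ, E) x [⋀^Fin k]→L[ℝ] F) (U : Set M) : Prop :=
  ∀ x₀ : M, ContDiffOn ℝ ∞ (chartRep θ x₀)
    ((extChartAt 𝓘(ℝ, E) x₀).target ∩ (extChartAt 𝓘(ℝ, E) x₀).symm ⁻¹' U)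

/-- The exterior derivative of a `k`-form on `M`, computed at `x` in the preferred chart
around `x`. -/
def extDer (θ : ∀ x : M, TangentSpace 𝓘(ℝ, E) x [⋀^Fin k]→L[ℝ] F) (x : M) :
    TangentSpace 𝓘(ℝ, E) x [⋀^Fin (k + 1)]→L[ℝ] F :=
  (extDeriv (chartRep θ x) (extChartAt 𝓘(ℝ, E) x x)).compContinuousLinearMap
    (mfderiv 𝓘(ℝ, E) 𝓘(ℝ, E) (extChartAt 𝓘(ℝ, E) x) x)

/-- A closed `k`-form: smooth, with vanishing exterior derivative. -/
def IsClosedForm (θ : ∀ x : M, TangentSpace 𝓘(ℝ, E) x [⋀^Fin k]→L[ℝ] F) : Prop :=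
  SmoothFormOn θ Set.univ ∧ ∀ x, extDer θ x = 0

/-- The differential of a function `f : M → F` at `x`. -/
def differential (f : M → F) (x : M) : TangentSpace 𝓘(ℝ, E) x →L[ℝ] F :=
  mfderiv 𝓘(ℝ, E) 𝓘(ℝ, F) f x

/-- Smoothness of a vector field on a set. -/
def SmoothFieldOn [IsManifold 𝓘(ℝ, E) ∞ M] (X : ∀ x : M, TangentSpace 𝓘(ℝ, E) x) (U : Set M) : Prop :=
  ContMDiffOn 𝓘(ℝ, E) 𝓘(ℝ, E).tangent ∞ (fun x => (⟨x, X x⟩ : TangentBundle 𝓘(ℝ, E) M)) U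

/-- Smoothness of a 1-form `x ↦ α x ∈ T*_x M` (or with values in `F`) on a set. -/
def SmoothOneFormOn (α : ∀ x : M, TangentSpace 𝓘(ℝ, E) x →L[ℝ] F) (U : Set M) : Prop :=
  SmoothFormOn (fun x => toForm (α x)) U

/-- The exterior derivative of a 1-form. -/
def extDerOne (α : ∀ x : M, TangentSpace 𝓘(ℝ, E) x →L[ℝ] F) (x : M) :
    TangentSpace 𝓘(ℝ, E) x [⋀^Fin 2]→L[ℝ] F :=
  extDer (fun y => toForm (α y)) x

/-- The Lie derivative of a 1-form along a vector field, `L_X α = d (i_X α) + i_X d α`. -/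
def lieDer (X : ∀ x : M, TangentSpace 𝓘(ℝ, E) x)
    (α : ∀ x : M, TangentSpace 𝓘(ℝ, E) x →L[ℝ] ℝ) (x : M) : TangentSpace 𝓘(ℝ, E) x →L[ℝ] ℝ :=
  differential (fun y => α y (X y)) x + contract (extDerOne α x) (X x)

/-- The fibre at `x` of the bundle `TM ⊕ T*M`. -/
abbrev BigTangent (E : Type*) [NormedAddCommGroup E] [NormedSpace ℝ E]
    {M : Type*} [TopologicalSpace M] [ChartedSpace E M] (x : M) : Type _ :=
  TangentSpace 𝓘(ℝ, E) x × (TangentSpace 𝓘(ℝ, E) x →L[ℝ] ℝ)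

/-- The symmetric pairing `⟨(X, α), (Y, β)⟩ = β(X) + α(Y)` on `TM ⊕ T*M`. -/
def bigPairing {x : M} (e f : BigTangent E x) : ℝ := f.2 e.1 + e.2 f.1

/-- Smoothness of a section of `TM ⊕ T*M` on a set. -/
def SmoothSectionOn [IsManifold 𝓘(ℝ, E) ∞ M] (e : ∀ x : M, BigTangent E x) (U : Set M) : Prop :=
  SmoothFieldOn (fun x => (e x).1) U ∧ SmoothOneFormOn (fun x => (e x).2) U

/-- The `φ`-twisted Courant bracket
`⟦(X, α), (Y, β)⟧_φ = ([X, Y], L_X β - i_Y dα + i_Y i_X φ)`. -/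
def courant (φ : ∀ x : M, TangentSpace 𝓘(ℝ, E) x [⋀^Fin 3]→L[ℝ] ℝ)
    (e f : ∀ x : M, BigTangent E x) (x : M) : BigTangent E x :=
  (VectorField.mlieBracket 𝓘(ℝ, E) (fun y => (e y).1) (fun y => (f y).1) x,
    lieDer (fun y => (e y).1) (fun y => (f y).2) x
      - contract (extDerOne (fun y => (e y).2) x) (f x).1
      + contract₂ (φ x) (e x).1 (f x).1)

/-- A smooth subbundle of `TM ⊕ T*M`: locally spanned by a smooth frame. -/
def IsSmoothSubbundle [IsManifold 𝓘(ℝ, E) ∞ M] (L : ∀ x : M, Submodule ℝ (BigTangent E x)) : Prop :=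
  ∀ x₀ : M, ∃ U : Set M, IsOpen U ∧ x₀ ∈ U ∧ ∃ (r : ℕ) (e : Fin r → ∀ x : M, BigTangent E x),
    (∀ i, SmoothSectionOn (e i) U) ∧
    ∀ x ∈ U, LinearIndependent ℝ (fun i => e i x) ∧
      Submodule.span ℝ (Set.range fun i => e i x) = L x

/-- A subspace of `T_xM ⊕ T*_xM` is isotropic if the pairing vanishes on it. -/
def IsIsotropicAt {x : M} (K : Submodule ℝ (BigTangent E x)) : Prop :=
  ∀ e ∈ K, ∀ f ∈ K, bigPairing e f = 0

/-- An almost Dirac structure: a smooth subbundle of `TM ⊕ T*M` whose fibres are lagrangian,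
i.e. maximal isotropic. -/
structure IsAlmostDirac [IsManifold 𝓘(ℝ, E) ∞ M]
    (L : ∀ x : M, Submodule ℝ (BigTangent E x)) : Prop where
  subbundle : IsSmoothSubbundle L
  lagrangian : ∀ x, Maximal (fun K : Submodule ℝ (BigTangent E x) => IsIsotropicAt K) (L x)

/-- A `φ`-twisted Dirac structure: `φ` is a closed 3-form and `L` is an almost Dirac structure
whose space of smooth sections is closed under the `φ`-twisted Courant bracket. -/
structure IsTwistedDirac [IsManifold 𝓘(ℝ, E) ∞ M]
    (φ : ∀ x : M, TangentSpace 𝓘(ℝ, E) x [⋀^Fin 3]→L[ℝ] ℝ)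
    (L : ∀ x : M, Submodule ℝ (BigTangent E x)) : Prop where
  closed : IsClosedForm φ
  almostDirac : IsAlmostDirac L
  involutive : ∀ e f : ∀ x : M, BigTangent E x,
    SmoothSectionOn e Set.univ → SmoothSectionOn f Set.univ →
    (∀ x, e x ∈ L x) → (∀ x, f x ∈ L x) → ∀ x, courant φ e f x ∈ L x

/-- Smooth sections of the trivial bundle `𝔤 × M`, i.e. smooth functions with values in the
subspace `𝔤` of `F`. -/
def IsSmoothSection (E : Type*) [NormedAddCommGroup E] [NormedSpace ℝ E]
    {M : Type*} [TopologicalSpace M] [ChartedSpace E M] (𝔤 : Submodule ℝ F) (a : M → F) : Prop :=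
  ContMDiff 𝓘(ℝ, E) 𝓘(ℝ, F) ∞ a ∧ ∀ x, a x ∈ 𝔤

/-- The bracket of the action Lie algebroid, on sections of the trivial bundle: the pointwise
bracket `br` plus the derivatives along the anchor `ρ`,
`[a, b](x) = [a(x), b(x)] + L_{ρ(a(x))} b - L_{ρ(b(x))} a`. -/
def actionBracket (br : F →L[ℝ] F →L[ℝ] F) (ρ : ∀ x : M, F →L[ℝ] TangentSpace 𝓘(ℝ, E) x)
    (a b : M → F) (x : M) : F :=
  br (a x) (b x)
    + differential b x (ρ x (a x)) - differential a x (ρ x (b x))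

/-- The infinitesimal multiplicativity conditions for a smooth bundle map `σ : 𝔤 × M → T*M` and
a 3-form `φ`, where `𝔤 × M` is the action Lie algebroid with anchor `ρ`: for all sections
`a`, `b`,
`⟨σ(a), ρ(b)⟩ = -⟨σ(b), ρ(a)⟩` and
`σ([a, b]) = L_{ρ(a)} σ(b) - i_{ρ(b)} d(σ(a)) + i_{ρ(a) ∧ ρ(b)} φ`. -/
structure IsInfMultiplicative (br : F →L[ℝ] F →L[ℝ] F) (𝔤 : Submodule ℝ F)
    (ρ : ∀ x : M, F →L[ℝ] TangentSpace 𝓘(ℝ, E) x)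
    (σ : ∀ x : M, F →ₗ[ℝ] TangentSpace 𝓘(ℝ, E) x →L[ℝ] ℝ)
    (φ : ∀ x : M, TangentSpace 𝓘(ℝ, E) x [⋀^Fin 3]→L[ℝ] ℝ) : Prop where
  smooth : ∀ u ∈ 𝔤, SmoothOneFormOn (fun x => σ x u) Set.univ
  im1 : ∀ a b : M → F, IsSmoothSection E 𝔤 a → IsSmoothSection E 𝔤 b →
    ∀ x, σ x (a x) (ρ x (b x)) = - σ x (b x) (ρ x (a x))
  im2 : ∀ a b : M → F, IsSmoothSection E 𝔤 a → IsSmoothSection E 𝔤 b →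
    ∀ x, σ x (actionBracket br ρ a b x) =
      lieDer (fun y => ρ y (a y)) (fun y => σ y (b y)) x
        - contract (extDerOne (fun y => σ y (a y)) x) (ρ x (b x))
        + contract₂ (φ x) (ρ x (a x)) (ρ x (b x))

end Manifold

/-! ## Lie groups, with the Lie bracket of right-invariant vector fields

The Lie group `D` is modelled on the vector space `𝔡`, so that its tangent space at the identity
is, by definition, `𝔡`. -/

section LieGroup

variable {𝔡 : Type*} [NormedAddCommGroup 𝔡] [NormedSpace ℝ 𝔡]
  {D : Type*} [TopologicalSpace D] [Group D] [ChartedSpace 𝔡 D]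

/-- The right-invariant vector field `u^r` defined by `u ∈ 𝔡 = T_1 D`. -/
def rightField (D : Type*) [TopologicalSpace D] [Group D] [ChartedSpace 𝔡 D]
    (u : 𝔡) (a : D) : TangentSpace 𝓘(ℝ, 𝔡) a :=
  mfderiv 𝓘(ℝ, 𝔡) 𝓘(ℝ, 𝔡) (fun b : D => b * a) 1 u

/-- The adjoint action of `a ∈ D` on `𝔡 = T_1 D`. -/
def adjoint (a : D) (u : 𝔡) : 𝔡 :=
  mfderiv 𝓘(ℝ, 𝔡) 𝓘(ℝ, 𝔡) (fun b : D => a * b * a⁻¹) 1 u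

/-- The Lie algebra of a closed subgroup `G` of `D`, as a set: all velocities at the identity of
curves in `D` that lie in `G`. -/
def lieAlgebraOf (G : Subgroup D) : Set 𝔡 :=
  {v | ∃ γ : ℝ → D, ContMDiffAt 𝓘(ℝ, ℝ) 𝓘(ℝ, 𝔡) ∞ γ 0 ∧ (∀ t, γ t ∈ G) ∧ γ 0 = 1 ∧
    (mfderiv 𝓘(ℝ, ℝ) 𝓘(ℝ, 𝔡) γ 0 (1 : ℝ) : 𝔡) = v}

theorem rightField_add (u v : 𝔡) : rightField D (u + v) = rightField D u + rightField D v := by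
  funext a
  exact map_add (mfderiv 𝓘(ℝ, 𝔡) 𝓘(ℝ, 𝔡) (fun b : D => b * a) 1) u v

theorem rightField_smul (c : ℝ) (u : 𝔡) : rightField D (c • u) = c • rightField D u := by
  funext a
  exact map_smul (mfderiv 𝓘(ℝ, 𝔡) 𝓘(ℝ, 𝔡) (fun b : D => b * a) 1) c u

variable [LieGroup 𝓘(ℝ, 𝔡) ∞ D]

theorem contMDiff_rightField (u : 𝔡) :
    ContMDiff 𝓘(ℝ, 𝔡) 𝓘(ℝ, 𝔡).tangent ∞
      (fun a : D => (⟨a, rightField D u a⟩ : TangentBundle 𝓘(ℝ, 𝔡) D)) := by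
  let fg : D → TangentBundle 𝓘(ℝ, 𝔡) D := fun g => ⟨g, 0⟩
  have sfg : ContMDiff 𝓘(ℝ, 𝔡) 𝓘(ℝ, 𝔡).tangent ∞ fg := Bundle.contMDiff_zeroSection _ _
  let fv : D → TangentBundle 𝓘(ℝ, 𝔡) D := fun _ => ⟨1, u⟩
  have sfv : ContMDiff 𝓘(ℝ, 𝔡) 𝓘(ℝ, 𝔡).tangent ∞ fv := contMDiff_const
  have S₁ := sfv.prodMk sfg
  have S₂ := (contMDiff_equivTangentBundleProd_symm (I := 𝓘(ℝ, 𝔡)) (M := D)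
    (I' := 𝓘(ℝ, 𝔡)) (M' := D) (n := ∞))
  have S₃ : ContMDiff (𝓘(ℝ, 𝔡).prod 𝓘(ℝ, 𝔡)).tangent 𝓘(ℝ, 𝔡).tangent ∞
      (tangentMap (𝓘(ℝ, 𝔡).prod 𝓘(ℝ, 𝔡)) 𝓘(ℝ, 𝔡) (fun p : D × D => p.1 * p.2)) :=
    ContMDiff.contMDiff_tangentMap (n := ∞) (contMDiff_mul 𝓘(ℝ, 𝔡) ∞) (by simp)
  have S := (S₃.comp S₂).comp S₁
  convert! S with g
  · simp [fg, fv]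
  · simp only [Function.comp_apply, tangentMap, fg, fv]
    rw [mfderiv_prod_eq_add_apply ((contMDiff_mul 𝓘(ℝ, 𝔡) ∞).mdifferentiableAt (by simp))]
    simp +instances only [rightField]
    erw [map_zero, add_zero]
    rfl

theorem mdifferentiableAt_rightField (u : 𝔡) (a : D) :
    MDifferentiableAt 𝓘(ℝ, 𝔡) 𝓘(ℝ, 𝔡).tangent
      (fun a : D => (⟨a, rightField D u a⟩ : TangentBundle 𝓘(ℝ, 𝔡) D)) a :=
  (contMDiff_rightField u).mdifferentiable (by simp) a

variable [FiniteDimensional ℝ 𝔡]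

/-- The Lie bracket on `𝔡 = T_1 D` defined by right-invariant vector fields,
`[u, v] = [u^r, v^r](1)`, as a continuous bilinear map. -/
def lieBr (D : Type*) [TopologicalSpace D] [Group D] [ChartedSpace 𝔡 D]
    [LieGroup 𝓘(ℝ, 𝔡) ∞ D] : 𝔡 →L[ℝ] 𝔡 →L[ℝ] 𝔡 :=
  LinearMap.toContinuousBilinearMap <| LinearMap.mk₂ ℝ
    (fun u v : 𝔡 => (VectorField.mlieBracket 𝓘(ℝ, 𝔡) (rightField D u) (rightField D v) 1 : 𝔡))
    (fun u u' v => by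
      rw [rightField_add]
      exact VectorField.mlieBracket_add_left (mdifferentiableAt_rightField u 1)
        (mdifferentiableAt_rightField u' 1))
    (fun c u v => by
      rw [rightField_smul]
      exact VectorField.mlieBracket_const_smul_left (mdifferentiableAt_rightField u 1))
    (fun u v v' => by
      rw [rightField_add]
      exact VectorField.mlieBracket_add_right (mdifferentiableAt_rightField v 1)
        (mdifferentiableAt_rightField v' 1))
    (fun c u v => by
      rw [rightField_smul]
      exact VectorField.mlieBracket_const_smul_right (mdifferentiableAt_rightField v 1))

theorem lieBr_apply (u v : 𝔡) :
    lieBr D u v = VectorField.mlieBracket 𝓘(ℝ, 𝔡) (rightField D u) (rightField D v) 1 := rfl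

end LieGroup

/-! ## Manin pairs and isotropic connections -/

section ManinPair

variable {𝔡 : Type*} [NormedAddCommGroup 𝔡] [NormedSpace ℝ 𝔡] [FiniteDimensional ℝ 𝔡]
  {D : Type*} [TopologicalSpace D] [Group D] [ChartedSpace 𝔡 D] [LieGroup 𝓘(ℝ, 𝔡) ∞ D]

/-- `(𝔡, 𝔤)` is a Manin pair, where `𝔡` is the Lie algebra of `D`, of dimension `2 n`: `B` is an
Ad-invariant nondegenerate symmetric bilinear form of signature `(n, n)` on `𝔡`, and `𝔤` is a
Lie subalgebra that is a maximal isotropic subspace. -/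
structure IsManinPair (D : Type*) [TopologicalSpace D] [Group D] [ChartedSpace 𝔡 D]
    [LieGroup 𝓘(ℝ, 𝔡) ∞ D] (n : ℕ) (B : 𝔡 →L[ℝ] 𝔡 →L[ℝ] ℝ) (𝔤 : Submodule ℝ 𝔡) : Prop where
  finrank_eq : Module.finrank ℝ 𝔡 = 2 * n
  symm : ∀ u v, B u v = B v u
  nondegenerate : ∀ u, (∀ v, B u v = 0) → u = 0
  adInvariant : ∀ (a : D) (u v : 𝔡), B (adjoint a u) (adjoint a v) = B u v
  signature : ∃ b : Module.Basis (Fin n ⊕ Fin n) ℝ 𝔡,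
    (∀ i j, i ≠ j → B (b i) (b j) = 0) ∧
    (∀ i, B (b (Sum.inl i)) (b (Sum.inl i)) = 1) ∧
    (∀ i, B (b (Sum.inr i)) (b (Sum.inr i)) = -1)
  lieSubalgebra : ∀ u ∈ 𝔤, ∀ v ∈ 𝔤, lieBr D u v ∈ 𝔤
  maximalIsotropic : Maximal (fun K : Submodule ℝ 𝔡 => ∀ u ∈ K, ∀ v ∈ K, B u v = 0) 𝔤

/-- `(D, G)` is a group pair integrating the Manin pair `(𝔡, 𝔤)`: `D` is a connected Lie group
with Lie algebra `𝔡`, and `G` is a connected, closed subgroup of `D` with Lie algebra `𝔤`. -/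
structure IsGroupPair (n : ℕ) (B : 𝔡 →L[ℝ] 𝔡 →L[ℝ] ℝ) (𝔤 : Submodule ℝ 𝔡)
    (G : Subgroup D) : Prop where
  maninPair : IsManinPair D n B 𝔤
  connected : ConnectedSpace D
  isClosed : IsClosed (G : Set D)
  isConnected : IsConnected (G : Set D)
  lieAlgebra : (𝔤 : Set 𝔡) = lieAlgebraOf G

variable {G : Subgroup D} {E : Type*} [NormedAddCommGroup E] [NormedSpace ℝ E]
  [ChartedSpace E (D ⧸ G)]

/-- The manifold structure on the topological space `D ⧸ G` is the quotient one, that is, the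
projection `p : D → D ⧸ G` is a smooth submersion (this determines the smooth structure
uniquely). -/
structure IsQuotientStructure (𝔡 : Type*) [NormedAddCommGroup 𝔡] [NormedSpace ℝ 𝔡]
    {D : Type*} [TopologicalSpace D] [Group D] [ChartedSpace 𝔡 D] (E : Type*) [NormedAddCommGroup E] [NormedSpace ℝ E]
    (G : Subgroup D) [ChartedSpace E (D ⧸ G)] : Prop where
  smooth : ContMDiff 𝓘(ℝ, 𝔡) 𝓘(ℝ, E) ∞ (fun a : D => (a : D ⧸ G))
  submersion : ∀ a : D,
    Function.Surjective (mfderiv 𝓘(ℝ, 𝔡) 𝓘(ℝ, E) (fun a : D => (a : D ⧸ G)) a)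

/-- The infinitesimal dressing action: `ρ_S(u)` at `x ∈ S = D ⧸ G` is the derivative at the
identity, in the direction `u`, of the orbit map `a ↦ a • x` of left multiplication. -/
def dressing (E : Type*) [NormedAddCommGroup E] [NormedSpace ℝ E]
    (G : Subgroup D) [ChartedSpace E (D ⧸ G)] (x : D ⧸ G) : 𝔡 →L[ℝ] TangentSpace 𝓘(ℝ, E) x :=
  mfderiv 𝓘(ℝ, 𝔡) 𝓘(ℝ, E) (fun a : D => a • x) 1

/-- A connection splitting: a smooth 1-form `s ∈ Ω¹(S, 𝔡)` with `ρ_S(s(X)) = X`, isotropic in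
the sense that its image at each point is an isotropic subspace of `𝔡`. -/
structure IsIsotropicConnection (B : 𝔡 →L[ℝ] 𝔡 →L[ℝ] ℝ)
    (s : ∀ x : D ⧸ G, TangentSpace 𝓘(ℝ, E) x →L[ℝ] 𝔡) : Prop where
  smooth : SmoothOneFormOn s Set.univ
  splitting : ∀ x (X : TangentSpace 𝓘(ℝ, E) x), dressing E G x (s x X) = X
  isotropic : ∀ x (X Y : TangentSpace 𝓘(ℝ, E) x), B (s x X) (s x Y) = 0

/-- The 3-form `φ_S = 1/2 ⟨ds, s⟩ + 1/6 ⟨[s, s], s⟩`. -/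
def phiForm (B : 𝔡 →L[ℝ] 𝔡 →L[ℝ] ℝ) (s : ∀ x : D ⧸ G, TangentSpace 𝓘(ℝ, E) x →L[ℝ] 𝔡)
    (x : D ⧸ G) : TangentSpace 𝓘(ℝ, E) x [⋀^Fin 3]→L[ℝ] ℝ :=
  (1 / 2 : ℝ) • wedge B (extDerOne s x) (toForm (s x))
    + (1 / 6 : ℝ) • wedge B (wedge (lieBr D) (toForm (s x)) (toForm (s x))) (toForm (s x))

/-- The map `σ(u) = ⟨s(·), u⟩`, from `𝔡` to 1-forms on `S`. -/
def sigmaForm (B : 𝔡 →L[ℝ] 𝔡 →L[ℝ] ℝ) (s : ∀ x : D ⧸ G, TangentSpace 𝓘(ℝ, E) x →L[ℝ] 𝔡)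
    (x : D ⧸ G) : 𝔡 →ₗ[ℝ] TangentSpace 𝓘(ℝ, E) x →L[ℝ] ℝ where
  toFun u := (B.flip u).comp (s x)
  map_add' u v := by
    ext X
    simp
  map_smul' c u := by
    ext X
    simp

/-- The subspace `L_S = {(ρ(u), σ(u)) | u ∈ 𝔤}` of `T_xS ⊕ T*_xS`. -/
def diracL (B : 𝔡 →L[ℝ] 𝔡 →L[ℝ] ℝ) (𝔤 : Submodule ℝ 𝔡)
    (s : ∀ x : D ⧸ G, TangentSpace 𝓘(ℝ, E) x →L[ℝ] 𝔡) (x : D ⧸ G) :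
    Submodule ℝ (BigTangent E x) :=
  𝔤.map ((dressing E G x).toLinearMap.prod (sigmaForm B s x))

end ManinPair

end ManinPairs

end

/-!
The form `φ_S` is the Chern–Simons form of `s`, so its differential is `½⟨F, F⟩` with
`F = ds + ½[s, s]`. Since `ρ_S` is a Lie algebra action and `ρ_S ∘ s = id`, the curvature `F` takes
values in `ker ρ_S`. The kernel of `ρ_S` at `p(a)` is `Ad_a 𝔤`, hence isotropic, and `⟨F, F⟩ = 0`.

For the same reason `u ↦ (ρ_S(u), ⟨s, u⟩)` is an isometry of `𝔡` onto `T_xS ⊕ T*_xS` at every point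
`x`. It carries `𝔤` to the fibre of `L_S`, which is therefore Lagrangian. In a chart, (IM2) says
that on sections with values in `𝔤` it carries the action bracket to the `φ_S`-twisted Courant
bracket.
-/

noncomputable section

namespace ManinPairs

section Wedge

variable {E E' V W U : Type*} [AddCommGroup E] [Module ℝ E] [TopologicalSpace E]
  [AddCommGroup E'] [Module ℝ E'] [TopologicalSpace E']
  [NormedAddCommGroup V] [NormedSpace ℝ V] [NormedAddCommGroup W] [NormedSpace ℝ W]
  [NormedAddCommGroup U] [NormedSpace ℝ U] {p q : ℕ}

theorem toForm_apply (α : E →L[ℝ] V) (v : Fin 1 → E) : toForm α v = α (v 0) := rfl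

theorem tensorForm_apply (β : V →L[ℝ] W →L[ℝ] U) (θ : E [⋀^Fin p]→L[ℝ] V)
    (η : E [⋀^Fin q]→L[ℝ] W) (v : Fin (p + q) → E) :
    tensorForm β θ η v = β (θ (v ∘ Fin.castAdd q)) (η (v ∘ Fin.natAdd p)) := rfl

theorem wedge_apply (β : V →L[ℝ] W →L[ℝ] U) (θ : E [⋀^Fin p]→L[ℝ] V) (η : E [⋀^Fin q]→L[ℝ] W)
    (v : Fin (p + q) → E) :
    wedge β θ η v = ((p.factorial : ℝ) * (q.factorial : ℝ))⁻¹ •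
      ∑ τ : Equiv.Perm (Fin (p + q)), Equiv.Perm.sign τ • tensorForm β θ η (v ∘ τ) := by
  rw [wedge, ContinuousAlternatingMap.smul_apply,
    ContinuousMultilinearMap.alternatization_apply_apply]

theorem wedge_compContinuousLinearMap (β : V →L[ℝ] W →L[ℝ] U) (θ : E [⋀^Fin p]→L[ℝ] V)
    (η : E [⋀^Fin q]→L[ℝ] W) (A : E' →L[ℝ] E) :
    (wedge β θ η).compContinuousLinearMap A =
      wedge β (θ.compContinuousLinearMap A) (η.compContinuousLinearMap A) := by
  ext v
  simp only [ContinuousAlternatingMap.compContinuousLinearMap_apply, wedge_apply]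
  rfl

theorem twoForm_swap (θ : E [⋀^Fin 2]→L[ℝ] V) (X Y : E) : θ ![X, Y] = -θ ![Y, X] := by
  have map_swap : θ (![Y, X] ∘ Equiv.swap 0 1) = -θ ![Y, X] :=
    θ.toAlternatingMap.map_swap ![Y, X] (i := 0) (j := 1) (by decide)
  rw [← map_swap]
  congr 1
  funext i
  fin_cases i <;> rfl

theorem tensorForm_one_one_apply (β : V →L[ℝ] W →L[ℝ] U) (θ : E [⋀^Fin 1]→L[ℝ] V)
    (η : E [⋀^Fin 1]→L[ℝ] W) (v : Fin (1 + 1) → E) :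
    tensorForm β θ η v = β (θ ![v 0]) (η ![v 1]) := by
  refine congrArg₂ (fun x y => β x y) (congrArg θ ?_) (congrArg η ?_) <;>
  · funext i
    fin_cases i
    rfl

theorem tensorForm_two_one_apply (β : V →L[ℝ] W →L[ℝ] U) (θ : E [⋀^Fin 2]→L[ℝ] V)
    (η : E [⋀^Fin 1]→L[ℝ] W) (v : Fin (2 + 1) → E) :
    tensorForm β θ η v = β (θ ![v 0, v 1]) (η ![v 2]) := by
  refine congrArg₂ (fun x y => β x y) (congrArg θ ?_) (congrArg η ?_)
  · funext i
    fin_cases i <;> rfl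
  · funext i
    fin_cases i
    rfl

theorem univ_perm_fin_two : (Finset.univ : Finset (Equiv.Perm (Fin 2))) = {1, Equiv.swap 0 1} := by
  decide

theorem univ_perm_fin_three : (Finset.univ : Finset (Equiv.Perm (Fin 3))) =
    {1, Equiv.swap 0 1, Equiv.swap 1 2, Equiv.swap 0 2, Equiv.swap 0 1 * Equiv.swap 1 2,
      Equiv.swap 1 2 * Equiv.swap 0 1} := by
  decide

theorem wedge_one_one_apply (β : V →L[ℝ] W →L[ℝ] U) (θ : E [⋀^Fin 1]→L[ℝ] V)
    (η : E [⋀^Fin 1]→L[ℝ] W) (X Y : E) :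
    wedge β θ η ![X, Y] = β (θ ![X]) (η ![Y]) - β (θ ![Y]) (η ![X]) := by
  rw [wedge_apply, univ_perm_fin_two, Finset.sum_pair (by decide), Equiv.Perm.sign_one,
    Equiv.Perm.sign_swap (by decide)]
  simp only [tensorForm_one_one_apply]
  simp [sub_eq_add_neg]

theorem wedge_two_one_apply (β : V →L[ℝ] W →L[ℝ] U) (θ : E [⋀^Fin 2]→L[ℝ] V)
    (η : E [⋀^Fin 1]→L[ℝ] W) (X Y Z : E) :
    wedge β θ η ![X, Y, Z] =
      β (θ ![X, Y]) (η ![Z]) + β (θ ![Y, Z]) (η ![X]) + β (θ ![Z, X]) (η ![Y]) := by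
  have swap_two : Equiv.swap (0 : Fin 3) 1 2 = 2 := by decide
  have swap_zero : Equiv.swap (1 : Fin 3) 2 0 = 0 := by decide
  have swap_one : Equiv.swap (0 : Fin 3) 2 1 = 1 := by decide
  rw [wedge_apply, univ_perm_fin_three]
  repeat rw [Finset.sum_insert (by decide)]
  rw [Finset.sum_singleton]
  simp only [tensorForm_two_one_apply, Function.comp_apply, Equiv.Perm.sign_one,
    Equiv.Perm.sign_mul, Equiv.Perm.sign_swap (show (0 : Fin 3) ≠ 1 by decide),
    Equiv.Perm.sign_swap (show (1 : Fin 3) ≠ 2 by decide),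
    Equiv.Perm.sign_swap (show (0 : Fin 3) ≠ 2 by decide), Equiv.Perm.mul_apply,
    Equiv.swap_apply_left, Equiv.swap_apply_right, swap_two, swap_zero, swap_one,
    Equiv.Perm.one_apply, Matrix.cons_val_zero, Matrix.cons_val_one, Matrix.cons_val]
  rw [twoForm_swap θ Y X, twoForm_swap θ X Z, twoForm_swap θ Z Y]
  simp only [one_smul, mul_neg, mul_one, neg_neg, map_neg, neg_apply, Units.neg_smul,
    Nat.factorial]
  norm_num
  module

end Wedge

section NormedForms

variable {E V W U : Type*} [NormedAddCommGroup E] [NormedSpace ℝ E]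
  [NormedAddCommGroup V] [NormedSpace ℝ V] [NormedAddCommGroup W] [NormedSpace ℝ W]
  [NormedAddCommGroup U] [NormedSpace ℝ U] {p q : ℕ}

theorem contDiff_toForm {n : WithTop ℕ∞} :
    ContDiff ℝ n (toForm : (E →L[ℝ] V) → E [⋀^Fin 1]→L[ℝ] V) :=
  (ContinuousAlternatingMap.ofSubsingletonLIE (𝕜 := ℝ) (E := E) (F := V) (0 : Fin 1)).contDiff

theorem norm_tensorForm_le (β : V →L[ℝ] W →L[ℝ] U) (θ : E [⋀^Fin p]→L[ℝ] V)
    (η : E [⋀^Fin q]→L[ℝ] W) : ‖tensorForm β θ η‖ ≤ ‖β‖ * ‖θ‖ * ‖η‖ := by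
  refine ContinuousMultilinearMap.opNorm_le_bound (by positivity) fun v => ?_
  calc ‖β (θ (v ∘ Fin.castAdd q)) (η (v ∘ Fin.natAdd p))‖
      ≤ ‖β‖ * ‖θ (v ∘ Fin.castAdd q)‖ * ‖η (v ∘ Fin.natAdd p)‖ := β.le_opNorm₂ _ _
    _ ≤ ‖β‖ * (‖θ‖ * ∏ i, ‖v (Fin.castAdd q i)‖) * (‖η‖ * ∏ i, ‖v (Fin.natAdd p i)‖) := by
        gcongr
        · exact θ.le_opNorm _
        · exact η.le_opNorm _
    _ = ‖β‖ * ‖θ‖ * ‖η‖ * ∏ i, ‖v i‖ := by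
        rw [Fin.prod_univ_add]
        ring

theorem norm_sign_smul_tensorForm_le (β : V →L[ℝ] W →L[ℝ] U) (θ : E [⋀^Fin p]→L[ℝ] V)
    (η : E [⋀^Fin q]→L[ℝ] W) (τ : Equiv.Perm (Fin (p + q))) (v : Fin (p + q) → E) :
    ‖Equiv.Perm.sign τ • tensorForm β θ η (v ∘ τ)‖ ≤ ‖β‖ * ‖θ‖ * ‖η‖ * ∏ i, ‖v i‖ :=
  calc ‖Equiv.Perm.sign τ • tensorForm β θ η (v ∘ τ)‖ = ‖tensorForm β θ η (v ∘ τ)‖ := by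
        rcases Int.units_eq_one_or (Equiv.Perm.sign τ) with h | h <;> simp [h]
    _ ≤ ‖β‖ * ‖θ‖ * ‖η‖ * ∏ i, ‖v (τ i)‖ :=
        ContinuousMultilinearMap.le_of_opNorm_le (norm_tensorForm_le β θ η) _
    _ = ‖β‖ * ‖θ‖ * ‖η‖ * ∏ i, ‖v i‖ := by
        rw [Equiv.prod_comp τ fun i => ‖v i‖]

theorem norm_wedge_le (β : V →L[ℝ] W →L[ℝ] U) (θ : E [⋀^Fin p]→L[ℝ] V)
    (η : E [⋀^Fin q]→L[ℝ] W) : ‖wedge β θ η‖ ≤ ((p + q).factorial * ‖β‖) * ‖θ‖ * ‖η‖ := by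
  refine ContinuousAlternatingMap.opNorm_le_bound _ (by positivity) fun v => ?_
  have norm_coeff_le : ‖((p.factorial : ℝ) * (q.factorial : ℝ))⁻¹‖ ≤ 1 := by
    rw [norm_inv, Real.norm_of_nonneg (by positivity)]
    apply inv_le_one_of_one_le₀
    exact_mod_cast Nat.one_le_iff_ne_zero.2 (by positivity)
  rw [wedge_apply, norm_smul]
  calc _ ≤ 1 * ∑ _τ : Equiv.Perm (Fin (p + q)), ‖β‖ * ‖θ‖ * ‖η‖ * ∏ i, ‖v i‖ := by
        gcongr
        exact norm_sum_le_of_le _ fun τ _ => norm_sign_smul_tensorForm_le β θ η τ v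
    _ = ((p + q).factorial * ‖β‖) * ‖θ‖ * ‖η‖ * ∏ i, ‖v i‖ := by
        rw [one_mul, Finset.sum_const, Finset.card_univ, Fintype.card_perm, Fintype.card_fin,
          nsmul_eq_mul]
        ring

theorem isBoundedBilinearMap_wedge (β : V →L[ℝ] W →L[ℝ] U) :
    IsBoundedBilinearMap ℝ
      (fun x : (E [⋀^Fin p]→L[ℝ] V) × (E [⋀^Fin q]→L[ℝ] W) => wedge β x.1 x.2) where
  add_left θ θ' η := by
    ext v
    simp [wedge_apply, tensorForm_apply, Finset.sum_add_distrib]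
  smul_left c θ η := by
    ext v
    simp only [wedge_apply, tensorForm_apply, ContinuousAlternatingMap.smul_apply, map_smul,
      smul_apply, smul_comm _ c, Finset.smul_sum]
  add_right θ η η' := by
    ext v
    simp [wedge_apply, tensorForm_apply, Finset.sum_add_distrib]
  smul_right c θ η := by
    ext v
    simp only [wedge_apply, tensorForm_apply, ContinuousAlternatingMap.smul_apply, map_smul,
      smul_comm _ c, Finset.smul_sum]
  bound := by
    refine ⟨(p + q).factorial * ‖β‖ + 1, by positivity, fun θ η => (norm_wedge_le β θ η).trans ?_⟩
    gcongr
    linarith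

/-- The exterior derivative `ds (X, Y)` at `y` of a 1-form `s` on a vector space, as a function of
two vectors. -/
def extDerivOne (s : E → E →L[ℝ] V) (y X Y : E) : V := fderiv ℝ s y X Y - fderiv ℝ s y Y X

theorem extDeriv_toForm_apply {s : E → E →L[ℝ] V} {y : E} (hs : DifferentiableAt ℝ s y) (X Y : E) :
    extDeriv (fun z => toForm (s z)) y ![X, Y] = extDerivOne s y X Y := by
  have differentiableAt_toForm : DifferentiableAt ℝ (fun z => toForm (s z)) y :=
    ((contDiff_toForm (n := 1)).differentiable one_ne_zero).differentiableAt.comp y hs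
  have fderiv_apply (w v : E) : fderiv ℝ (fun z => s z w) y v = fderiv ℝ s y v w := by
    rw [fderiv_clm_apply hs (differentiableAt_const w)]
    simp
  rw [extDeriv_apply differentiableAt_toForm, Fin.sum_univ_two]
  simp only [toForm_apply]
  simp [Fin.removeNth, extDerivOne, fderiv_apply, sub_eq_add_neg]

theorem fderiv_bilinear_apply (B : V →L[ℝ] W →L[ℝ] U) {f : E → V} {g : E → W} {y : E}
    (hf : DifferentiableAt ℝ f y) (hg : DifferentiableAt ℝ g y) (w : E) :
    fderiv ℝ (fun z => B (f z) (g z)) y w =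
      B (fderiv ℝ f y w) (g y) + B (f y) (fderiv ℝ g y w) := by
  rw [B.fderiv_of_bilinear hf hg]
  simp [add_comm]

end NormedForms

section ChernSimons

theorem two_le_infty : (2 : WithTop ℕ∞) ≤ ∞ :=
  WithTop.coe_le_coe.2 (le_top : (2 : ℕ∞) ≤ ⊤)

theorem minSmoothness_two_le_infty : minSmoothness ℝ 2 ≤ (∞ : WithTop ℕ∞) := by
  simpa using two_le_infty

variable {E V F : Type*} [NormedAddCommGroup E] [NormedSpace ℝ E]
  [NormedAddCommGroup V] [NormedSpace ℝ V] [NormedAddCommGroup F] [NormedSpace ℝ F]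

/-- A space `V` with an antisymmetric bracket `br` and an invariant symmetric bilinear form `B`;
if `br` also satisfies the Jacobi identity and `B` is nondegenerate, this is a quadratic Lie
algebra. -/
structure IsQuadratic (B : V →L[ℝ] V →L[ℝ] ℝ) (br : V →L[ℝ] V →L[ℝ] V) : Prop where
  symm : ∀ u v, B u v = B v u
  skew : ∀ u v, br u v = -br v u
  invariant : ∀ w u v, B (br w u) v + B u (br w v) = 0

/-- The curvature `F = ds + 1/2 [s, s]` of a `V`-valued 1-form `s` on a vector space, as a
function of two vectors. -/
def curvature (br : V →L[ℝ] V →L[ℝ] V) (s : E → E →L[ℝ] V) (y X Y : E) : V :=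
  extDerivOne s y X Y + br (s y X) (s y Y)

/-- The Chern–Simons 3-form `1/2 ⟨ds, s⟩ + 1/6 ⟨[s, s], s⟩` of a `V`-valued 1-form `s` on a vector
space: the coordinate expression of `phiForm`. -/
def chernSimons (B : V →L[ℝ] V →L[ℝ] ℝ) (br : V →L[ℝ] V →L[ℝ] V) (s : E → E →L[ℝ] V) (y : E) :
    E [⋀^Fin 3]→L[ℝ] ℝ :=
  (1 / 2 : ℝ) • wedge B (extDeriv (fun z => toForm (s z)) y) (toForm (s y))
    + (1 / 6 : ℝ) • wedge B (wedge br (toForm (s y)) (toForm (s y))) (toForm (s y))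

variable {B : V →L[ℝ] V →L[ℝ] ℝ} {br : V →L[ℝ] V →L[ℝ] V} {s : E → E →L[ℝ] V} {y : E}

theorem IsQuadratic.rotate (h : IsQuadratic B br) (u v w : V) :
    B (br u v) w = B (br v w) u := by
  have invariant := h.invariant v u w
  rw [h.skew u v, map_neg, neg_apply, h.symm (br v w) u]
  linarith

theorem IsQuadratic.swap (h : IsQuadratic B br) (u v w : V) :
    B (br u v) w = -B (br v u) w := by
  rw [h.skew u v, map_neg, neg_apply]

theorem IsQuadratic.jacobi (h : IsQuadratic B br)
    (jac : ∀ u v w, br u (br v w) = br (br u v) w + br v (br u w)) (a b c d : V) :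
    B (br a b) (br c d) - B (br a c) (br b d) + B (br a d) (br b c) = 0 := by
  have jac_pair := congrArg (B a) (jac b c d)
  rw [h.skew (br b c), map_add, map_neg] at jac_pair
  rw [h.rotate a b, h.rotate a c, h.rotate a d, h.symm _ a, h.symm _ a, h.symm _ a, jac_pair]
  ring

theorem chernSimons_apply (h : IsQuadratic B br) (hs : DifferentiableAt ℝ s y) (X Y Z : E) :
    chernSimons B br s y ![X, Y, Z] =
      (1 / 2 : ℝ) * (B (extDerivOne s y X Y) (s y Z) + B (extDerivOne s y Y Z) (s y X)
        + B (extDerivOne s y Z X) (s y Y))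
      + B (br (s y X) (s y Y)) (s y Z) := by
  simp only [chernSimons, ContinuousAlternatingMap.add_apply, ContinuousAlternatingMap.smul_apply,
    wedge_two_one_apply, wedge_one_one_apply, extDeriv_toForm_apply hs, smul_eq_mul, toForm_apply,
    Matrix.cons_val_zero, map_sub, sub_apply]
  linarith [h.rotate (s y X) (s y Y) (s y Z), h.rotate (s y Y) (s y Z) (s y X),
    h.swap (s y X) (s y Y) (s y Z), h.swap (s y Y) (s y Z) (s y X), h.swap (s y Z) (s y X) (s y Y)]

theorem contDiffAt_extDeriv {k : ℕ} {θ : E → E [⋀^Fin k]→L[ℝ] F} (h : ContDiffAt ℝ ∞ θ y) :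
    ContDiffAt ℝ ∞ (extDeriv θ) y := by
  have fderiv_smooth : ContDiffAt ℝ ∞ (fderiv ℝ θ) y := h.fderiv_right (by simp)
  exact (ContinuousAlternatingMap.alternatizeUncurryFinCLM ℝ E F).contDiff.contDiffAt.comp y
    fderiv_smooth

theorem contDiffAt_chernSimons (hs : ContDiffAt ℝ ∞ s y) :
    ContDiffAt ℝ ∞ (chernSimons B br s) y := by
  have form : ContDiffAt ℝ ∞ (fun z => toForm (s z)) y := contDiff_toForm.contDiffAt.comp y hs
  have pair_der := (isBoundedBilinearMap_wedge B).contDiff.contDiffAt.comp y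
    ((contDiffAt_extDeriv form).prodMk form)
  have bracket := (isBoundedBilinearMap_wedge br).contDiff.contDiffAt.comp y (form.prodMk form)
  have pair_bracket := (isBoundedBilinearMap_wedge B).contDiff.contDiffAt.comp y
    (bracket.prodMk form)
  exact (pair_der.const_smul (1 / 2 : ℝ)).add (pair_bracket.const_smul (1 / 6 : ℝ))

theorem hasFDerivAt_form_apply (hs : DifferentiableAt ℝ s y) (X : E) :
    HasFDerivAt (fun z => s z X) ((fderiv ℝ s y).flip X) y :=
  (ContinuousLinearMap.apply ℝ V X).hasFDerivAt.comp y hs.hasFDerivAt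

theorem hasFDerivAt_extDerivOne (hs : DifferentiableAt ℝ (fderiv ℝ s) y) (X Y : E) :
    HasFDerivAt (fun z => extDerivOne s z X Y)
      (((fderiv ℝ (fderiv ℝ s) y).flip X).flip Y -
        ((fderiv ℝ (fderiv ℝ s) y).flip Y).flip X) y := by
  have deriv_apply (P Q : E) : HasFDerivAt (fun z => fderiv ℝ s z P Q)
      (((fderiv ℝ (fderiv ℝ s) y).flip P).flip Q) y :=
    (ContinuousLinearMap.apply ℝ V Q).hasFDerivAt.comp y (hasFDerivAt_form_apply hs P)
  exact (deriv_apply X Y).sub (deriv_apply Y X)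

theorem fderiv_chernSimons_apply (h : IsQuadratic B br) (hs : ContDiffAt ℝ 2 s y) (W X Y Z : E) :
    fderiv ℝ (fun z => chernSimons B br s z ![X, Y, Z]) y W =
      (1 / 2 : ℝ) * (
          B (fderiv ℝ (fderiv ℝ s) y W X Y - fderiv ℝ (fderiv ℝ s) y W Y X) (s y Z)
        + B (extDerivOne s y X Y) (fderiv ℝ s y W Z)
        + (B (fderiv ℝ (fderiv ℝ s) y W Y Z - fderiv ℝ (fderiv ℝ s) y W Z Y) (s y X)
        + B (extDerivOne s y Y Z) (fderiv ℝ s y W X))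
        + (B (fderiv ℝ (fderiv ℝ s) y W Z X - fderiv ℝ (fderiv ℝ s) y W X Z) (s y Y)
        + B (extDerivOne s y Z X) (fderiv ℝ s y W Y)))
      + (B (br (s y Y) (s y Z)) (fderiv ℝ s y W X) + B (br (s y Z) (s y X)) (fderiv ℝ s y W Y)
        + B (br (s y X) (s y Y)) (fderiv ℝ s y W Z)) := by
  have hs₁ : DifferentiableAt ℝ s y := hs.differentiableAt (by simp)
  have hs₂ : DifferentiableAt ℝ (fderiv ℝ s) y :=
    (hs.fderiv_right (m := 1) (by norm_num)).differentiableAt (by simp)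
  have formula : (fun z => chernSimons B br s z ![X, Y, Z]) =ᶠ[𝓝 y] fun z =>
      (1 / 2 : ℝ) * (B (extDerivOne s z X Y) (s z Z) + B (extDerivOne s z Y Z) (s z X)
        + B (extDerivOne s z Z X) (s z Y)) + B (br (s z X) (s z Y)) (s z Z) := by
    filter_upwards [hs.eventually (by simp)] with z hz
    exact chernSimons_apply h (hz.differentiableAt (by simp)) X Y Z
  have der_pair (P Q R : E) := B.hasFDerivAt_of_bilinear (hasFDerivAt_extDerivOne hs₂ P Q)
    (hasFDerivAt_form_apply hs₁ R)
  have der_triple := B.hasFDerivAt_of_bilinear (br.hasFDerivAt_of_bilinear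
    (hasFDerivAt_form_apply hs₁ X) (hasFDerivAt_form_apply hs₁ Y)) (hasFDerivAt_form_apply hs₁ Z)
  rw [(((((der_pair X Y Z).add (der_pair Y Z X)).add (der_pair Z X Y)).const_mul
    (1 / 2)).add der_triple |>.congr_of_eventuallyEq formula).fderiv]
  simp only [add_apply, smul_apply, ContinuousLinearMap.precompR_apply,
    ContinuousLinearMap.precompL_apply, ContinuousLinearMap.compL_apply,
    ContinuousLinearMap.comp_apply, sub_apply, ContinuousLinearMap.flip_apply, map_add,
    smul_eq_mul]
  linear_combination h.rotate (fderiv ℝ s y W X) (s y Y) (s y Z)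
    + h.rotate (s y X) (fderiv ℝ s y W Y) (s y Z) + h.rotate (fderiv ℝ s y W Y) (s y Z) (s y X)

theorem extDeriv_threeForm_apply {θ : E → E [⋀^Fin 3]→L[ℝ] F} (hθ : DifferentiableAt ℝ θ y)
    (a b c d : E) :
    extDeriv θ y ![a, b, c, d] =
      fderiv ℝ (fun z => θ z ![b, c, d]) y a - fderiv ℝ (fun z => θ z ![a, c, d]) y b
        + fderiv ℝ (fun z => θ z ![a, b, d]) y c - fderiv ℝ (fun z => θ z ![a, b, c]) y d := by
  have remove_zero : (0 : Fin 4).removeNth ![a, b, c, d] = ![b, c, d] := by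
    funext i; fin_cases i <;> rfl
  have remove_one : (1 : Fin 4).removeNth ![a, b, c, d] = ![a, c, d] := by
    funext i; fin_cases i <;> rfl
  have remove_two : (2 : Fin 4).removeNth ![a, b, c, d] = ![a, b, d] := by
    funext i; fin_cases i <;> rfl
  have remove_three : (3 : Fin 4).removeNth ![a, b, c, d] = ![a, b, c] := by
    funext i; fin_cases i <;> rfl
  rw [extDeriv_apply hθ, Fin.sum_univ_four, remove_zero, remove_one, remove_two, remove_three]
  simp [pow_succ, sub_eq_add_neg]

/-- The transgression formula `d CS = 1/2 ⟨F, F⟩`. -/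
theorem extDeriv_chernSimons_apply (h : IsQuadratic B br)
    (jac : ∀ u v w, br u (br v w) = br (br u v) w + br v (br u w))
    (hs : ContDiffAt ℝ ∞ s y) (a b c d : E) :
    extDeriv (chernSimons B br s) y ![a, b, c, d] =
      B (curvature br s y a b) (curvature br s y c d)
        - B (curvature br s y a c) (curvature br s y b d)
        + B (curvature br s y a d) (curvature br s y b c) := by
  have sndDeriv_symm (P Q) : fderiv ℝ (fderiv ℝ s) y P Q = fderiv ℝ (fderiv ℝ s) y Q P :=
    hs.isSymmSndFDerivAt minSmoothness_two_le_infty P Q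
  have pair_swap (v : V) (P Q) :
      B v (fderiv ℝ s y P Q) = B v (fderiv ℝ s y Q P) - B v (extDerivOne s y Q P) := by
    simp [extDerivOne]
  have swap (P Q) : extDerivOne s y P Q = -extDerivOne s y Q P := by
    simp [extDerivOne]
  have hs₂ : ContDiffAt ℝ 2 s y := hs.of_le two_le_infty
  rw [extDeriv_threeForm_apply ((contDiffAt_chernSimons hs).differentiableAt (by simp))]
  simp only [fderiv_chernSimons_apply h hs₂, curvature]
  rw [sndDeriv_symm b a, sndDeriv_symm c a, sndDeriv_symm d a, sndDeriv_symm c b,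
    sndDeriv_symm d b, sndDeriv_symm d c, swap d b, swap c a, swap d a,
    h.skew (s y d) (s y a), h.skew (s y c) (s y a), h.skew (s y d) (s y b)]
  simp only [map_add, map_sub, map_neg, add_apply, neg_apply, sub_apply, pair_swap _ b a,
    pair_swap _ c a, pair_swap _ d a, pair_swap _ c b, pair_swap _ d b, pair_swap _ d c]
  have jacobi := h.jacobi jac (s y a) (s y b) (s y c) (s y d)
  generalize extDerivOne s y = ds, fderiv ℝ (fderiv ℝ s) y = dds, fderiv ℝ s y = ds', s y = s₀
    at jacobi ⊢
  linarith [h.symm (ds c d) (ds a b), h.symm (ds b d) (ds a c), h.symm (ds b c) (ds a d),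
    h.symm (br (s₀ c) (s₀ d)) (ds a b), h.symm (br (s₀ b) (s₀ d)) (ds a c),
    h.symm (br (s₀ b) (s₀ c)) (ds a d)]

end ChernSimons

section LinearSplitting

variable {V W : Type*} [NormedAddCommGroup V] [NormedSpace ℝ V]
  [AddCommGroup W] [Module ℝ W] [TopologicalSpace W]

/-- `s` is a right inverse with isotropic values of the linear map `R`, whose kernel is isotropic
as well: the pointwise datum of an isotropic connection splitting. -/
structure IsIsotropicSplitting (B : V →L[ℝ] V →L[ℝ] ℝ) (R : V →L[ℝ] W) (s : W →L[ℝ] V) :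
    Prop where
  splitting : ∀ X, R (s X) = X
  isotropic : ∀ X Y, B (s X) (s Y) = 0
  ker_isotropic : ∀ u v, R u = 0 → R v = 0 → B u v = 0

/-- The map `u ↦ (R u, ⟨s ·, u⟩)` from `V` to `W ⊕ W*`; with `R` the infinitesimal dressing action
it carries `𝔤` to `diracL`. -/
def splittingMap (B : V →L[ℝ] V →L[ℝ] ℝ) (R : V →L[ℝ] W) (s : W →L[ℝ] V) :
    V →ₗ[ℝ] W × (W →L[ℝ] ℝ) where
  toFun u := (R u, (B.flip u).comp s)
  map_add' u v := by ext <;> simp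
  map_smul' c u := by ext <;> simp

theorem splittingMap_fst (B : V →L[ℝ] V →L[ℝ] ℝ) (R : V →L[ℝ] W) (s : W →L[ℝ] V) (u : V) :
    (splittingMap B R s u).1 = R u := rfl

theorem splittingMap_snd_apply (B : V →L[ℝ] V →L[ℝ] ℝ) (R : V →L[ℝ] W) (s : W →L[ℝ] V) (u : V)
    (X : W) : (splittingMap B R s u).2 X = B (s X) u := rfl

namespace IsIsotropicSplitting

variable {B : V →L[ℝ] V →L[ℝ] ℝ} {R : V →L[ℝ] W} {s : W →L[ℝ] V}

/-- `1 - sR` takes values in the isotropic subspace `ker R`, so it is the adjoint of `sR`. -/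
theorem pairing_splitting_anchor (h : IsIsotropicSplitting B R s) (u v : V) :
    B (s (R u)) v + B u (s (R v)) = B u v := by
  have complement := h.ker_isotropic (u - s (R u)) (v - s (R v))
    (by rw [map_sub, h.splitting, sub_self]) (by rw [map_sub, h.splitting, sub_self])
  simp only [map_sub, sub_apply, h.isotropic] at complement
  linarith

theorem pairing_splittingMap (h : IsIsotropicSplitting B R s) (symm : ∀ u v, B u v = B v u)
    (u v : V) :
    (splittingMap B R s v).2 (splittingMap B R s u).1 +
      (splittingMap B R s u).2 (splittingMap B R s v).1 = B u v := by
  rw [splittingMap_snd_apply, splittingMap_snd_apply, splittingMap_fst, splittingMap_fst,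
    symm (s (R v))]
  exact h.pairing_splitting_anchor u v

theorem splittingMap_injective (h : IsIsotropicSplitting B R s) (symm : ∀ u v, B u v = B v u)
    (nondegenerate : ∀ u, (∀ v, B u v = 0) → u = 0) :
    Function.Injective (splittingMap B R s) := by
  refine (injective_iff_map_eq_zero _).2 fun u hu => nondegenerate u fun v => ?_
  rw [← h.pairing_splittingMap symm, hu]
  simp

theorem maximal_isotropic_ker (h : IsIsotropicSplitting B R s)
    (nondegenerate : ∀ u, (∀ v, B u v = 0) → u = 0) :
    Maximal (fun K : Submodule ℝ V => ∀ u ∈ K, ∀ v ∈ K, B u v = 0)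
      (LinearMap.ker R.toLinearMap) := by
  refine ⟨fun u hu v hv => h.ker_isotropic u v hu hv, fun K isotropic ker_le u hu => ?_⟩
  have splitting_zero : s (R u) = 0 := nondegenerate _ fun v => by
    have mem_ker : v - s (R v) ∈ LinearMap.ker R.toLinearMap := by
      simp [LinearMap.mem_ker, h.splitting]
    have orthogonal := isotropic u hu _ (ker_le mem_ker)
    rw [map_sub] at orthogonal
    linarith [h.pairing_splitting_anchor u v]
  rw [LinearMap.mem_ker, ContinuousLinearMap.coe_coe, ← h.splitting (R u), splitting_zero, map_zero]

variable [FiniteDimensional ℝ V]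

theorem splittingMap_surjective (h : IsIsotropicSplitting B R s) (symm : ∀ u v, B u v = B v u)
    (nondegenerate : ∀ u, (∀ v, B u v = 0) → u = 0) :
    Function.Surjective (splittingMap B R s) := by
  rintro ⟨X, α⟩
  have injective : Function.Injective B.toLinearMap₁₂ :=
    (injective_iff_map_eq_zero _).2 fun u hu => nondegenerate u (DFunLike.congr_fun hu)
  have surjective : Function.Surjective B.toLinearMap₁₂ :=
    (LinearMap.injective_iff_surjective_of_finrank_eq_finrank
      (Subspace.dual_finrank_eq (K := ℝ) (V := V)).symm).1 injective
  obtain ⟨u, hu⟩ := surjective (α.comp R).toLinearMap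
  have pairing_u (v) : B u v = α (R v) := DFunLike.congr_fun hu v
  refine ⟨u - s (R u) + s X, Prod.ext ?_ ?_⟩
  · simp [splittingMap_fst, h.splitting]
  · ext Z
    rw [splittingMap_snd_apply, map_add, map_sub, h.isotropic, h.isotropic, symm, pairing_u,
      h.splitting]
    simp

theorem maximal_isotropic_map (h : IsIsotropicSplitting B R s) (symm : ∀ u v, B u v = B v u)
    (nondegenerate : ∀ u, (∀ v, B u v = 0) → u = 0) {𝔤 : Submodule ℝ V}
    (maximal : Maximal (fun K : Submodule ℝ V => ∀ u ∈ K, ∀ v ∈ K, B u v = 0) 𝔤) :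
    Maximal (fun K : Submodule ℝ (W × (W →L[ℝ] ℝ)) => ∀ e ∈ K, ∀ f ∈ K, f.2 e.1 + e.2 f.1 = 0)
      (𝔤.map (splittingMap B R s)) := by
  refine ⟨?_, fun K isotropic map_le => ?_⟩
  · rintro _ ⟨u, hu, rfl⟩ _ ⟨v, hv, rfl⟩
    rw [h.pairing_splittingMap symm]
    exact maximal.prop u hu v hv
  · have comap_le : K.comap (splittingMap B R s) ≤ 𝔤 := by
      refine maximal.le_of_ge (fun u hu v hv => ?_) (Submodule.map_le_iff_le_comap.1 map_le)
      rw [← h.pairing_splittingMap symm]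
      exact isotropic _ hu _ hv
    intro e he
    obtain ⟨u, rfl⟩ := h.splittingMap_surjective symm nondegenerate e
    exact ⟨u, comap_le he, rfl⟩

end IsIsotropicSplitting

end LinearSplitting

section NormedSplitting

variable {V W : Type*} [NormedAddCommGroup V] [NormedSpace ℝ V] [FiniteDimensional ℝ V]
  [NormedAddCommGroup W] [NormedSpace ℝ W] {B : V →L[ℝ] V →L[ℝ] ℝ}

namespace IsIsotropicSplitting

variable {R : V →L[ℝ] W} {s : W →L[ℝ] V}

theorem finiteDimensional (h : IsIsotropicSplitting B R s) : FiniteDimensional ℝ W :=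
  FiniteDimensional.of_surjective R.toLinearMap fun X => ⟨s X, h.splitting X⟩

theorem finrank_eq (h : IsIsotropicSplitting B R s) (symm : ∀ u v, B u v = B v u)
    (nondegenerate : ∀ u, (∀ v, B u v = 0) → u = 0) :
    Module.finrank ℝ V = 2 * Module.finrank ℝ W := by
  have := h.finiteDimensional
  rw [(LinearEquiv.ofBijective (splittingMap B R s) ⟨h.splittingMap_injective symm nondegenerate,
    h.splittingMap_surjective symm nondegenerate⟩).finrank_eq, Module.finrank_prod,
    ← (LinearMap.toContinuousLinearMap (𝕜 := ℝ) (E := W) (F' := ℝ)).finrank_eq,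
    Module.finrank_linearMap_self]
  ring

theorem finrank_ker (h : IsIsotropicSplitting B R s) (symm : ∀ u v, B u v = B v u)
    (nondegenerate : ∀ u, (∀ v, B u v = 0) → u = 0) :
    Module.finrank ℝ (LinearMap.ker R.toLinearMap) = Module.finrank ℝ W := by
  have range_eq_top : LinearMap.range R.toLinearMap = ⊤ :=
    LinearMap.range_eq_top.2 fun X => ⟨s X, h.splitting X⟩
  have rank_nullity := LinearMap.finrank_range_add_finrank_ker R.toLinearMap
  rw [range_eq_top, finrank_top, h.finrank_eq symm nondegenerate] at rank_nullity
  omega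

theorem isInvertible_splittingMap (h : IsIsotropicSplitting B R s) (symm : ∀ u v, B u v = B v u)
    (nondegenerate : ∀ u, (∀ v, B u v = 0) → u = 0) :
    (LinearMap.toContinuousLinearMap (splittingMap B R s)).IsInvertible :=
  ⟨(LinearEquiv.ofBijective (splittingMap B R s) ⟨h.splittingMap_injective symm nondegenerate,
    h.splittingMap_surjective symm nondegenerate⟩).toContinuousLinearEquiv, rfl⟩

end IsIsotropicSplitting

theorem contDiffOn_splittingMap {E : Type*} [NormedAddCommGroup E] [NormedSpace ℝ E]
    {R : E → V →L[ℝ] W} {s : E → W →L[ℝ] V} {T : Set E} (hR : ContDiffOn ℝ ∞ R T)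
    (hs : ContDiffOn ℝ ∞ s T) :
    ContDiffOn ℝ ∞ (fun z => LinearMap.toContinuousLinearMap (splittingMap B (R z) (s z))) T :=
  contDiffOn_clm_apply.2 fun _ =>
    (hR.clm_apply contDiffOn_const).prodMk (contDiffOn_const.clm_comp hs)

end NormedSplitting

section IsotropicSplitting

variable {E V : Type*} [NormedAddCommGroup E] [NormedSpace ℝ E]
  [NormedAddCommGroup V] [NormedSpace ℝ V]

/-- The coordinate picture near `y` of an isotropic connection splitting: `R` is the infinitesimal
action of `V` on `E`, with isotropic stabiliser at `y`, and `s` is a right inverse of `R` with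
isotropic values. -/
structure IsIsotropicSplittingAt (B : V →L[ℝ] V →L[ℝ] ℝ) (br : V →L[ℝ] V →L[ℝ] V)
    (s : E → E →L[ℝ] V) (R : E → V →L[ℝ] E) (y : E) : Prop where
  differentiable_splitting : DifferentiableAt ℝ s y
  differentiable_anchor : DifferentiableAt ℝ R y
  splitting : ∀ᶠ z in 𝓝 y, ∀ X, R z (s z X) = X
  isotropic : ∀ᶠ z in 𝓝 y, ∀ X Y, B (s z X) (s z Y) = 0
  stabiliser_isotropic : ∀ u v, R y u = 0 → R y v = 0 → B u v = 0
  anchor_bracket : ∀ u v, fderiv ℝ R y (R y u) v - fderiv ℝ R y (R y v) u = R y (br u v)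

namespace IsIsotropicSplittingAt

variable {B : V →L[ℝ] V →L[ℝ] ℝ} {br : V →L[ℝ] V →L[ℝ] V} {s : E → E →L[ℝ] V}
  {R : E → V →L[ℝ] E} {y : E}

theorem anchor_splitting (hs : IsIsotropicSplittingAt B br s R y) (X : E) : R y (s y X) = X :=
  hs.splitting.self_of_nhds X

theorem fderiv_splitting (hs : IsIsotropicSplittingAt B br s R y) (P Q : E) :
    fderiv ℝ R y P (s y Q) = -R y (fderiv ℝ s y P Q) := by
  have const : (fun z => R z (s z Q)) =ᶠ[𝓝 y] fun _ => Q := by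
    filter_upwards [hs.splitting] with z hz using hz Q
  have derivative := DFunLike.congr_fun (const.fderiv_eq (𝕜 := ℝ)) P
  rw [fderiv_clm_apply hs.differentiable_anchor
      (hs.differentiable_splitting.clm_apply (differentiableAt_const Q)),
    fderiv_clm_apply hs.differentiable_splitting (differentiableAt_const Q)] at derivative
  exact eq_neg_of_add_eq_zero_right (by simpa using derivative)

theorem fderiv_isotropic (hs : IsIsotropicSplittingAt B br s R y) (P Q Q' : E) :
    B (fderiv ℝ s y P Q) (s y Q') + B (s y Q) (fderiv ℝ s y P Q') = 0 := by
  have const : (fun z => B (s z Q) (s z Q')) =ᶠ[𝓝 y] fun _ => 0 := by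
    filter_upwards [hs.isotropic] with z hz using hz Q Q'
  have differentiable (Q) : DifferentiableAt ℝ (fun z => s z Q) y :=
    hs.differentiable_splitting.clm_apply (differentiableAt_const Q)
  have derivative := DFunLike.congr_fun (const.fderiv_eq (𝕜 := ℝ)) P
  rw [fderiv_bilinear_apply B (differentiable Q) (differentiable Q'),
    fderiv_clm_apply hs.differentiable_splitting (differentiableAt_const Q),
    fderiv_clm_apply hs.differentiable_splitting (differentiableAt_const Q')] at derivative
  simpa using derivative

theorem anchor_curvature (hs : IsIsotropicSplittingAt B br s R y) (X Y : E) :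
    R y (curvature br s y X Y) = 0 := by
  have bracket := hs.anchor_bracket (s y X) (s y Y)
  simp only [hs.anchor_splitting, hs.fderiv_splitting] at bracket
  rw [curvature, extDerivOne, map_add, map_sub, ← bracket]
  abel

theorem pairing_adjoint (hs : IsIsotropicSplittingAt B br s R y) (u v : V) :
    B (s y (R y u)) v + B u (s y (R y v)) = B u v :=
  IsIsotropicSplitting.pairing_splitting_anchor
    ⟨hs.anchor_splitting, hs.isotropic.self_of_nhds, hs.stabiliser_isotropic⟩ u v

theorem extDeriv_chernSimons_eq_zero (hs : IsIsotropicSplittingAt B br s R y)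
    (h : IsQuadratic B br) (jac : ∀ u v w, br u (br v w) = br (br u v) w + br v (br u w))
    (smooth : ContDiffAt ℝ ∞ s y) : extDeriv (chernSimons B br s) y = 0 := by
  have pair_curvature (X Y Z W) : B (curvature br s y X Y) (curvature br s y Z W) = 0 :=
    hs.stabiliser_isotropic _ _ (hs.anchor_curvature X Y) (hs.anchor_curvature Z W)
  ext v
  have v_eq : v = ![v 0, v 1, v 2, v 3] := by
    funext i
    fin_cases i <;> rfl
  rw [v_eq, extDeriv_chernSimons_apply h jac smooth]
  simp [pair_curvature]

theorem chernSimons_anchor_apply (hs : IsIsotropicSplittingAt B br s R y) (h : IsQuadratic B br)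
    (u : V) (Y Z : E) :
    chernSimons B br s y ![R y u, Y, Z] =
      B (curvature br s y Y Z) u + B (fderiv ℝ s y (R y u) Y) (s y Z) := by
  have pair_curvature : B (curvature br s y Y Z) (u - s y (R y u)) = 0 :=
    hs.stabiliser_isotropic _ _ (hs.anchor_curvature Y Z)
      (by rw [map_sub, hs.anchor_splitting, sub_self])
  rw [chernSimons_apply h hs.differentiable_splitting]
  simp only [curvature, extDerivOne, map_add, map_sub, add_apply, sub_apply] at pair_curvature ⊢
  generalize R y u = X at *
  linarith [h.rotate (s y X) (s y Y) (s y Z), hs.fderiv_isotropic X Z Y,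
    hs.fderiv_isotropic Y Z X, hs.fderiv_isotropic Z X Y, h.symm (s y Z) (fderiv ℝ s y X Y),
    h.symm (s y Z) (fderiv ℝ s y Y X), h.symm (s y X) (fderiv ℝ s y Z Y)]

theorem pairing_bracket (hs : IsIsotropicSplittingAt B br s R y) (h : IsQuadratic B br)
    (u v : V) (Z : E) :
    B (s y Z) (br u v) = B (s y (fderiv ℝ R y Z u)) v + B (fderiv ℝ s y (R y u) Z) v
      - B (extDerivOne s y (R y v) Z) u + chernSimons B br s y ![R y u, R y v, Z] := by
  have anchor_deriv : fderiv ℝ R y Z u =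
      -R y (fderiv ℝ s y (R y u) Z) - R y (br u (s y Z)) := by
    have bracket := hs.anchor_bracket u (s y Z)
    rw [hs.anchor_splitting, hs.fderiv_splitting] at bracket
    rw [← bracket]
    abel
  have adjoint_deriv := hs.pairing_adjoint (fderiv ℝ s y (R y u) Z) v
  have adjoint_bracket := hs.pairing_adjoint (br u (s y Z)) v
  have isotropic_deriv := hs.fderiv_isotropic (R y u) Z (R y v)
  rw [hs.chernSimons_anchor_apply h, anchor_deriv]
  simp only [curvature, map_add, map_sub, map_neg, add_apply, sub_apply, neg_apply]
  linarith [h.invariant u (s y Z) v, h.rotate u (s y Z) (s y (R y v)),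
    h.swap (s y Z) (s y (R y v)) u, h.symm (s y Z) (fderiv ℝ s y (R y u) (R y v))]

theorem hasFDerivAt_pairing_splitting (hs : IsIsotropicSplittingAt B br s R y) {c : E → V}
    (hc : DifferentiableAt ℝ c y) :
    HasFDerivAt (fun z => (B.flip (c z)).comp (s z))
      (((ContinuousLinearMap.compL ℝ E V ℝ) (B.flip (c y))).comp (fderiv ℝ s y)
        + ((ContinuousLinearMap.compL ℝ E V ℝ).flip (s y)).comp (B.flip.comp (fderiv ℝ c y))) y :=
  (B.flip.hasFDerivAt.comp y hc.hasFDerivAt).clm_comp hs.differentiable_splitting.hasFDerivAt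

theorem extDerivOne_pairing_splitting (hs : IsIsotropicSplittingAt B br s R y) {c : E → V}
    (hc : DifferentiableAt ℝ c y) (X Z : E) :
    extDerivOne (fun z => (B.flip (c z)).comp (s z)) y X Z =
      B (extDerivOne s y X Z) (c y) + B (s y Z) (fderiv ℝ c y X) - B (s y X) (fderiv ℝ c y Z) := by
  rw [extDerivOne, (hs.hasFDerivAt_pairing_splitting hc).fderiv]
  simp [extDerivOne]
  ring

/-- (IM2) in coordinates; `hab` encodes that `a` and `b` take values in a fixed isotropic
subspace. -/
theorem infMultiplicative (hs : IsIsotropicSplittingAt B br s R y) (h : IsQuadratic B br)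
    {a b : E → V} (ha : DifferentiableAt ℝ a y) (hb : DifferentiableAt ℝ b y)
    (hab : ∀ Z, B (fderiv ℝ a y Z) (b y) = 0) (Z : E) :
    B (s y Z) (br (a y) (b y) + fderiv ℝ b y (R y (a y)) - fderiv ℝ a y (R y (b y))) =
      fderiv ℝ (fun z => B (s z (R z (a z))) (b z)) y Z
        + extDeriv (fun z => toForm ((B.flip (b z)).comp (s z))) y ![R y (a y), Z]
        - extDeriv (fun z => toForm ((B.flip (a z)).comp (s z))) y ![R y (b y), Z]
        + chernSimons B br s y ![R y (a y), R y (b y), Z] := by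
  have differentiable_anchor_a := hs.differentiable_anchor.clm_apply ha
  have deriv_splitting_anchor : fderiv ℝ (fun z => s z (R z (a z))) y Z =
      fderiv ℝ s y Z (R y (a y)) + s y (fderiv ℝ R y Z (a y)) + s y (R y (fderiv ℝ a y Z)) := by
    rw [fderiv_clm_apply hs.differentiable_splitting differentiable_anchor_a,
      fderiv_clm_apply hs.differentiable_anchor ha]
    simp
    abel
  have adjoint_a := hs.pairing_adjoint (fderiv ℝ a y Z) (b y)
  have bracket := hs.pairing_bracket h (a y) (b y) Z
  rw [hab] at adjoint_a
  rw [fderiv_bilinear_apply B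
      (hs.differentiable_splitting.clm_apply differentiable_anchor_a) hb,
    extDeriv_toForm_apply (hs.hasFDerivAt_pairing_splitting ha).differentiableAt,
    extDeriv_toForm_apply (hs.hasFDerivAt_pairing_splitting hb).differentiableAt,
    hs.extDerivOne_pairing_splitting ha, hs.extDerivOne_pairing_splitting hb,
    deriv_splitting_anchor]
  simp only [extDerivOne, map_add, map_sub, add_apply, sub_apply] at bracket ⊢
  linarith [h.symm (s y (R y (b y))) (fderiv ℝ a y Z)]

end IsIsotropicSplittingAt

end IsotropicSplitting

section Charts

variable {E : Type*} [NormedAddCommGroup E] [NormedSpace ℝ E]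
  {M : Type*} [TopologicalSpace M] [ChartedSpace E M]
  {F : Type*} [NormedAddCommGroup F] [NormedSpace ℝ F] {k : ℕ}

/-- The coordinate expression of an `F`-valued 1-form in the preferred chart around `x₀`. -/
def oneRep (α : ∀ x : M, TangentSpace 𝓘(ℝ, E) x →L[ℝ] F) (x₀ : M) (y : E) : E →L[ℝ] F :=
  (α ((extChartAt 𝓘(ℝ, E) x₀).symm y)).comp
    (mfderiv 𝓘(ℝ, E) 𝓘(ℝ, E) (extChartAt 𝓘(ℝ, E) x₀).symm y)

/-- The coordinate expression of a vector field in the preferred chart around `x₀`. -/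
def fieldRep (X : ∀ x : M, TangentSpace 𝓘(ℝ, E) x) (x₀ : M) (y : E) : E :=
  mfderiv 𝓘(ℝ, E) 𝓘(ℝ, E) (extChartAt 𝓘(ℝ, E) x₀) ((extChartAt 𝓘(ℝ, E) x₀).symm y)
    (X ((extChartAt 𝓘(ℝ, E) x₀).symm y))

/-- The transition map from the preferred chart around `x₀` to the one around `x₁`. -/
def transition (E : Type*) [NormedAddCommGroup E] [NormedSpace ℝ E]
    {M : Type*} [TopologicalSpace M] [ChartedSpace E M] (x₀ x₁ : M) : E → E :=
  extChartAt 𝓘(ℝ, E) x₁ ∘ (extChartAt 𝓘(ℝ, E) x₀).symm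

theorem apply_congr_point (α : ∀ x : M, TangentSpace 𝓘(ℝ, E) x →L[ℝ] F) {x x' : M} (h : x = x')
    (v : E) : α x v = α x' v := by
  subst h
  rfl

theorem contDiffOn_toForm_iff {f : E → E →L[ℝ] F} {T : Set E} {n : WithTop ℕ∞} :
    ContDiffOn ℝ n (fun y => toForm (f y)) T ↔ ContDiffOn ℝ n f T :=
  ⟨fun h => (ContinuousAlternatingMap.ofSubsingletonLIE (𝕜 := ℝ) (E := E) (F := F)
    (0 : Fin 1)).symm.contDiff.comp_contDiffOn h, fun h => contDiff_toForm.comp_contDiffOn h⟩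

theorem chartRep_toForm (α : ∀ x : M, TangentSpace 𝓘(ℝ, E) x →L[ℝ] F) (x₀ : M) :
    chartRep (fun x => toForm (α x)) x₀ = fun y => toForm (oneRep α x₀ y) := rfl

theorem smoothOneFormOn_iff {α : ∀ x : M, TangentSpace 𝓘(ℝ, E) x →L[ℝ] F} {U : Set M} :
    SmoothOneFormOn α U ↔ ∀ x₀ : M, ContDiffOn ℝ ∞ (oneRep α x₀)
      ((extChartAt 𝓘(ℝ, E) x₀).target ∩ (extChartAt 𝓘(ℝ, E) x₀).symm ⁻¹' U) := by
  simp only [SmoothOneFormOn, SmoothFormOn, chartRep_toForm, contDiffOn_toForm_iff]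

theorem chart_symm_mem_source (x₀ : M) {y : E} (hy : y ∈ (extChartAt 𝓘(ℝ, E) x₀).target) :
    (extChartAt 𝓘(ℝ, E) x₀).symm y ∈ (chartAt E x₀).source := by
  rw [← extChartAt_source 𝓘(ℝ, E)]
  exact (extChartAt 𝓘(ℝ, E) x₀).map_target hy

theorem differential_apply {f : M → F} {x : M} (hf : MDifferentiableAt 𝓘(ℝ, E) 𝓘(ℝ, F) f x)
    (v : TangentSpace 𝓘(ℝ, E) x) :
    differential f x v =
      fderiv ℝ (f ∘ (extChartAt 𝓘(ℝ, E) x).symm) (extChartAt 𝓘(ℝ, E) x x) v := by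
  refine (DFunLike.congr_fun hf.mfderiv v).trans ?_
  simp only [writtenInExtChartAt, mfld_simps, fderivWithin_univ]
  rfl

variable [IsManifold 𝓘(ℝ, E) ∞ M]

theorem mdifferentiableAt_chart_symm (x₀ : M) {y : E}
    (hy : y ∈ (extChartAt 𝓘(ℝ, E) x₀).target) :
    MDifferentiableAt 𝓘(ℝ, E) 𝓘(ℝ, E) (extChartAt 𝓘(ℝ, E) x₀).symm y := by
  simpa [mdifferentiableWithinAt_univ] using
    mdifferentiableWithinAt_extChartAt_symm (I := 𝓘(ℝ, E)) hy

theorem mfderiv_chart_comp_symm (x₀ : M) {y : E} (hy : y ∈ (extChartAt 𝓘(ℝ, E) x₀).target)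
    (v : E) :
    mfderiv 𝓘(ℝ, E) 𝓘(ℝ, E) (extChartAt 𝓘(ℝ, E) x₀) ((extChartAt 𝓘(ℝ, E) x₀).symm y)
      (mfderiv 𝓘(ℝ, E) 𝓘(ℝ, E) (extChartAt 𝓘(ℝ, E) x₀).symm y v) = v := by
  have comp := mfderiv_extChartAt_comp_mfderivWithin_extChartAt_symm (I := 𝓘(ℝ, E)) hy
  rw [modelWithCornersSelf_coe, Set.range_id, mfderivWithin_univ] at comp
  exact DFunLike.congr_fun comp v

theorem mfderiv_chart_symm_comp (x₀ : M) {y : E} (hy : y ∈ (extChartAt 𝓘(ℝ, E) x₀).target)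
    (v : TangentSpace 𝓘(ℝ, E) ((extChartAt 𝓘(ℝ, E) x₀).symm y)) :
    mfderiv 𝓘(ℝ, E) 𝓘(ℝ, E) (extChartAt 𝓘(ℝ, E) x₀).symm y
      (mfderiv 𝓘(ℝ, E) 𝓘(ℝ, E) (extChartAt 𝓘(ℝ, E) x₀) ((extChartAt 𝓘(ℝ, E) x₀).symm y) v)
      = v := by
  have comp := mfderivWithin_extChartAt_symm_comp_mfderiv_extChartAt (I := 𝓘(ℝ, E)) hy
  rw [modelWithCornersSelf_coe, Set.range_id, mfderivWithin_univ] at comp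
  exact DFunLike.congr_fun comp v

theorem mfderiv_chart_self (x : M) (v : TangentSpace 𝓘(ℝ, E) x) :
    mfderiv 𝓘(ℝ, E) 𝓘(ℝ, E) (extChartAt 𝓘(ℝ, E) x) x v = v := by
  rw [mfderiv_extChartAt_self]
  rfl

theorem mfderiv_chart_symm_self (x : M) (v : E) :
    (mfderiv 𝓘(ℝ, E) 𝓘(ℝ, E) (extChartAt 𝓘(ℝ, E) x).symm (extChartAt 𝓘(ℝ, E) x x) v : E) = v := by
  have identity := mfderivWithin_range_extChartAt_symm (I := 𝓘(ℝ, E)) (x := x)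
  rw [modelWithCornersSelf_coe, Set.range_id, mfderivWithin_univ] at identity
  exact DFunLike.congr_fun identity v

theorem oneRep_self (α : ∀ x : M, TangentSpace 𝓘(ℝ, E) x →L[ℝ] F) (x : M)
    (v : TangentSpace 𝓘(ℝ, E) x) :
    oneRep α x (extChartAt 𝓘(ℝ, E) x x) v = α x v :=
  (congrArg _ (mfderiv_chart_symm_self (E := E) x v)).trans
    (apply_congr_point α (extChartAt_to_inv x) v)

theorem fieldRep_self (X : ∀ x : M, TangentSpace 𝓘(ℝ, E) x) (x : M) :
    fieldRep X x (extChartAt 𝓘(ℝ, E) x x) = X x := by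
  rw [fieldRep, extChartAt_to_inv]
  exact mfderiv_chart_self x _

theorem oneRep_fieldRep (α : ∀ x : M, TangentSpace 𝓘(ℝ, E) x →L[ℝ] F)
    (X : ∀ x : M, TangentSpace 𝓘(ℝ, E) x) (x₀ : M) {y : E}
    (hy : y ∈ (extChartAt 𝓘(ℝ, E) x₀).target) :
    oneRep α x₀ y (fieldRep X x₀ y) =
      α ((extChartAt 𝓘(ℝ, E) x₀).symm y) (X ((extChartAt 𝓘(ℝ, E) x₀).symm y)) :=
  congrArg _ (mfderiv_chart_symm_comp x₀ hy _)

theorem mpullbackWithin_chart_symm (X : ∀ x : M, TangentSpace 𝓘(ℝ, E) x) (x₀ : M) {y : E}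
    (hy : y ∈ (extChartAt 𝓘(ℝ, E) x₀).target) :
    VectorField.mpullbackWithin 𝓘(ℝ, E) 𝓘(ℝ, E) (extChartAt 𝓘(ℝ, E) x₀).symm X Set.univ y =
      fieldRep X x₀ y := by
  have inverse_eq : (mfderiv 𝓘(ℝ, E) 𝓘(ℝ, E) (extChartAt 𝓘(ℝ, E) x₀).symm y).inverse =
      mfderiv 𝓘(ℝ, E) 𝓘(ℝ, E) (extChartAt 𝓘(ℝ, E) x₀) ((extChartAt 𝓘(ℝ, E) x₀).symm y) :=
    ContinuousLinearMap.inverse_eq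
      (ContinuousLinearMap.ext fun v => mfderiv_chart_symm_comp x₀ hy v)
      (ContinuousLinearMap.ext fun v => mfderiv_chart_comp_symm x₀ hy v)
  rw [VectorField.mpullbackWithin_apply, mfderivWithin_univ, inverse_eq]
  rfl

theorem mlieBracket_eq_lieBracket (X Y : ∀ x : M, TangentSpace 𝓘(ℝ, E) x) (x : M) :
    VectorField.mlieBracket 𝓘(ℝ, E) X Y x =
      VectorField.lieBracket ℝ (fieldRep X x) (fieldRep Y x) (extChartAt 𝓘(ℝ, E) x x) := by
  have pullback_eq (Z : ∀ x : M, TangentSpace 𝓘(ℝ, E) x) :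
      VectorField.mpullbackWithin 𝓘(ℝ, E) 𝓘(ℝ, E) (extChartAt 𝓘(ℝ, E) x).symm Z Set.univ
        =ᶠ[𝓝 (extChartAt 𝓘(ℝ, E) x x)] fieldRep Z x := by
    filter_upwards [extChartAt_target_mem_nhds (I := 𝓘(ℝ, E)) x] with y hy
    exact mpullbackWithin_chart_symm Z x hy
  have bracket_eq := (pullback_eq X).lieBracket_vectorField_eq (𝕜 := ℝ) (pullback_eq Y)
  rw [VectorField.mlieBracket, VectorField.mlieBracketWithin_apply, mfderiv_extChartAt_self,
    Set.preimage_univ, Set.univ_inter, modelWithCornersSelf_coe, Set.range_id]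
  exact (DFunLike.congr_fun (ContinuousLinearMap.inverse_id (R := ℝ) (M := E)) _).trans
    ((congrFun VectorField.lieBracketWithin_univ _).trans bracket_eq)

theorem contDiffAt_transition (x₀ x₁ : M) {y : E} (hy : y ∈ (extChartAt 𝓘(ℝ, E) x₀).target)
    (hy' : (extChartAt 𝓘(ℝ, E) x₀).symm y ∈ (chartAt E x₁).source) :
    ContDiffAt ℝ ∞ (transition E x₀ x₁) y := by
  rw [← contMDiffAt_iff_contDiffAt]
  exact (contMDiffAt_extChartAt' (n := ∞) hy').comp y
    ((contMDiffOn_extChartAt_symm x₀).contMDiffAt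
      ((isOpen_extChartAt_target x₀).mem_nhds hy))

theorem fderiv_transition (x₀ x₁ : M) {y : E} (hy : y ∈ (extChartAt 𝓘(ℝ, E) x₀).target)
    (hy' : (extChartAt 𝓘(ℝ, E) x₀).symm y ∈ (chartAt E x₁).source) (v : E) :
    fderiv ℝ (transition E x₀ x₁) y v =
      mfderiv 𝓘(ℝ, E) 𝓘(ℝ, E) (extChartAt 𝓘(ℝ, E) x₁) ((extChartAt 𝓘(ℝ, E) x₀).symm y)
        (mfderiv 𝓘(ℝ, E) 𝓘(ℝ, E) (extChartAt 𝓘(ℝ, E) x₀).symm y v) := by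
  rw [← mfderiv_eq_fderiv, transition, mfderiv_comp y (mdifferentiableAt_extChartAt hy')
    (mdifferentiableAt_chart_symm x₀ hy)]
  rfl

theorem mfderiv_chart_symm_transition (x₀ x₁ : M) {y : E}
    (hy : y ∈ (extChartAt 𝓘(ℝ, E) x₀).target)
    (hy' : (extChartAt 𝓘(ℝ, E) x₀).symm y ∈ (chartAt E x₁).source) (v : E) :
    (mfderiv 𝓘(ℝ, E) 𝓘(ℝ, E) (extChartAt 𝓘(ℝ, E) x₁).symm (transition E x₀ x₁ y)
      (fderiv ℝ (transition E x₀ x₁) y v) : E) =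
      mfderiv 𝓘(ℝ, E) 𝓘(ℝ, E) (extChartAt 𝓘(ℝ, E) x₀).symm y v := by
  have hx : (extChartAt 𝓘(ℝ, E) x₀).symm y ∈ (extChartAt 𝓘(ℝ, E) x₁).source := by
    rwa [extChartAt_source]
  rw [fderiv_transition x₀ x₁ hy hy']
  have cancel := mfderiv_chart_symm_comp x₁ ((extChartAt 𝓘(ℝ, E) x₁).map_source hx)
  rw [(extChartAt 𝓘(ℝ, E) x₁).left_inv hx] at cancel
  exact cancel _

theorem chartRep_eq_pullback (θ : ∀ x : M, TangentSpace 𝓘(ℝ, E) x [⋀^Fin k]→L[ℝ] F) (x₀ x₁ : M)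
    {y : E} (hy : y ∈ (extChartAt 𝓘(ℝ, E) x₀).target)
    (hy' : (extChartAt 𝓘(ℝ, E) x₀).symm y ∈ (chartAt E x₁).source) :
    chartRep θ x₀ y = (chartRep θ x₁ (transition E x₀ x₁ y)).compContinuousLinearMap
      (fderiv ℝ (transition E x₀ x₁) y) := by
  have hx : (extChartAt 𝓘(ℝ, E) x₀).symm y = (extChartAt 𝓘(ℝ, E) x₁).symm (transition E x₀ x₁ y) :=
    ((extChartAt 𝓘(ℝ, E) x₁).left_inv (by rwa [extChartAt_source])).symm
  have apply_congr {x x' : M} (h : x = x') (w : Fin k → E) : θ x w = θ x' w := by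
    subst h
    rfl
  ext v
  refine (apply_congr hx _).trans (congrArg (θ _) (funext fun i => ?_))
  exact (mfderiv_chart_symm_transition x₀ x₁ hy hy' (v i)).symm

theorem chartRep_extDer {θ : ∀ x : M, TangentSpace 𝓘(ℝ, E) x [⋀^Fin k]→L[ℝ] F}
    (hθ : SmoothFormOn θ Set.univ) (x₀ : M) {y : E} (hy : y ∈ (extChartAt 𝓘(ℝ, E) x₀).target) :
    chartRep (extDer θ) x₀ y = extDeriv (chartRep θ x₀) y := by
  let x₁ := (extChartAt 𝓘(ℝ, E) x₀).symm y
  have mem_source : x₁ ∈ (chartAt E x₁).source := mem_chart_source E x₁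
  have pullback : chartRep θ x₀ =ᶠ[𝓝 y] fun z =>
      (chartRep θ x₁ (transition E x₀ x₁ z)).compContinuousLinearMap
        (fderiv ℝ (transition E x₀ x₁) z) := by
    filter_upwards [(isOpen_extChartAt_target x₀).mem_nhds hy,
      (continuousAt_extChartAt_symm'' hy).preimage_mem_nhds
        ((chartAt E x₁).open_source.mem_nhds mem_source)] with z hz hz'
    exact chartRep_eq_pullback θ x₀ x₁ hz hz'
  have differentiable : DifferentiableAt ℝ (chartRep θ x₁) (transition E x₀ x₁ y) := by
    have smooth := hθ x₁
    rw [Set.preimage_univ, Set.inter_univ] at smooth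
    exact (smooth.contDiffAt ((isOpen_extChartAt_target x₁).mem_nhds
      (mem_extChartAt_target x₁))).differentiableAt (by simp)
  rw [pullback.extDeriv_eq, extDeriv_pullback differentiable
    (contDiffAt_transition x₀ x₁ hy mem_source) minSmoothness_two_le_infty]
  ext v
  refine congrArg (extDeriv (chartRep θ x₁) (transition E x₀ x₁ y)) (funext fun i => ?_)
  exact (fderiv_transition x₀ x₁ hy mem_source (v i)).symm

theorem chartRep_self_apply (θ : ∀ x : M, TangentSpace 𝓘(ℝ, E) x [⋀^Fin k]→L[ℝ] F) (x : M)
    (v : Fin k → TangentSpace 𝓘(ℝ, E) x) :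
    chartRep θ x (extChartAt 𝓘(ℝ, E) x x) v = θ x v := by
  have apply_congr {x x' : M} (h : x = x') (w : Fin k → E) : θ x w = θ x' w := by
    subst h
    rfl
  exact (congrArg (θ _) (funext fun i => mfderiv_chart_symm_self (E := E) x (v i))).trans
    (apply_congr (extChartAt_to_inv x) v)

theorem extDer_self_apply (θ : ∀ x : M, TangentSpace 𝓘(ℝ, E) x [⋀^Fin k]→L[ℝ] F) (x : M)
    (v : Fin (k + 1) → TangentSpace 𝓘(ℝ, E) x) :
    extDer θ x v = extDeriv (chartRep θ x) (extChartAt 𝓘(ℝ, E) x x) v :=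
  congrArg (extDeriv (chartRep θ x) (extChartAt 𝓘(ℝ, E) x x))
    (funext fun i => mfderiv_chart_self x (v i))

theorem contMDiff_iff_chart {f : M → F} :
    ContMDiff 𝓘(ℝ, E) 𝓘(ℝ, F) ∞ f ↔ ∀ x₀ : M,
      ContDiffOn ℝ ∞ (f ∘ (extChartAt 𝓘(ℝ, E) x₀).symm) (extChartAt 𝓘(ℝ, E) x₀).target := by
  constructor
  · intro hf x₀
    rw [← contMDiffOn_iff_contDiffOn]
    exact hf.comp_contMDiffOn (contMDiffOn_extChartAt_symm x₀)
  · intro hf x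
    have smooth_rep := (hf x).contDiffAt (extChartAt_target_mem_nhds x)
    rw [← contMDiffAt_iff_contDiffAt] at smooth_rep
    refine (smooth_rep.comp x contMDiffAt_extChartAt).congr_of_eventuallyEq ?_
    filter_upwards [extChartAt_source_mem_nhds (I := 𝓘(ℝ, E)) x] with z hz
    simp only [Function.comp_apply, (extChartAt 𝓘(ℝ, E) x).left_inv hz]

theorem trivializationAt_snd_eq_fieldRep (X : ∀ x : M, TangentSpace 𝓘(ℝ, E) x) (x₀ : M) {x : M}
    (hx : x ∈ (chartAt E x₀).source) :
    (trivializationAt E (TangentSpace 𝓘(ℝ, E)) x₀ ⟨x, X x⟩).2 =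
      fieldRep X x₀ (extChartAt 𝓘(ℝ, E) x₀ x) := by
  have linearMapAt_eq := TangentBundle.continuousLinearMapAt_trivializationAt (I := 𝓘(ℝ, E)) hx
  rw [fieldRep, (extChartAt 𝓘(ℝ, E) x₀).left_inv (by rwa [extChartAt_source])]
  refine Eq.trans ?_ (DFunLike.congr_fun linearMapAt_eq (X x))
  exact (congrFun (Bundle.Trivialization.coe_linearMapAt_of_mem (R := ℝ)
    (trivializationAt E (TangentSpace 𝓘(ℝ, E)) x₀) (b := x) (by simpa using hx)) (X x)).symm

theorem contMDiffOn_chart_source_iff (X : ∀ x : M, TangentSpace 𝓘(ℝ, E) x) (x₀ : M) :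
    ContMDiffOn 𝓘(ℝ, E) 𝓘(ℝ, E).tangent ∞
      (fun x => (⟨x, X x⟩ : TangentBundle 𝓘(ℝ, E) M)) (chartAt E x₀).source ↔
      ContDiffOn ℝ ∞ (fieldRep X x₀) (extChartAt 𝓘(ℝ, E) x₀).target := by
  have section_iff := Bundle.Trivialization.contMDiffOn_section_baseSet_iff (IB := 𝓘(ℝ, E))
    (n := ∞) (e := trivializationAt E (TangentSpace 𝓘(ℝ, E)) x₀) (s := X)
  rw [TangentBundle.trivializationAt_baseSet] at section_iff
  rw [section_iff, ← contMDiffOn_iff_contDiffOn]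
  refine ⟨fun smooth => ?_, fun smooth => ?_⟩
  · refine (smooth.comp (contMDiffOn_extChartAt_symm x₀)
      fun y hy => chart_symm_mem_source x₀ hy).congr fun y hy => ?_
    rw [Function.comp_apply, trivializationAt_snd_eq_fieldRep X x₀ (chart_symm_mem_source x₀ hy),
      (extChartAt 𝓘(ℝ, E) x₀).right_inv hy]
  · exact (smooth.comp (contMDiffOn_extChartAt (x := x₀)) fun x hx =>
      (extChartAt 𝓘(ℝ, E) x₀).map_source (by rwa [extChartAt_source])).congr
        fun x hx => trivializationAt_snd_eq_fieldRep X x₀ hx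

theorem smoothFieldOn_univ_iff {X : ∀ x : M, TangentSpace 𝓘(ℝ, E) x} :
    SmoothFieldOn X Set.univ ↔ ∀ x₀ : M,
      ContDiffOn ℝ ∞ (fieldRep X x₀) (extChartAt 𝓘(ℝ, E) x₀).target := by
  rw [SmoothFieldOn, contMDiffOn_univ]
  refine ⟨fun h x₀ => (contMDiffOn_chart_source_iff X x₀).1 h.contMDiffOn, fun h x => ?_⟩
  exact ((contMDiffOn_chart_source_iff X x).2 (h x)).contMDiffAt
    ((chartAt E x).open_source.mem_nhds (mem_chart_source E x))

end Charts

section Action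

variable {𝔡 : Type*} [NormedAddCommGroup 𝔡] [NormedSpace ℝ 𝔡]
  {D : Type*} [TopologicalSpace D] [Group D] [ChartedSpace 𝔡 D]
  {E : Type*} [NormedAddCommGroup E] [NormedSpace ℝ E]
  {N : Type*} [TopologicalSpace N] [ChartedSpace E N] [MulAction D N]

/-- The fundamental vector field of `u ∈ 𝔡 = T_1 D` for an action of `D` on `N`. -/
def actionField (D : Type*) [TopologicalSpace D] [Group D] [ChartedSpace 𝔡 D]
    {N : Type*} [TopologicalSpace N] [ChartedSpace E N] [MulAction D N] (u : 𝔡) (x : N) :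
    TangentSpace 𝓘(ℝ, E) x :=
  mfderiv 𝓘(ℝ, 𝔡) 𝓘(ℝ, E) (fun a : D => a • x) 1 u

/-- The orbit map of `x`, written in the preferred chart of `D` around the identity and the
preferred chart of `N` around `x₀`. -/
def orbitChart (D : Type*) [TopologicalSpace D] [Group D] [ChartedSpace 𝔡 D]
    (E : Type*) [NormedAddCommGroup E] [NormedSpace ℝ E]
    {N : Type*} [TopologicalSpace N] [ChartedSpace E N] [MulAction D N] (x₀ x : N) (z : 𝔡) : E :=
  extChartAt 𝓘(ℝ, E) x₀ ((extChartAt 𝓘(ℝ, 𝔡) (1 : D)).symm z • x)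

theorem adjoint_one (v : 𝔡) : adjoint (1 : D) v = v := by
  have conj_eq : (fun b : D => 1 * b * 1⁻¹) = id := by
    funext b
    simp
  rw [adjoint, conj_eq, mfderiv_id]
  rfl

theorem rightField_one (u : 𝔡) : rightField D u 1 = u := by
  have mul_eq : (fun b : D => b * 1) = id := funext mul_one
  rw [rightField, mul_eq, mfderiv_id]
  rfl

theorem orbitChart_one (x₀ x : N) :
    orbitChart D E x₀ x (extChartAt 𝓘(ℝ, 𝔡) (1 : D) 1) = extChartAt 𝓘(ℝ, E) x₀ x := by
  rw [orbitChart, extChartAt_to_inv, one_smul]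

theorem eventually_orbit_mem {x : N} {U : Set N} (orbit : Continuous (fun a : D => a • x))
    (hU : U ∈ 𝓝 x) :
    ∀ᶠ z in 𝓝 (extChartAt 𝓘(ℝ, 𝔡) (1 : D) 1), z ∈ (extChartAt 𝓘(ℝ, 𝔡) (1 : D)).target ∧
      (extChartAt 𝓘(ℝ, 𝔡) (1 : D)).symm z • x ∈ U := by
  refine Filter.Eventually.and (extChartAt_target_mem_nhds (I := 𝓘(ℝ, 𝔡)) (1 : D)) ?_
  have continuousAt : ContinuousAt (fun z => (extChartAt 𝓘(ℝ, 𝔡) (1 : D)).symm z • x)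
      (extChartAt 𝓘(ℝ, 𝔡) (1 : D) 1) :=
    ContinuousAt.comp (g := fun a : D => a • x) orbit.continuousAt
      (continuousAt_extChartAt_symm (I := 𝓘(ℝ, 𝔡)) (1 : D))
  refine continuousAt.preimage_mem_nhds ?_
  rwa [extChartAt_to_inv (I := 𝓘(ℝ, 𝔡)) (1 : D), one_smul]

variable [LieGroup 𝓘(ℝ, 𝔡) ∞ D]

theorem mdifferentiable_mul_right (a : D) :
    MDifferentiable 𝓘(ℝ, 𝔡) 𝓘(ℝ, 𝔡) (fun b : D => b * a) :=
  (contMDiff_mul_right (I := 𝓘(ℝ, 𝔡)) (n := ∞) (a := a)).mdifferentiable (by simp)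

theorem mfderiv_orbit_rightField {x : N}
    (orbit : MDifferentiable 𝓘(ℝ, 𝔡) 𝓘(ℝ, E) (fun a : D => a • x)) (u : 𝔡) (b : D) :
    mfderiv 𝓘(ℝ, 𝔡) 𝓘(ℝ, E) (fun a : D => a • x) b (rightField D u b) =
      actionField D u (b • x) := by
  have orbit_eq : (fun a : D => a • (b • x)) = (fun a : D => a • x) ∘ (fun a => a * b) :=
    funext fun a => (mul_smul a b x).symm
  rw [actionField, orbit_eq]
  exact (mfderiv_comp_apply_of_eq (1 : D) (orbit b) (mdifferentiable_mul_right (𝔡 := 𝔡) b 1)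
    (one_mul b) u).symm

theorem contDiffOn_fieldRep_rightField (u : 𝔡) (a : D) :
    ContDiffOn ℝ ∞ (fieldRep (rightField D u) a) (extChartAt 𝓘(ℝ, 𝔡) a).target :=
  smoothFieldOn_univ_iff.1 (contMDiff_rightField u).contMDiffOn a

theorem fieldRep_rightField_one (w : 𝔡) :
    fieldRep (rightField D w) 1 (extChartAt 𝓘(ℝ, 𝔡) (1 : D) 1) = w :=
  (fieldRep_self (rightField D w) 1).trans (rightField_one w)

theorem differentiableAt_fieldRep_rightField (u : 𝔡) :
    DifferentiableAt ℝ (fieldRep (rightField D u) 1) (extChartAt 𝓘(ℝ, 𝔡) (1 : D) 1) :=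
  ((contDiffOn_fieldRep_rightField u (1 : D)).contDiffAt
    (extChartAt_target_mem_nhds (I := 𝓘(ℝ, 𝔡)) (1 : D))).differentiableAt (by simp)

variable [IsManifold 𝓘(ℝ, E) ∞ N]

theorem contDiffAt_orbitChart {x₀ x : N}
    (orbit : ContMDiff 𝓘(ℝ, 𝔡) 𝓘(ℝ, E) ∞ (fun a : D => a • x))
    (hx : x ∈ (chartAt E x₀).source) :
    ContDiffAt ℝ ∞ (orbitChart D E x₀ x) (extChartAt 𝓘(ℝ, 𝔡) (1 : D) 1) := by
  rw [← contMDiffAt_iff_contDiffAt]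
  have smooth : ContMDiffAt 𝓘(ℝ, 𝔡) 𝓘(ℝ, E) ∞
      (fun z => (extChartAt 𝓘(ℝ, 𝔡) (1 : D)).symm z • x) (extChartAt 𝓘(ℝ, 𝔡) (1 : D) 1) :=
    ContMDiffAt.comp _ (g := fun a : D => a • x) (orbit _)
      ((contMDiffOn_extChartAt_symm (n := ∞) (I := 𝓘(ℝ, 𝔡)) (1 : D)).contMDiffAt
        (extChartAt_target_mem_nhds (I := 𝓘(ℝ, 𝔡)) (1 : D)))
  refine ContMDiffAt.comp _ (contMDiffAt_extChartAt' (I := 𝓘(ℝ, E)) (n := ∞) ?_) smooth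
  rwa [extChartAt_to_inv (I := 𝓘(ℝ, 𝔡)) (1 : D), one_smul]

theorem fderiv_orbitChart_rightField {x₀ x : N}
    (orbit : ContMDiff 𝓘(ℝ, 𝔡) 𝓘(ℝ, E) ∞ (fun a : D => a • x))
    (hx : x ∈ (chartAt E x₀).source) (w : 𝔡) :
    ∀ᶠ z in 𝓝 (extChartAt 𝓘(ℝ, 𝔡) (1 : D) 1),
      fderiv ℝ (orbitChart D E x₀ x) z (fieldRep (rightField D w) 1 z) =
        fieldRep (actionField D (N := N) w) x₀ (orbitChart D E x₀ x z) := by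
  let ψ := extChartAt 𝓘(ℝ, 𝔡) (1 : D)
  have orbit_diff : MDifferentiable 𝓘(ℝ, 𝔡) 𝓘(ℝ, E) (fun a : D => a • x) :=
    orbit.mdifferentiable (by simp)
  filter_upwards [eventually_orbit_mem orbit.continuous
    ((chartAt E x₀).open_source.mem_nhds hx)] with z ⟨hz, hzx⟩
  have symm_diff := mdifferentiableAt_chart_symm (1 : D) hz
  have comp_eq : orbitChart D E x₀ x = extChartAt 𝓘(ℝ, E) x₀ ∘ (fun a : D => a • x) ∘ ψ.symm := rfl
  have point_eq : (extChartAt 𝓘(ℝ, E) x₀).symm (orbitChart D E x₀ x z) = ψ.symm z • x :=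
    (extChartAt 𝓘(ℝ, E) x₀).left_inv (by rwa [extChartAt_source])
  rw [← mfderiv_eq_fderiv, comp_eq, mfderiv_comp z (mdifferentiableAt_extChartAt hzx)
    ((orbit_diff (ψ.symm z)).comp z symm_diff), mfderiv_comp z (orbit_diff _) symm_diff,
    ← comp_eq, fieldRep.eq_def (actionField D w), point_eq,
    ← mfderiv_orbit_rightField orbit_diff w (ψ.symm z)]
  exact congrArg (fun q => mfderiv 𝓘(ℝ, E) 𝓘(ℝ, E) (extChartAt 𝓘(ℝ, E) x₀) (ψ.symm z • x)
    (mfderiv 𝓘(ℝ, 𝔡) 𝓘(ℝ, E) (fun a : D => a • x) (ψ.symm z) q))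
    (mfderiv_chart_symm_comp (1 : D) hz (rightField D w (ψ.symm z)))

theorem fderiv_orbitChart_one {x₀ x : N}
    (orbit : ContMDiff 𝓘(ℝ, 𝔡) 𝓘(ℝ, E) ∞ (fun a : D => a • x))
    (hx : x ∈ (chartAt E x₀).source) (w : 𝔡) :
    fderiv ℝ (orbitChart D E x₀ x) (extChartAt 𝓘(ℝ, 𝔡) (1 : D) 1) w =
      fieldRep (actionField D (N := N) w) x₀ (extChartAt 𝓘(ℝ, E) x₀ x) := by
  have at_one := (fderiv_orbitChart_rightField orbit hx w).self_of_nhds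
  rwa [fieldRep_rightField_one, orbitChart_one] at at_one

theorem lieBracket_fieldRep_actionField [FiniteDimensional ℝ 𝔡] (x₀ : N) {y : E}
    (hy : y ∈ (extChartAt 𝓘(ℝ, E) x₀).target)
    (orbit : ContMDiff 𝓘(ℝ, 𝔡) 𝓘(ℝ, E) ∞
      (fun a : D => a • (extChartAt 𝓘(ℝ, E) x₀).symm y))
    (hd : ∀ u : 𝔡, DifferentiableAt ℝ (fieldRep (actionField D (N := N) u) x₀) y) (u v : 𝔡) :
    VectorField.lieBracket ℝ (fieldRep (actionField D (N := N) u) x₀)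
      (fieldRep (actionField D (N := N) v) x₀) y =
      fieldRep (actionField D (N := N) (lieBr D u v)) x₀ y := by
  let e : 𝔡 := extChartAt 𝓘(ℝ, 𝔡) (1 : D) 1
  let f : 𝔡 → E := orbitChart D E x₀ ((extChartAt 𝓘(ℝ, E) x₀).symm y)
  have hx := chart_symm_mem_source x₀ hy
  have right_inv := (extChartAt 𝓘(ℝ, E) x₀).right_inv hy
  have f_one : f e = y := (orbitChart_one x₀ _).trans right_inv
  have smooth : ContDiffAt ℝ ∞ f e := contDiffAt_orbitChart orbit hx
  have fderiv_f (w : 𝔡) : fderiv ℝ f e w = fieldRep (actionField D (N := N) w) x₀ y := by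
    rw [fderiv_orbitChart_one orbit hx, right_inv]
  have fderiv_related (w w' : 𝔡) :
      fderiv ℝ (fun z => fderiv ℝ f z (fieldRep (rightField D w) 1 z)) e w' =
        fderiv ℝ (fieldRep (actionField D (N := N) w) x₀) y
          (fieldRep (actionField D (N := N) w') x₀ y) := by
    have related : (fun z => fderiv ℝ f z (fieldRep (rightField D w) 1 z)) =ᶠ[𝓝 e]
        fieldRep (actionField D (N := N) w) x₀ ∘ f := fderiv_orbitChart_rightField orbit hx w
    rw [related.fderiv_eq, fderiv_comp e (by rw [f_one]; exact hd w)
      (smooth.differentiableAt (by simp)), f_one, ContinuousLinearMap.comp_apply, fderiv_f]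
  have bracket_f := VectorField.fderiv_apply_lieBracket smooth minSmoothness_two_le_infty
    (differentiableAt_fieldRep_rightField v) (differentiableAt_fieldRep_rightField u)
  rw [fieldRep_rightField_one, fieldRep_rightField_one, fderiv_related, fderiv_related]
    at bracket_f
  rw [VectorField.lieBracket, ← bracket_f, ← fderiv_f, lieBr_apply]
  exact congrArg (fderiv ℝ f e)
    (mlieBracket_eq_lieBracket (rightField D u) (rightField D v) (1 : D)).symm

end Action

section LieAlgebra

theorem fderiv_chart_comp {E : Type*} [NormedAddCommGroup E] [NormedSpace ℝ E]
    {M : Type*} [TopologicalSpace M] [ChartedSpace E M] [IsManifold 𝓘(ℝ, E) ∞ M] {g : M → M}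
    {x b : M} (hb : g x = b) (hg : MDifferentiableAt 𝓘(ℝ, E) 𝓘(ℝ, E) g x)
    (hbs : b ∈ (chartAt E x).source) (w : E) :
    fderiv ℝ (fun z => extChartAt 𝓘(ℝ, E) x (g ((extChartAt 𝓘(ℝ, E) x).symm z)))
      (extChartAt 𝓘(ℝ, E) x x) w =
    mfderiv 𝓘(ℝ, E) 𝓘(ℝ, E) (extChartAt 𝓘(ℝ, E) x) b (mfderiv 𝓘(ℝ, E) 𝓘(ℝ, E) g x w : E) := by
  subst hb
  have chart_diff := mdifferentiableAt_extChartAt (I := 𝓘(ℝ, E)) hbs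
  have symm_diff := mdifferentiableAt_chart_symm x (mem_extChartAt_target (I := 𝓘(ℝ, E)) x)
  have comp_eq := mfderiv_comp_apply_of_eq (extChartAt 𝓘(ℝ, E) x x) (chart_diff.comp x hg)
    symm_diff (extChartAt_to_inv x) w
  rw [← mfderiv_eq_fderiv]
  refine comp_eq.trans ?_
  rw [mfderiv_comp x chart_diff hg]
  exact congrArg (fun q : E => mfderiv 𝓘(ℝ, E) 𝓘(ℝ, E) (extChartAt 𝓘(ℝ, E) x) (g x)
    (mfderiv 𝓘(ℝ, E) 𝓘(ℝ, E) g x q)) (mfderiv_chart_symm_self (E := E) x w)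

variable {𝔡 : Type*} [NormedAddCommGroup 𝔡] [NormedSpace ℝ 𝔡]
  {D : Type*} [TopologicalSpace D] [Group D] [ChartedSpace 𝔡 D]

/-- The left-invariant vector field defined by `v ∈ 𝔡 = T_1 D`. -/
def leftField (D : Type*) [TopologicalSpace D] [Group D] [ChartedSpace 𝔡 D]
    (v : 𝔡) (a : D) : TangentSpace 𝓘(ℝ, 𝔡) a :=
  mfderiv 𝓘(ℝ, 𝔡) 𝓘(ℝ, 𝔡) (fun b : D => a * b) 1 v

/-- The multiplication of `D` in the preferred chart around the identity. -/
def chartMul (D : Type*) [TopologicalSpace D] [Group D] [ChartedSpace 𝔡 D] (p : 𝔡 × 𝔡) : 𝔡 :=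
  extChartAt 𝓘(ℝ, 𝔡) (1 : D) ((extChartAt 𝓘(ℝ, 𝔡) (1 : D)).symm p.1 *
    (extChartAt 𝓘(ℝ, 𝔡) (1 : D)).symm p.2)

/-- The right trivialization of `T D`, as a family of endomorphisms of `𝔡` in the preferred chart
around the identity: `rightFrame D z u` is the value at `z` of the right-invariant field of `u`. -/
def rightFrame (D : Type*) [TopologicalSpace D] [Group D] [ChartedSpace 𝔡 D] (z : 𝔡) :
    𝔡 →L[ℝ] 𝔡 :=
  (mfderiv 𝓘(ℝ, 𝔡) 𝓘(ℝ, 𝔡) (extChartAt 𝓘(ℝ, 𝔡) (1 : D))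
    ((extChartAt 𝓘(ℝ, 𝔡) (1 : D)).symm z)).comp
      (mfderiv 𝓘(ℝ, 𝔡) 𝓘(ℝ, 𝔡) (fun b : D => b * (extChartAt 𝓘(ℝ, 𝔡) (1 : D)).symm z) 1)

variable [LieGroup 𝓘(ℝ, 𝔡) ∞ D]

theorem mdifferentiable_conj (a : D) :
    MDifferentiable 𝓘(ℝ, 𝔡) 𝓘(ℝ, 𝔡) (fun b : D => a * b * a⁻¹) :=
  ((contMDiff_mul_right (I := 𝓘(ℝ, 𝔡)) (n := ∞) (a := a⁻¹)).comp
    (contMDiff_mul_left (I := 𝓘(ℝ, 𝔡)) (n := ∞) (a := a))).mdifferentiable (by simp)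

theorem rightField_adjoint (a : D) (v : 𝔡) : rightField D (adjoint a v) a = leftField D v a := by
  have mul_left_eq : (fun b : D => a * b) = (fun b : D => b * a) ∘ (fun b => a * b * a⁻¹) :=
    funext fun b => (inv_mul_cancel_right (a * b) a).symm
  rw [leftField, mul_left_eq]
  exact (mfderiv_comp_apply_of_eq (1 : D) (mdifferentiable_mul_right (𝔡 := 𝔡) a 1)
    (mdifferentiable_conj a 1) (by simp) v).symm

theorem contDiffAt_chartMul : ContDiffAt ℝ ∞ (chartMul (𝔡 := 𝔡) D)
    (extChartAt 𝓘(ℝ, 𝔡) (1 : D) 1, extChartAt 𝓘(ℝ, 𝔡) (1 : D) 1) := by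
  let ψ := extChartAt 𝓘(ℝ, 𝔡) (1 : D)
  let e : 𝔡 := ψ 1
  have symm_smooth : ContMDiffAt 𝓘(ℝ, 𝔡) 𝓘(ℝ, 𝔡) ∞ ψ.symm e :=
    (contMDiffOn_extChartAt_symm (1 : D)).contMDiffAt
      (extChartAt_target_mem_nhds (I := 𝓘(ℝ, 𝔡)) (1 : D))
  have fst_smooth : ContMDiffAt 𝓘(ℝ, 𝔡 × 𝔡) 𝓘(ℝ, 𝔡) ∞ (fun p : 𝔡 × 𝔡 => ψ.symm p.1) (e, e) :=
    ContMDiffAt.comp (e, e) (g := ψ.symm) (f := Prod.fst) symm_smooth contDiffAt_fst.contMDiffAt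
  have snd_smooth : ContMDiffAt 𝓘(ℝ, 𝔡 × 𝔡) 𝓘(ℝ, 𝔡) ∞ (fun p : 𝔡 × 𝔡 => ψ.symm p.2) (e, e) :=
    ContMDiffAt.comp (e, e) (g := ψ.symm) (f := Prod.snd) symm_smooth contDiffAt_snd.contMDiffAt
  rw [← contMDiffAt_iff_contDiffAt]
  refine ContMDiffAt.comp (e, e) (contMDiffAt_extChartAt' (n := ∞) ?_) (fst_smooth.mul snd_smooth)
  change ψ.symm e * ψ.symm e ∈ _
  rw [extChartAt_to_inv (I := 𝓘(ℝ, 𝔡)) (1 : D), one_mul]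
  exact mem_chart_source 𝔡 1

theorem eventually_differentiableAt_chartMul :
    ∀ᶠ p in 𝓝 (extChartAt 𝓘(ℝ, 𝔡) (1 : D) 1, extChartAt 𝓘(ℝ, 𝔡) (1 : D) 1),
      DifferentiableAt ℝ (chartMul (𝔡 := 𝔡) D) p := by
  filter_upwards [((contDiffAt_chartMul (𝔡 := 𝔡) (D := D)).of_le
    (m := 1) (by norm_cast)).eventually (by simp)] with p hp
    using hp.differentiableAt (by simp)

theorem fieldRep_rightField_eventuallyEq (w : 𝔡) :
    fieldRep (rightField D w) 1 =ᶠ[𝓝 (extChartAt 𝓘(ℝ, 𝔡) (1 : D) 1)]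
      fun y => fderiv ℝ (chartMul (𝔡 := 𝔡) D) (extChartAt 𝓘(ℝ, 𝔡) (1 : D) 1, y) (w, 0) := by
  have tendsto := (continuous_const.prodMk continuous_id :
    Continuous fun y : 𝔡 => (extChartAt 𝓘(ℝ, 𝔡) (1 : D) 1, y)).tendsto
      (extChartAt 𝓘(ℝ, 𝔡) (1 : D) 1)
  filter_upwards [extChartAt_target_mem_nhds (I := 𝓘(ℝ, 𝔡)) (1 : D),
    tendsto.eventually eventually_differentiableAt_chartMul] with y hy differentiable
  have partial_deriv := (HasFDerivAt.comp _ (g := chartMul (𝔡 := 𝔡) D)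
    (f := fun z => (z, y)) differentiable.hasFDerivAt
    (hasFDerivAt_prodMk_left (𝕜 := ℝ) (extChartAt 𝓘(ℝ, 𝔡) (1 : D) 1) y)).fderiv
  refine Eq.trans ?_ (DFunLike.congr_fun partial_deriv w)
  exact (fderiv_chart_comp (g := fun b : D => b * (extChartAt 𝓘(ℝ, 𝔡) (1 : D)).symm y)
    (one_mul _) (mdifferentiable_mul_right (𝔡 := 𝔡) _ 1) (chart_symm_mem_source 1 hy) w).symm

theorem fieldRep_leftField_eventuallyEq (v : 𝔡) :
    fieldRep (leftField D v) 1 =ᶠ[𝓝 (extChartAt 𝓘(ℝ, 𝔡) (1 : D) 1)]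
      fun x => fderiv ℝ (chartMul (𝔡 := 𝔡) D) (x, extChartAt 𝓘(ℝ, 𝔡) (1 : D) 1) (0, v) := by
  have tendsto := (continuous_id.prodMk continuous_const :
    Continuous fun x : 𝔡 => (x, extChartAt 𝓘(ℝ, 𝔡) (1 : D) 1)).tendsto
      (extChartAt 𝓘(ℝ, 𝔡) (1 : D) 1)
  filter_upwards [extChartAt_target_mem_nhds (I := 𝓘(ℝ, 𝔡)) (1 : D),
    tendsto.eventually eventually_differentiableAt_chartMul] with x hx differentiable
  have partial_deriv := (HasFDerivAt.comp _ (g := chartMul (𝔡 := 𝔡) D) differentiable.hasFDerivAt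
    (hasFDerivAt_prodMk_right (𝕜 := ℝ) x (extChartAt 𝓘(ℝ, 𝔡) (1 : D) 1))).fderiv
  refine Eq.trans ?_ (DFunLike.congr_fun partial_deriv v)
  exact (fderiv_chart_comp (g := fun b : D => (extChartAt 𝓘(ℝ, 𝔡) (1 : D)).symm x * b)
    (mul_one _) ((contMDiff_mul_left (I := 𝓘(ℝ, 𝔡)) (n := ∞)).mdifferentiable (by simp) 1)
    (chart_symm_mem_source 1 hx) v).symm

theorem differentiableAt_fderiv_chartMul :
    DifferentiableAt ℝ (fderiv ℝ (chartMul (𝔡 := 𝔡) D))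
      (extChartAt 𝓘(ℝ, 𝔡) (1 : D) 1, extChartAt 𝓘(ℝ, 𝔡) (1 : D) 1) :=
  (contDiffAt_chartMul.fderiv_right (m := 1) (by norm_cast)).differentiableAt (by simp)

theorem hasFDerivAt_fieldRep_leftField (v : 𝔡) :
    HasFDerivAt (fieldRep (leftField D v) 1)
      ((fderiv ℝ (fderiv ℝ (chartMul (𝔡 := 𝔡) D))
        (extChartAt 𝓘(ℝ, 𝔡) (1 : D) 1, extChartAt 𝓘(ℝ, 𝔡) (1 : D) 1)).flip (0, v) ∘L
          ContinuousLinearMap.inl ℝ 𝔡 𝔡) (extChartAt 𝓘(ℝ, 𝔡) (1 : D) 1) := by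
  refine HasFDerivAt.congr_of_eventuallyEq ?_ (fieldRep_leftField_eventuallyEq v)
  refine ((HasFDerivAt.comp _ (g := fderiv ℝ (chartMul (𝔡 := 𝔡) D))
    (f := fun z => (z, extChartAt 𝓘(ℝ, 𝔡) (1 : D) 1))
    differentiableAt_fderiv_chartMul.hasFDerivAt
    (hasFDerivAt_prodMk_left (𝕜 := ℝ) (extChartAt 𝓘(ℝ, 𝔡) (1 : D) 1)
      (extChartAt 𝓘(ℝ, 𝔡) (1 : D) 1))).clm_apply
        (hasFDerivAt_const ((0, v) : 𝔡 × 𝔡) _)).congr_fderiv ?_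
  ext w
  simp

/-- Left- and right-invariant vector fields commute: both derivatives are the mixed second
derivative of the multiplication. -/
theorem fderiv_fieldRep_leftField (v w : 𝔡) :
    fderiv ℝ (fieldRep (leftField D v) 1) (extChartAt 𝓘(ℝ, 𝔡) (1 : D) 1) w =
      fderiv ℝ (fieldRep (rightField D w) 1) (extChartAt 𝓘(ℝ, 𝔡) (1 : D) 1) v := by
  have fderiv_right := ((HasFDerivAt.comp _ (g := fderiv ℝ (chartMul (𝔡 := 𝔡) D))
    differentiableAt_fderiv_chartMul.hasFDerivAt
    (hasFDerivAt_prodMk_right (𝕜 := ℝ) (extChartAt 𝓘(ℝ, 𝔡) (1 : D) 1)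
      (extChartAt 𝓘(ℝ, 𝔡) (1 : D) 1))).clm_apply
        (hasFDerivAt_const ((w, 0) : 𝔡 × 𝔡) _)).fderiv
  rw [(fieldRep_rightField_eventuallyEq (D := D) w).fderiv_eq (𝕜 := ℝ),
    (hasFDerivAt_fieldRep_leftField v).fderiv]
  refine Eq.trans ?_ (DFunLike.congr_fun fderiv_right v).symm
  have symm_second := (contDiffAt_chartMul (𝔡 := 𝔡) (D := D)).isSymmSndFDerivAt
    minSmoothness_two_le_infty
  simpa using symm_second.eq (w, 0) (0, v)

theorem rightFrame_one :
    rightFrame D (extChartAt 𝓘(ℝ, 𝔡) (1 : D) 1) = ContinuousLinearMap.id ℝ 𝔡 :=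
  ContinuousLinearMap.ext fieldRep_rightField_one

theorem rightFrame_adjoint (z v : 𝔡) :
    rightFrame D z (adjoint ((extChartAt 𝓘(ℝ, 𝔡) (1 : D)).symm z) v) =
      fieldRep (leftField D v) 1 z :=
  congrArg (mfderiv 𝓘(ℝ, 𝔡) 𝓘(ℝ, 𝔡) (extChartAt 𝓘(ℝ, 𝔡) (1 : D)) _)
    (rightField_adjoint ((extChartAt 𝓘(ℝ, 𝔡) (1 : D)).symm z) v)

variable [FiniteDimensional ℝ 𝔡]

theorem lieBracket_fieldRep_rightField (u v : 𝔡) {y : 𝔡}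
    (hy : y ∈ (extChartAt 𝓘(ℝ, 𝔡) (1 : D)).target) :
    VectorField.lieBracket ℝ (fieldRep (rightField D u) 1) (fieldRep (rightField D v) 1) y =
      fieldRep (rightField D (lieBr D u v)) 1 y := by
  refine lieBracket_fieldRep_actionField (D := D) (N := D) 1 hy
    (contMDiff_mul_right (I := 𝓘(ℝ, 𝔡)) (n := ∞)) (fun w => ?_) u v
  exact ((contDiffOn_fieldRep_rightField w (1 : D)).contDiffAt
    ((isOpen_extChartAt_target (1 : D)).mem_nhds hy)).differentiableAt (by simp)

theorem lieBr_skew (u v : 𝔡) : lieBr D u v = -lieBr D v u := by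
  rw [lieBr_apply, lieBr_apply, VectorField.mlieBracket_swap_apply]
  rfl

theorem lieBr_leibniz (u v w : 𝔡) :
    lieBr D u (lieBr D v w) = lieBr D (lieBr D u v) w + lieBr D v (lieBr D u w) := by
  have target_mem := extChartAt_target_mem_nhds (I := 𝓘(ℝ, 𝔡)) (1 : D)
  have smooth (w : 𝔡) : ContDiffAt ℝ ∞ (fieldRep (rightField D w) 1)
      (extChartAt 𝓘(ℝ, 𝔡) (1 : D) 1) :=
    (contDiffOn_fieldRep_rightField w (1 : D)).contDiffAt target_mem
  have bracket_eq (u v : 𝔡) : VectorField.lieBracket ℝ (fieldRep (rightField D u) 1)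
      (fieldRep (rightField D v) 1) =ᶠ[𝓝 (extChartAt 𝓘(ℝ, 𝔡) (1 : D) 1)]
      fieldRep (rightField D (lieBr D u v)) 1 := by
    filter_upwards [target_mem] with y hy using lieBracket_fieldRep_rightField u v hy
  have leibniz := VectorField.leibniz_identity_lieBracket minSmoothness_two_le_infty
    (smooth u) (smooth v) (smooth w)
  rwa [Filter.EventuallyEq.rfl.lieBracket_vectorField_eq (bracket_eq v w),
    (bracket_eq u v).lieBracket_vectorField_eq Filter.EventuallyEq.rfl,
    Filter.EventuallyEq.rfl.lieBracket_vectorField_eq (bracket_eq u w),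
    (bracket_eq _ _).self_of_nhds, (bracket_eq _ _).self_of_nhds,
    (bracket_eq _ _).self_of_nhds, fieldRep_rightField_one, fieldRep_rightField_one,
    fieldRep_rightField_one] at leibniz

theorem contDiffAt_rightFrame :
    ContDiffAt ℝ ∞ (rightFrame (𝔡 := 𝔡) D) (extChartAt 𝓘(ℝ, 𝔡) (1 : D) 1) :=
  (contDiffOn_clm_apply.2 fun u => contDiffOn_fieldRep_rightField u (1 : D)).contDiffAt
    (extChartAt_target_mem_nhds (I := 𝓘(ℝ, 𝔡)) (1 : D))

theorem fderiv_rightFrame_apply (u w : 𝔡) :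
    fderiv ℝ (rightFrame D) (extChartAt 𝓘(ℝ, 𝔡) (1 : D) 1) w u =
      fderiv ℝ (fieldRep (rightField D u) 1) (extChartAt 𝓘(ℝ, 𝔡) (1 : D) 1) w := by
  have evaluated := fderiv_clm_apply (contDiffAt_rightFrame (D := D).differentiableAt (by simp))
    (differentiableAt_const u)
  refine Eq.trans ?_ (DFunLike.congr_fun evaluated w).symm
  simp

theorem differentiableAt_adjoint (v : 𝔡) :
    DifferentiableAt ℝ (fun z => adjoint ((extChartAt 𝓘(ℝ, 𝔡) (1 : D)).symm z) v : 𝔡 → 𝔡)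
      (extChartAt 𝓘(ℝ, 𝔡) (1 : D) 1) := by
  have smooth := contDiffAt_rightFrame (𝔡 := 𝔡) (D := D)
  have invertible : ∀ᶠ z in 𝓝 (extChartAt 𝓘(ℝ, 𝔡) (1 : D) 1), (rightFrame D z).IsInvertible := by
    have nhds_id := ContinuousLinearEquiv.nhds (ContinuousLinearEquiv.refl ℝ 𝔡)
    rw [ContinuousLinearEquiv.coe_refl, ← rightFrame_one (D := D)] at nhds_id
    exact smooth.continuousAt.preimage_mem_nhds nhds_id
  have inverse_diff : DifferentiableAt ℝ (fun z => (rightFrame D z).inverse)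
      (extChartAt 𝓘(ℝ, 𝔡) (1 : D) 1) :=
    ((invertible.self_of_nhds.contDiffAt_map_inverse (n := ∞)).comp _ smooth).differentiableAt
      (by simp)
  refine (inverse_diff.clm_apply
    (hasFDerivAt_fieldRep_leftField v).differentiableAt).congr_of_eventuallyEq ?_
  filter_upwards [invertible] with z hz
  rw [← rightFrame_adjoint, hz.inverse_apply_self]

/-- The sign comes from the Lie bracket being that of right-invariant fields. -/
theorem fderiv_adjoint (v w : 𝔡) :
    fderiv ℝ (fun z => adjoint ((extChartAt 𝓘(ℝ, 𝔡) (1 : D)).symm z) v : 𝔡 → 𝔡)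
      (extChartAt 𝓘(ℝ, 𝔡) (1 : D) 1) w = -lieBr D w v := by
  have product_rule := DFunLike.congr_fun (fderiv_clm_apply
    (contDiffAt_rightFrame (D := D).differentiableAt (by simp)) (differentiableAt_adjoint v)) w
  have bracket := lieBracket_fieldRep_rightField (D := D) w v
    (mem_extChartAt_target (I := 𝓘(ℝ, 𝔡)) (1 : D))
  simp only [VectorField.lieBracket, fieldRep_rightField_one] at bracket
  simp only [rightFrame_adjoint, rightFrame_one, extChartAt_to_inv, adjoint_one, add_apply,
    ContinuousLinearMap.comp_apply, ContinuousLinearMap.flip_apply, ContinuousLinearMap.id_apply,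
    fderiv_rightFrame_apply] at product_rule
  have commute := (fderiv_fieldRep_leftField (D := D) v w).symm.trans product_rule
  rw [← bracket, commute]
  abel

theorem infinitesimal_adInvariant {B : 𝔡 →L[ℝ] 𝔡 →L[ℝ] ℝ}
    (hB : ∀ (a : D) (u v : 𝔡), B (adjoint a u) (adjoint a v) = B u v) (w u v : 𝔡) :
    B (lieBr D w u) v + B u (lieBr D w v) = 0 := by
  have product_rule := fderiv_bilinear_apply B (differentiableAt_adjoint (D := D) u)
    (differentiableAt_adjoint v) w
  have constant : fderiv ℝ (fun z : 𝔡 => B (adjoint ((extChartAt 𝓘(ℝ, 𝔡) (1 : D)).symm z) u)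
      (adjoint ((extChartAt 𝓘(ℝ, 𝔡) (1 : D)).symm z) v)) (extChartAt 𝓘(ℝ, 𝔡) (1 : D) 1) w = 0 := by
    simp [hB]
  simp only [constant, fderiv_adjoint, extChartAt_to_inv, adjoint_one, map_neg,
    neg_apply] at product_rule
  linarith

end LieAlgebra

section Submersion

variable {V E : Type*} [NormedAddCommGroup V] [NormedSpace ℝ V] [NormedAddCommGroup E]
  [NormedSpace ℝ E] [CompleteSpace E] {f : V → E} {v₀ : V} {T : E →L[ℝ] V}

theorem exists_local_section (hf : ContDiffAt ℝ ∞ f v₀) (hT : ∀ e, fderiv ℝ f v₀ (T e) = e) :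
    ∃ τ : E → V, ContDiffAt ℝ ∞ τ (f v₀) ∧ τ (f v₀) = v₀ ∧ HasFDerivAt τ T (f v₀) ∧
      ∀ᶠ y in 𝓝 (f v₀), f (τ y) = y := by
  let h : E → E := fun e => f (v₀ + T e)
  have base : v₀ + T 0 = v₀ := by simp
  have h_zero : h 0 = f v₀ := congrArg f base
  have smooth : ContDiffAt ℝ ∞ h 0 :=
    ContDiffAt.comp (0 : E) (g := f) (base.symm ▸ hf)
      (contDiffAt_const.add T.contDiff.contDiffAt)
  have h_deriv : HasFDerivAt h (ContinuousLinearEquiv.refl ℝ E : E →L[ℝ] E) 0 := by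
    have f_deriv : HasFDerivAt f (fderiv ℝ f v₀) (v₀ + T 0) :=
      base.symm ▸ (hf.differentiableAt (by simp)).hasFDerivAt
    refine (HasFDerivAt.comp (0 : E) f_deriv (T.hasFDerivAt.const_add v₀)).congr_fderiv ?_
    ext e
    exact hT e
  have strict := smooth.hasStrictFDerivAt' h_deriv (by simp)
  have inverse_smooth := smooth.to_localInverse h_deriv (by simp)
  have inverse_image := smooth.localInverse_apply_image h_deriv (by simp)
  have inverse_deriv := strict.to_localInverse.hasFDerivAt
  have right_inverse := strict.eventually_right_inverse
  rw [h_zero] at inverse_smooth inverse_image inverse_deriv right_inverse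
  refine ⟨fun y => v₀ + T (smooth.localInverse h_deriv (by simp) y),
    contDiffAt_const.add (T.contDiff.contDiffAt.comp _ inverse_smooth),
    by dsimp only; rw [inverse_image, base], ?_, right_inverse⟩
  refine ((T.hasFDerivAt.comp _ inverse_deriv).const_add v₀).congr_fderiv ?_
  ext e
  rfl

/-- The curve is a local section of `(t, v) ↦ (t, f v)` restricted to `ℝ × {f v₀}`. -/
theorem exists_curve_in_fibre (hf : ContDiffAt ℝ ∞ f v₀) (hT : ∀ e, fderiv ℝ f v₀ (T e) = e)
    {v : V} (hv : fderiv ℝ f v₀ v = 0) :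
    ∃ γ : ℝ → V, ContDiffAt ℝ ∞ γ 0 ∧ γ 0 = v₀ ∧
      HasFDerivAt γ (ContinuousLinearMap.toSpanSingleton ℝ v) 0 ∧ ∀ᶠ t in 𝓝 0, f (γ t) = f v₀ := by
  have smooth : ContDiffAt ℝ ∞ (fun p : ℝ × V => (p.1, f p.2)) (0, v₀) :=
    contDiffAt_fst.prodMk (ContDiffAt.comp (0, v₀) (g := f) hf contDiffAt_snd)
  have deriv : HasFDerivAt (fun p : ℝ × V => (p.1, f p.2)) _ (0, v₀) :=
    hasFDerivAt_fst.prodMk (HasFDerivAt.comp (0, v₀) (g := f)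
      (hf.differentiableAt (by simp)).hasFDerivAt hasFDerivAt_snd)
  obtain ⟨τ, τ_smooth, τ_base, τ_deriv, τ_section⟩ := exists_local_section (T :=
    (ContinuousLinearMap.fst ℝ ℝ E).prod (T ∘L ContinuousLinearMap.snd ℝ ℝ E +
      (ContinuousLinearMap.toSpanSingleton ℝ v) ∘L ContinuousLinearMap.fst ℝ ℝ E)) smooth
    (fun e => by
      rw [deriv.fderiv]
      ext <;> simp [hT, hv])
  have slice_smooth : ContDiffAt ℝ ∞ (fun t : ℝ => (t, f v₀)) 0 :=
    contDiffAt_id.prodMk contDiffAt_const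
  have slice_deriv := hasFDerivAt_prodMk_left (𝕜 := ℝ) (0 : ℝ) (f v₀)
  refine ⟨fun t => (τ (t, f v₀)).2, contDiffAt_snd.comp _ (τ_smooth.comp (0 : ℝ) slice_smooth),
    congrArg Prod.snd τ_base, ?_, ?_⟩
  · refine (hasFDerivAt_snd.comp (0 : ℝ) (τ_deriv.comp (0 : ℝ) slice_deriv)).congr_fderiv ?_
    ext
    simp
  · filter_upwards [slice_smooth.continuousAt.eventually τ_section] with t ht
      using congrArg Prod.snd ht

end Submersion

section TransitiveAction

variable {𝔡 : Type*} [NormedAddCommGroup 𝔡] [NormedSpace ℝ 𝔡]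
  {D : Type*} [TopologicalSpace D] [Group D] [ChartedSpace 𝔡 D] [LieGroup 𝓘(ℝ, 𝔡) ∞ D]

theorem exists_curve_of_hasFDerivAt {γ : ℝ → 𝔡} {u : 𝔡} (smooth : ContDiffAt ℝ ∞ γ 0)
    (hγ : γ 0 = extChartAt 𝓘(ℝ, 𝔡) (1 : D) 1)
    (deriv : HasFDerivAt γ (ContinuousLinearMap.toSpanSingleton ℝ u) 0) :
    ContMDiffAt 𝓘(ℝ, ℝ) 𝓘(ℝ, 𝔡) ∞ (fun t => (extChartAt 𝓘(ℝ, 𝔡) (1 : D)).symm (γ t)) 0 ∧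
      (mfderiv 𝓘(ℝ, ℝ) 𝓘(ℝ, 𝔡) (fun t => (extChartAt 𝓘(ℝ, 𝔡) (1 : D)).symm (γ t)) 0
        (1 : ℝ) : 𝔡) = u := by
  have symm_diff := mdifferentiableAt_chart_symm (1 : D)
    (mem_extChartAt_target (I := 𝓘(ℝ, 𝔡)) (1 : D))
  constructor
  · refine ContMDiffAt.comp (0 : ℝ) (g := (extChartAt 𝓘(ℝ, 𝔡) (1 : D)).symm) (f := γ)
      (I' := 𝓘(ℝ, 𝔡)) ?_ smooth.contMDiffAt
    rw [hγ]
    exact (contMDiffOn_extChartAt_symm (n := ∞) (I := 𝓘(ℝ, 𝔡)) (1 : D)).contMDiffAt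
      (extChartAt_target_mem_nhds (I := 𝓘(ℝ, 𝔡)) (1 : D))
  · have velocity : (mfderiv 𝓘(ℝ, ℝ) 𝓘(ℝ, 𝔡) γ 0 (1 : ℝ) : 𝔡) = u := by
      rw [mfderiv_eq_fderiv, deriv.fderiv]
      exact one_smul ℝ u
    refine (mfderiv_comp_apply_of_eq (0 : ℝ) symm_diff
      deriv.differentiableAt.mdifferentiableAt hγ (1 : ℝ)).trans ?_
    exact (congrArg (mfderiv 𝓘(ℝ, 𝔡) 𝓘(ℝ, 𝔡) (extChartAt 𝓘(ℝ, 𝔡) (1 : D)).symm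
      (extChartAt 𝓘(ℝ, 𝔡) (1 : D) 1)) velocity).trans (mfderiv_chart_symm_self (1 : D) u)

variable {E : Type*} [NormedAddCommGroup E] [NormedSpace ℝ E] [FiniteDimensional ℝ E]
  {N : Type*} [TopologicalSpace N] [ChartedSpace E N] [MulAction D N]
  [IsManifold 𝓘(ℝ, E) ∞ N]

theorem exists_rightInverse_fderiv_orbitChart {x₀ x : N}
    (orbit : ContMDiff 𝓘(ℝ, 𝔡) 𝓘(ℝ, E) ∞ (fun a : D => a • x))
    (transitive : ∀ X : TangentSpace 𝓘(ℝ, E) x, ∃ u : 𝔡, actionField D u x = X)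
    (hx : x ∈ (chartAt E x₀).source) :
    ∃ T : E →L[ℝ] 𝔡, ∀ e, fderiv ℝ (orbitChart D E x₀ x) (extChartAt 𝓘(ℝ, 𝔡) (1 : D) 1) (T e) =
      e := by
  have hx' : x ∈ (extChartAt 𝓘(ℝ, E) x₀).source := by rwa [extChartAt_source]
  have surjective : Function.Surjective
      (fderiv ℝ (orbitChart D E x₀ x) (extChartAt 𝓘(ℝ, 𝔡) (1 : D) 1)) := by
    intro e
    have left_inv := (extChartAt 𝓘(ℝ, E) x₀).left_inv hx'
    obtain ⟨u, hu⟩ := transitive (mfderiv 𝓘(ℝ, E) 𝓘(ℝ, E) (extChartAt 𝓘(ℝ, E) x₀).symm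
      (extChartAt 𝓘(ℝ, E) x₀ x) e)
    have cancel := mfderiv_chart_comp_symm x₀ ((extChartAt 𝓘(ℝ, E) x₀).map_source hx') e
    refine ⟨u, ?_⟩
    rw [fderiv_orbitChart_one orbit hx, fieldRep, left_inv, hu]
    rwa [left_inv] at cancel
  obtain ⟨T, hT⟩ := LinearMap.exists_rightInverse_of_surjective
    (fderiv ℝ (orbitChart D E x₀ x) (extChartAt 𝓘(ℝ, 𝔡) (1 : D) 1)).toLinearMap
    (LinearMap.range_eq_top.2 surjective)
  exact ⟨LinearMap.toContinuousLinearMap T, fun e => DFunLike.congr_fun hT e⟩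

/-- Along a local section `τ` of an orbit map, the fundamental field is the image of the
right-invariant field. -/
theorem contDiffOn_fieldRep_actionField
    (orbit : ∀ x : N, ContMDiff 𝓘(ℝ, 𝔡) 𝓘(ℝ, E) ∞ (fun a : D => a • x))
    (transitive : ∀ (x : N) (X : TangentSpace 𝓘(ℝ, E) x), ∃ u : 𝔡, actionField D u x = X)
    (u : 𝔡) (x₀ : N) :
    ContDiffOn ℝ ∞ (fieldRep (actionField D (N := N) u) x₀) (extChartAt 𝓘(ℝ, E) x₀).target := by
  have : CompleteSpace E := FiniteDimensional.complete ℝ E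
  intro y hy
  let x := (extChartAt 𝓘(ℝ, E) x₀).symm y
  let e : 𝔡 := extChartAt 𝓘(ℝ, 𝔡) (1 : D) 1
  let f : 𝔡 → E := orbitChart D E x₀ x
  have hx : x ∈ (chartAt E x₀).source := chart_symm_mem_source x₀ hy
  have f_one : f e = y := (orbitChart_one x₀ x).trans ((extChartAt 𝓘(ℝ, E) x₀).right_inv hy)
  have f_smooth : ContDiffAt ℝ ∞ f e := contDiffAt_orbitChart (orbit x) hx
  have field_smooth : ContDiffAt ℝ ∞ (fieldRep (rightField D u) 1) e :=
    (contDiffOn_fieldRep_rightField u (1 : D)).contDiffAt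
      (extChartAt_target_mem_nhds (I := 𝓘(ℝ, 𝔡)) (1 : D))
  obtain ⟨T, hT⟩ := exists_rightInverse_fderiv_orbitChart (orbit x) (transitive x) hx
  obtain ⟨τ, τ_smooth, τ_base, -, τ_section⟩ := exists_local_section f_smooth hT
  rw [f_one] at τ_smooth τ_base τ_section
  have along_section : fieldRep (actionField D (N := N) u) x₀ =ᶠ[𝓝 y]
      fun y' => fderiv ℝ f (τ y') (fieldRep (rightField D u) 1 (τ y')) := by
    have tendsto := τ_smooth.continuousAt.tendsto
    rw [τ_base] at tendsto
    filter_upwards [τ_section, tendsto.eventually (fderiv_orbitChart_rightField (orbit x) hx u)]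
      with y' hτ related
    rw [related]
    exact congrArg _ hτ.symm
  refine (ContDiffAt.congr_of_eventuallyEq ?_ along_section).contDiffWithinAt
  have fderiv_smooth : ContDiffAt ℝ ∞ (fderiv ℝ f) (τ y) := by
    rw [τ_base]
    exact f_smooth.fderiv_right (by simp)
  rw [← τ_base] at field_smooth
  exact (fderiv_smooth.comp y τ_smooth).clm_apply (field_smooth.comp y τ_smooth)

theorem exists_curve_eventually_smul_eq {x : N}
    (orbit : ContMDiff 𝓘(ℝ, 𝔡) 𝓘(ℝ, E) ∞ (fun a : D => a • x))
    (transitive : ∀ X : TangentSpace 𝓘(ℝ, E) x, ∃ u : 𝔡, actionField D u x = X)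
    {u : 𝔡} (hu : actionField (E := E) D u x = 0) :
    ∃ β : ℝ → D, ContMDiffAt 𝓘(ℝ, ℝ) 𝓘(ℝ, 𝔡) ∞ β 0 ∧ β 0 = 1 ∧
      (mfderiv 𝓘(ℝ, ℝ) 𝓘(ℝ, 𝔡) β 0 (1 : ℝ) : 𝔡) = u ∧ ∀ᶠ t in 𝓝 0, β t • x = x := by
  have : CompleteSpace E := FiniteDimensional.complete ℝ E
  have hx : x ∈ (chartAt E x).source := mem_chart_source E x
  have fderiv_zero :
      fderiv ℝ (orbitChart D E x x) (extChartAt 𝓘(ℝ, 𝔡) (1 : D) 1) u = 0 := by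
    rw [fderiv_orbitChart_one orbit hx, fieldRep_self]
    exact hu
  obtain ⟨T, hT⟩ := exists_rightInverse_fderiv_orbitChart orbit transitive hx
  obtain ⟨γ, γ_smooth, γ_zero, γ_deriv, γ_fibre⟩ :=
    exists_curve_in_fibre (contDiffAt_orbitChart orbit hx) hT fderiv_zero
  obtain ⟨smooth, velocity⟩ := exists_curve_of_hasFDerivAt γ_smooth γ_zero γ_deriv
  refine ⟨_, smooth, by rw [γ_zero, extChartAt_to_inv], velocity, ?_⟩
  have tendsto := γ_smooth.continuousAt.tendsto
  rw [γ_zero] at tendsto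
  filter_upwards [γ_fibre, tendsto.eventually (eventually_orbit_mem orbit.continuous
    ((chartAt E x).open_source.mem_nhds hx))] with t fibre mem
  rw [orbitChart_one] at fibre
  exact (extChartAt 𝓘(ℝ, E) x).injOn (by rw [extChartAt_source]; exact mem.2)
    (mem_extChartAt_source x) fibre

end TransitiveAction

section LieSubgroup

variable {𝔡 : Type*} [NormedAddCommGroup 𝔡] [NormedSpace ℝ 𝔡]
  {D : Type*} [TopologicalSpace D] [Group D] [ChartedSpace 𝔡 D] {G : Subgroup D}

theorem velocity_mem_lieAlgebraOf {γ : ℝ → D} (smooth : ContMDiffAt 𝓘(ℝ, ℝ) 𝓘(ℝ, 𝔡) ∞ γ 0)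
    (γ_zero : γ 0 = 1) (γ_mem : ∀ᶠ t in 𝓝 0, γ t ∈ G) :
    (mfderiv 𝓘(ℝ, ℝ) 𝓘(ℝ, 𝔡) γ 0 (1 : ℝ) : 𝔡) ∈ lieAlgebraOf (𝔡 := 𝔡) G := by
  classical
  have germ_eq : (fun t => if γ t ∈ G then γ t else 1) =ᶠ[𝓝 0] γ := by
    filter_upwards [γ_mem] with t ht using if_pos ht
  refine ⟨_, smooth.congr_of_eventuallyEq germ_eq, fun t => ?_, ?_, ?_⟩
  · split_ifs with ht
    exacts [ht, G.one_mem]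
  · exact germ_eq.self_of_nhds.trans γ_zero
  · exact DFunLike.congr_fun (germ_eq.mfderiv_eq (I := 𝓘(ℝ, ℝ)) (I' := 𝓘(ℝ, 𝔡))) (1 : ℝ)

variable [LieGroup 𝓘(ℝ, 𝔡) ∞ D]

theorem velocity_conj {β : ℝ → D} (hβ : MDifferentiableAt 𝓘(ℝ, ℝ) 𝓘(ℝ, 𝔡) β 0)
    (β_zero : β 0 = 1) (a : D) :
    (mfderiv 𝓘(ℝ, ℝ) 𝓘(ℝ, 𝔡) (fun t => a * β t * a⁻¹) 0 (1 : ℝ) : 𝔡) =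
      adjoint (𝔡 := 𝔡) a (mfderiv 𝓘(ℝ, ℝ) 𝓘(ℝ, 𝔡) β 0 (1 : ℝ)) :=
  mfderiv_comp_apply_of_eq (0 : ℝ) (mdifferentiable_conj a 1) hβ β_zero (1 : ℝ)

variable {E : Type*} [NormedAddCommGroup E] [NormedSpace ℝ E] [ChartedSpace E (D ⧸ G)]

theorem contMDiff_orbit (hS : IsQuotientStructure 𝔡 E G) (x : D ⧸ G) :
    ContMDiff 𝓘(ℝ, 𝔡) 𝓘(ℝ, E) ∞ (fun a : D => a • x) := by
  obtain ⟨b, rfl⟩ := QuotientGroup.mk_surjective x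
  exact hS.smooth.comp (contMDiff_mul_right (I := 𝓘(ℝ, 𝔡)) (n := ∞) (a := b))

theorem dressing_one_eq_zero (hS : IsQuotientStructure 𝔡 E G) {u : 𝔡}
    (hu : u ∈ lieAlgebraOf G) : dressing E G ((1 : D) : D ⧸ G) u = 0 := by
  obtain ⟨γ, smooth, γ_mem, γ_zero, rfl⟩ := hu
  have constant : (fun a : D => a • ((1 : D) : D ⧸ G)) ∘ γ = fun _ => ((1 : D) : D ⧸ G) := by
    funext t
    refine QuotientGroup.eq.2 ?_
    simpa using γ_mem t
  have chain_rule := mfderiv_comp_apply_of_eq (0 : ℝ)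
    ((contMDiff_orbit hS ((1 : D) : D ⧸ G)).mdifferentiable (by simp) 1)
    (smooth.mdifferentiableAt (by simp)) γ_zero (1 : ℝ)
  rw [constant, mfderiv_const] at chain_rule
  exact chain_rule.symm

theorem adjoint_inv_mem_lieAlgebraOf [FiniteDimensional ℝ E] [IsManifold 𝓘(ℝ, E) ∞ (D ⧸ G)]
    (hS : IsQuotientStructure 𝔡 E G) {a : D}
    (transitive : Function.Surjective (dressing (𝔡 := 𝔡) E G a)) {u : 𝔡}
    (hu : dressing E G (a : D ⧸ G) u = 0) : adjoint a⁻¹ u ∈ lieAlgebraOf (𝔡 := 𝔡) G := by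
  obtain ⟨β, β_smooth, β_zero, rfl, β_fix⟩ :=
    exists_curve_eventually_smul_eq (contMDiff_orbit hS a) transitive hu
  rw [← velocity_conj (β_smooth.mdifferentiableAt (by simp)) β_zero]
  have conj_smooth : ContMDiff 𝓘(ℝ, 𝔡) 𝓘(ℝ, 𝔡) ∞ (fun b : D => a⁻¹ * b * a⁻¹⁻¹) :=
    (contMDiff_mul_right (I := 𝓘(ℝ, 𝔡)) (n := ∞) (a := a⁻¹⁻¹)).comp
      (contMDiff_mul_left (I := 𝓘(ℝ, 𝔡)) (n := ∞) (a := a⁻¹))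
  refine velocity_mem_lieAlgebraOf (conj_smooth.contMDiffAt.comp (0 : ℝ) β_smooth)
    (by simp [β_zero]) ?_
  filter_upwards [β_fix] with t ht
  simpa [mul_assoc] using QuotientGroup.eq.1 ht.symm

end LieSubgroup

section Connection

variable {𝔡 : Type*} [NormedAddCommGroup 𝔡] [NormedSpace ℝ 𝔡]
  {D : Type*} [TopologicalSpace D] [Group D] [ChartedSpace 𝔡 D]

/-- The infinitesimal dressing action in the preferred chart around `x₀`. -/
def dressingRep (E : Type*) [NormedAddCommGroup E] [NormedSpace ℝ E]
    (G : Subgroup D) [ChartedSpace E (D ⧸ G)] (x₀ : D ⧸ G) (y : E) : 𝔡 →L[ℝ] E :=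
  (mfderiv 𝓘(ℝ, E) 𝓘(ℝ, E) (extChartAt 𝓘(ℝ, E) x₀) ((extChartAt 𝓘(ℝ, E) x₀).symm y)).comp
    (dressing E G ((extChartAt 𝓘(ℝ, E) x₀).symm y))

/-- `B` is an Ad-invariant nondegenerate symmetric bilinear form on the Lie algebra `𝔡` of `D`, and
`𝔤` is the Lie algebra of the subgroup `G` and isotropic: the part of `IsGroupPair` that makes
sense for arbitrary `D` and `G`. -/
structure IsIsotropicGroupPair (B : 𝔡 →L[ℝ] 𝔡 →L[ℝ] ℝ) (𝔤 : Submodule ℝ 𝔡) (G : Subgroup D) :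
    Prop where
  symm : ∀ u v, B u v = B v u
  nondegenerate : ∀ u, (∀ v, B u v = 0) → u = 0
  adInvariant : ∀ (a : D) (u v : 𝔡), B (adjoint a u) (adjoint a v) = B u v
  isotropic : ∀ u ∈ 𝔤, ∀ v ∈ 𝔤, B u v = 0
  lieAlgebra : (𝔤 : Set 𝔡) = lieAlgebraOf G

variable {B : 𝔡 →L[ℝ] 𝔡 →L[ℝ] ℝ} {𝔤 : Submodule ℝ 𝔡} {G : Subgroup D}
  {E : Type*} [NormedAddCommGroup E] [NormedSpace ℝ E] [ChartedSpace E (D ⧸ G)]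
  {s : ∀ x : D ⧸ G, TangentSpace 𝓘(ℝ, E) x →L[ℝ] 𝔡}

theorem dressing_surjective (hs : IsIsotropicConnection B s) (x : D ⧸ G) :
    Function.Surjective (dressing (𝔡 := 𝔡) E G x) :=
  fun X => ⟨s x X, hs.splitting x X⟩

theorem contDiffOn_connectionRep (hs : IsIsotropicConnection B s) (x₀ : D ⧸ G) :
    ContDiffOn ℝ ∞ (oneRep s x₀) (extChartAt 𝓘(ℝ, E) x₀).target := by
  simpa using smoothOneFormOn_iff.1 hs.smooth x₀

theorem contDiffAt_connectionRep (hs : IsIsotropicConnection B s) (x₀ : D ⧸ G) {y : E}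
    (hy : y ∈ (extChartAt 𝓘(ℝ, E) x₀).target) : ContDiffAt ℝ ∞ (oneRep s x₀) y :=
  (contDiffOn_connectionRep hs x₀).contDiffAt ((isOpen_extChartAt_target x₀).mem_nhds hy)

theorem smoothOneFormOn_sigmaForm (hs : IsIsotropicConnection B s) (u : 𝔡) :
    SmoothOneFormOn (fun x => sigmaForm B s x u) Set.univ := by
  refine (smoothOneFormOn_iff (F := ℝ)).2 fun x₀ => ?_
  rw [Set.preimage_univ, Set.inter_univ]
  exact ContDiffOn.clm_comp (g := fun _ => B.flip u) contDiffOn_const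
    (contDiffOn_connectionRep hs x₀)

theorem diracL_eq_map (x : D ⧸ G) :
    diracL B 𝔤 s x = 𝔤.map (splittingMap B (dressing E G x) (s x)) := rfl

variable [IsManifold 𝓘(ℝ, E) ∞ (D ⧸ G)]

theorem dressingRep_self (x : D ⧸ G) (u : 𝔡) :
    dressingRep E G x (extChartAt 𝓘(ℝ, E) x x) u = dressing E G x u :=
  fieldRep_self (fun x => dressing E G x u) x

theorem dressing_eq_zero_of_dressingRep {x₀ : D ⧸ G} {y : E}
    (hy : y ∈ (extChartAt 𝓘(ℝ, E) x₀).target) {u : 𝔡} (hu : dressingRep E G x₀ y u = 0) :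
    dressing E G ((extChartAt 𝓘(ℝ, E) x₀).symm y) u = 0 := by
  rw [← mfderiv_chart_symm_comp x₀ hy (dressing E G _ u)]
  exact (congrArg (mfderiv 𝓘(ℝ, E) 𝓘(ℝ, E) (extChartAt 𝓘(ℝ, E) x₀).symm y) hu).trans (map_zero _)

variable [LieGroup 𝓘(ℝ, 𝔡) ∞ D]

section Stabiliser

variable [FiniteDimensional ℝ E]

/-- The stabiliser of the coset of `a` is the Lie algebra of `a G a⁻¹`, that is, `Ad_a 𝔤`. -/
theorem ker_dressing_isotropic (hpair : IsIsotropicGroupPair B 𝔤 G)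
    (hS : IsQuotientStructure 𝔡 E G) (hs : IsIsotropicConnection B s) (x : D ⧸ G) {u v : 𝔡}
    (hu : dressing E G x u = 0) (hv : dressing E G x v = 0) : B u v = 0 := by
  obtain ⟨a, rfl⟩ := QuotientGroup.mk_surjective x
  have adjoint_mem (w : 𝔡) (hw : dressing E G (a : D ⧸ G) w = 0) : adjoint a⁻¹ w ∈ 𝔤 := by
    rw [← SetLike.mem_coe, hpair.lieAlgebra]
    exact adjoint_inv_mem_lieAlgebraOf hS (dressing_surjective hs _) hw
  rw [← hpair.adInvariant a⁻¹]
  exact hpair.isotropic _ (adjoint_mem u hu) _ (adjoint_mem v hv)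

theorem isIsotropicSplitting_dressing (hpair : IsIsotropicGroupPair B 𝔤 G)
    (hS : IsQuotientStructure 𝔡 E G) (hs : IsIsotropicConnection B s) (x : D ⧸ G) :
    IsIsotropicSplitting B (dressing E G x) (s x) where
  splitting := hs.splitting x
  isotropic := hs.isotropic x
  ker_isotropic _ _ := ker_dressing_isotropic hpair hS hs x

theorem isIsotropicSplitting_dressingRep (hpair : IsIsotropicGroupPair B 𝔤 G)
    (hS : IsQuotientStructure 𝔡 E G) (hs : IsIsotropicConnection B s) (x₀ : D ⧸ G) {y : E}
    (hy : y ∈ (extChartAt 𝓘(ℝ, E) x₀).target) :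
    IsIsotropicSplitting B (dressingRep E G x₀ y) (oneRep s x₀ y) where
  splitting X := (congrArg (mfderiv 𝓘(ℝ, E) 𝓘(ℝ, E) (extChartAt 𝓘(ℝ, E) x₀)
    ((extChartAt 𝓘(ℝ, E) x₀).symm y)) (hs.splitting _ _)).trans (mfderiv_chart_comp_symm x₀ hy X)
  isotropic _ _ := hs.isotropic _ _ _
  ker_isotropic _ _ hu hv := ker_dressing_isotropic hpair hS hs _
    (dressing_eq_zero_of_dressingRep hy hu) (dressing_eq_zero_of_dressingRep hy hv)

theorem eq_ker_dressing_one (hpair : IsIsotropicGroupPair B 𝔤 G)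
    (hS : IsQuotientStructure 𝔡 E G) (hs : IsIsotropicConnection B s) :
    𝔤 = LinearMap.ker (dressing (𝔡 := 𝔡) E G ((1 : D) : D ⧸ G)).toLinearMap := by
  ext u
  rw [← SetLike.mem_coe, hpair.lieAlgebra]
  refine ⟨dressing_one_eq_zero hS, fun hu => ?_⟩
  have adjoint_mem := adjoint_inv_mem_lieAlgebraOf hS (dressing_surjective hs _) (a := 1) hu
  rwa [inv_one, adjoint_one] at adjoint_mem

theorem maximal_isotropic_subalgebra (hpair : IsIsotropicGroupPair B 𝔤 G)
    (hS : IsQuotientStructure 𝔡 E G) (hs : IsIsotropicConnection B s) :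
    Maximal (fun K : Submodule ℝ 𝔡 => ∀ u ∈ K, ∀ v ∈ K, B u v = 0) 𝔤 := by
  rw [eq_ker_dressing_one hpair hS hs]
  exact (isIsotropicSplitting_dressing hpair hS hs _).maximal_isotropic_ker hpair.nondegenerate

theorem eq_zero_of_dressing_sigmaForm (hpair : IsIsotropicGroupPair B 𝔤 G)
    (hS : IsQuotientStructure 𝔡 E G) (hs : IsIsotropicConnection B s) (x : D ⧸ G) {u : 𝔡}
    (hu : dressing E G x u = 0) (hu' : sigmaForm B s x u = 0) : u = 0 :=
  (isIsotropicSplitting_dressing hpair hS hs x).splittingMap_injective hpair.symm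
    hpair.nondegenerate ((Prod.ext hu hu').trans (map_zero _).symm)

end Stabiliser

variable [FiniteDimensional ℝ 𝔡]

theorem IsGroupPair.isIsotropicGroupPair {n : ℕ} (hpair : IsGroupPair n B 𝔤 G) :
    IsIsotropicGroupPair B 𝔤 G where
  symm := hpair.maninPair.symm
  nondegenerate := hpair.maninPair.nondegenerate
  adInvariant := hpair.maninPair.adInvariant
  isotropic := hpair.maninPair.maximalIsotropic.prop
  lieAlgebra := hpair.lieAlgebra

theorem IsIsotropicGroupPair.isQuadratic (hpair : IsIsotropicGroupPair B 𝔤 G) :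
    IsQuadratic B (lieBr D) where
  symm := hpair.symm
  skew := lieBr_skew
  invariant := infinitesimal_adInvariant hpair.adInvariant

theorem chartRep_phiForm (hs : IsIsotropicConnection B s) (x₀ : D ⧸ G) {y : E}
    (hy : y ∈ (extChartAt 𝓘(ℝ, E) x₀).target) :
    chartRep (phiForm B s) x₀ y = chernSimons B (lieBr D) (oneRep s x₀) y := by
  have chartRep_ds : chartRep (extDerOne s) x₀ y = extDeriv (fun z => toForm (oneRep s x₀ z)) y :=
    chartRep_extDer hs.smooth x₀ hy
  rw [chernSimons, ← chartRep_ds]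
  let x := (extChartAt 𝓘(ℝ, E) x₀).symm y
  let A : E →L[ℝ] TangentSpace 𝓘(ℝ, E) x :=
    mfderiv 𝓘(ℝ, E) 𝓘(ℝ, E) (extChartAt 𝓘(ℝ, E) x₀).symm y
  have pullback_ds_s := wedge_compContinuousLinearMap B (extDerOne s x) (toForm (s x)) A
  have pullback_s_s := wedge_compContinuousLinearMap (lieBr D) (toForm (s x)) (toForm (s x)) A
  have pullback_s_s_s := wedge_compContinuousLinearMap B
    (wedge (lieBr D) (toForm (s x)) (toForm (s x))) (toForm (s x)) A
  rw [pullback_s_s] at pullback_s_s_s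
  ext v
  exact congrArg₂ (fun p q : ℝ => (1 / 2 : ℝ) • p + (1 / 6 : ℝ) • q)
    (DFunLike.congr_fun pullback_ds_s v) (DFunLike.congr_fun pullback_s_s_s v)

theorem phiForm_self (hs : IsIsotropicConnection B s) (x : D ⧸ G)
    (v : Fin 3 → TangentSpace 𝓘(ℝ, E) x) :
    phiForm B s x v = chernSimons B (lieBr D) (oneRep s x) (extChartAt 𝓘(ℝ, E) x x) v := by
  rw [← chartRep_phiForm hs x (mem_extChartAt_target x)]
  exact (chartRep_self_apply (phiForm B s) x v).symm

variable [FiniteDimensional ℝ E]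

theorem contDiffOn_dressingRep (hS : IsQuotientStructure 𝔡 E G) (hs : IsIsotropicConnection B s)
    (x₀ : D ⧸ G) :
    ContDiffOn ℝ ∞ (dressingRep (𝔡 := 𝔡) E G x₀) (extChartAt 𝓘(ℝ, E) x₀).target :=
  contDiffOn_clm_apply.2 fun u =>
    contDiffOn_fieldRep_actionField (contMDiff_orbit hS) (dressing_surjective hs) u x₀

theorem differentiableAt_dressingRep (hS : IsQuotientStructure 𝔡 E G)
    (hs : IsIsotropicConnection B s) (x₀ : D ⧸ G) {y : E}
    (hy : y ∈ (extChartAt 𝓘(ℝ, E) x₀).target) :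
    DifferentiableAt ℝ (dressingRep (𝔡 := 𝔡) E G x₀) y :=
  ((contDiffOn_dressingRep hS hs x₀).contDiffAt
    ((isOpen_extChartAt_target x₀).mem_nhds hy)).differentiableAt (by simp)

theorem fderiv_dressingRep (hS : IsQuotientStructure 𝔡 E G) (hs : IsIsotropicConnection B s)
    (x₀ : D ⧸ G) {y : E} (hy : y ∈ (extChartAt 𝓘(ℝ, E) x₀).target) (u v : 𝔡) :
    fderiv ℝ (dressingRep E G x₀) y (dressingRep E G x₀ y u) v -
      fderiv ℝ (dressingRep E G x₀) y (dressingRep E G x₀ y v) u =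
      dressingRep E G x₀ y (lieBr D u v) := by
  have differentiable := differentiableAt_dressingRep hS hs x₀ hy
  have fderiv_apply (w : 𝔡) (X : E) : fderiv ℝ (fun z => dressingRep E G x₀ z w) y X =
      fderiv ℝ (dressingRep E G x₀) y X w := by
    rw [fderiv_clm_apply differentiable (differentiableAt_const w)]
    simp
  rw [← fderiv_apply, ← fderiv_apply]
  exact lieBracket_fieldRep_actionField x₀ hy (contMDiff_orbit hS _)
    (fun w => differentiable.clm_apply (differentiableAt_const w)) u v

theorem isIsotropicSplittingAt_dressingRep (hpair : IsIsotropicGroupPair B 𝔤 G)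
    (hS : IsQuotientStructure 𝔡 E G) (hs : IsIsotropicConnection B s) (x₀ : D ⧸ G) {y : E}
    (hy : y ∈ (extChartAt 𝓘(ℝ, E) x₀).target) :
    IsIsotropicSplittingAt B (lieBr D) (oneRep s x₀) (dressingRep E G x₀) y where
  differentiable_splitting := (contDiffAt_connectionRep hs x₀ hy).differentiableAt (by simp)
  differentiable_anchor := differentiableAt_dressingRep hS hs x₀ hy
  splitting := by
    filter_upwards [(isOpen_extChartAt_target x₀).mem_nhds hy] with z hz
      using (isIsotropicSplitting_dressingRep hpair hS hs x₀ hz).splitting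
  isotropic := Filter.Eventually.of_forall fun _ _ _ => hs.isotropic _ _ _
  stabiliser_isotropic := (isIsotropicSplitting_dressingRep hpair hS hs x₀ hy).ker_isotropic
  anchor_bracket := fderiv_dressingRep hS hs x₀ hy

theorem isClosedForm_phiForm (hpair : IsIsotropicGroupPair B 𝔤 G)
    (hS : IsQuotientStructure 𝔡 E G) (hs : IsIsotropicConnection B s) :
    IsClosedForm (phiForm B s) := by
  refine ⟨fun x₀ => ?_, fun x => ?_⟩
  · rw [Set.preimage_univ, Set.inter_univ]
    exact ContDiffOn.congr (fun y hy =>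
      (contDiffAt_chernSimons (contDiffAt_connectionRep hs x₀ hy)).contDiffWithinAt)
      fun y hy => chartRep_phiForm hs x₀ hy
  · have center_mem := mem_extChartAt_target (I := 𝓘(ℝ, E)) x
    have chartRep_eq : chartRep (phiForm B s) x =ᶠ[𝓝 (extChartAt 𝓘(ℝ, E) x x)]
        chernSimons B (lieBr D) (oneRep s x) := by
      filter_upwards [extChartAt_target_mem_nhds x] with y hy using chartRep_phiForm hs x hy
    rw [extDer, chartRep_eq.extDeriv_eq,
      (isIsotropicSplittingAt_dressingRep hpair hS hs x center_mem).extDeriv_chernSimons_eq_zero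
        hpair.isQuadratic lieBr_leibniz (contDiffAt_connectionRep hs x center_mem)]
    rfl

theorem lieBr_mem (hpair : IsIsotropicGroupPair B 𝔤 G) (hS : IsQuotientStructure 𝔡 E G)
    (hs : IsIsotropicConnection B s) {u v : 𝔡} (hu : u ∈ 𝔤) (hv : v ∈ 𝔤) : lieBr D u v ∈ 𝔤 := by
  rw [eq_ker_dressing_one hpair hS hs] at hu hv ⊢
  let x := ((1 : D) : D ⧸ G)
  have dressingRep_eq_zero {w : 𝔡} (hw : dressing E G x w = 0) :
      dressingRep E G x (extChartAt 𝓘(ℝ, E) x x) w = 0 := (dressingRep_self x w).trans hw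
  have bracket := fderiv_dressingRep hS hs x (mem_extChartAt_target x) u v
  rw [dressingRep_eq_zero hu, dressingRep_eq_zero hv, dressingRep_self, map_zero, zero_apply,
    zero_apply, sub_zero] at bracket
  exact bracket.symm

theorem finrank_subalgebra_eq (hpair : IsIsotropicGroupPair B 𝔤 G)
    (hS : IsQuotientStructure 𝔡 E G) (hs : IsIsotropicConnection B s) :
    Module.finrank ℝ 𝔤 = Module.finrank ℝ E := by
  rw [eq_ker_dressing_one hpair hS hs]
  exact IsIsotropicSplitting.finrank_ker (W := E)
    (isIsotropicSplitting_dressing hpair hS hs ((1 : D) : D ⧸ G)) hpair.symm hpair.nondegenerate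

theorem diracL_lagrangian (hpair : IsIsotropicGroupPair B 𝔤 G)
    (hS : IsQuotientStructure 𝔡 E G) (hs : IsIsotropicConnection B s) (x : D ⧸ G) :
    Maximal (fun K : Submodule ℝ (BigTangent E x) => IsIsotropicAt K) (diracL B 𝔤 s x) :=
  (isIsotropicSplitting_dressing hpair hS hs x).maximal_isotropic_map hpair.symm
    hpair.nondegenerate (maximal_isotropic_subalgebra hpair hS hs)

end Connection

section Sections

theorem fderiv_mem_submodule {E V : Type*} [NormedAddCommGroup E] [NormedSpace ℝ E]
    [NormedAddCommGroup V] [NormedSpace ℝ V] [FiniteDimensional ℝ V] {𝔤 : Submodule ℝ V}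
    {f : E → V} {y : E} (hf : DifferentiableAt ℝ f y) (mem : ∀ z, f z ∈ 𝔤) (Z : E) :
    fderiv ℝ f y Z ∈ 𝔤 := by
  have : IsClosed (𝔤 : Set V) := 𝔤.closed_of_finiteDimensional
  let quotientMap := LinearMap.toContinuousLinearMap 𝔤.mkQ
  have quotient_zero : quotientMap ∘ f = fun _ => 0 :=
    funext fun z => (Submodule.Quotient.mk_eq_zero 𝔤).2 (mem z)
  have derivative := quotientMap.hasFDerivAt.comp y hf.hasFDerivAt
  rw [quotient_zero] at derivative
  exact (Submodule.Quotient.mk_eq_zero 𝔤).1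
    (DFunLike.congr_fun (derivative.unique (hasFDerivAt_const _ _)) Z)

theorem lieBracket_anchor {E V : Type*} [NormedAddCommGroup E] [NormedSpace ℝ E]
    [NormedAddCommGroup V] [NormedSpace ℝ V] {br : V →L[ℝ] V →L[ℝ] V}
    {R : E → V →L[ℝ] E} {y : E} (hR : DifferentiableAt ℝ R y)
    (anchor_bracket : ∀ u v, fderiv ℝ R y (R y u) v - fderiv ℝ R y (R y v) u = R y (br u v))
    {a b : E → V} (ha : DifferentiableAt ℝ a y) (hb : DifferentiableAt ℝ b y) :
    VectorField.lieBracket ℝ (fun z => R z (a z)) (fun z => R z (b z)) y =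
      R y (br (a y) (b y) + fderiv ℝ b y (R y (a y)) - fderiv ℝ a y (R y (b y))) := by
  rw [VectorField.lieBracket, fderiv_clm_apply hR ha, fderiv_clm_apply hR hb, map_sub, map_add,
    ← anchor_bracket]
  simp only [add_apply, ContinuousLinearMap.comp_apply, ContinuousLinearMap.flip_apply]
  abel

variable {E : Type*} [NormedAddCommGroup E] [NormedSpace ℝ E]
  {M : Type*} [TopologicalSpace M] [ChartedSpace E M]
  {F : Type*} [NormedAddCommGroup F] [NormedSpace ℝ F]

theorem actionBracket_apply (br : F →L[ℝ] F →L[ℝ] F) (ρ : ∀ x : M, F →L[ℝ] TangentSpace 𝓘(ℝ, E) x)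
    {a b : M → F} {x : M} (ha : MDifferentiableAt 𝓘(ℝ, E) 𝓘(ℝ, F) a x)
    (hb : MDifferentiableAt 𝓘(ℝ, E) 𝓘(ℝ, F) b x) :
    actionBracket br ρ a b x = br (a x) (b x) +
      fderiv ℝ (b ∘ (extChartAt 𝓘(ℝ, E) x).symm) (extChartAt 𝓘(ℝ, E) x x) (ρ x (a x)) -
      fderiv ℝ (a ∘ (extChartAt 𝓘(ℝ, E) x).symm) (extChartAt 𝓘(ℝ, E) x x) (ρ x (b x)) := by
  rw [actionBracket, differential_apply ha, differential_apply hb]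

variable [IsManifold 𝓘(ℝ, E) ∞ M]

theorem differentiableAt_comp_chart_symm {a : M → F} (ha : ContMDiff 𝓘(ℝ, E) 𝓘(ℝ, F) ∞ a) (x : M) :
    DifferentiableAt ℝ (a ∘ (extChartAt 𝓘(ℝ, E) x).symm) (extChartAt 𝓘(ℝ, E) x x) :=
  ((contMDiff_iff_chart.1 ha x).contDiffAt (extChartAt_target_mem_nhds x)).differentiableAt
    (by simp)

theorem actionBracket_mem [FiniteDimensional ℝ F] {br : F →L[ℝ] F →L[ℝ] F}
    (ρ : ∀ x : M, F →L[ℝ] TangentSpace 𝓘(ℝ, E) x) {𝔤 : Submodule ℝ F}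
    (hbr : ∀ u ∈ 𝔤, ∀ v ∈ 𝔤, br u v ∈ 𝔤) {a b : M → F} (ha : IsSmoothSection E 𝔤 a)
    (hb : IsSmoothSection E 𝔤 b) (x : M) : actionBracket br ρ a b x ∈ 𝔤 := by
  rw [actionBracket_apply br ρ (ha.1.mdifferentiable (by simp) x)
    (hb.1.mdifferentiable (by simp) x)]
  exact 𝔤.sub_mem (𝔤.add_mem (hbr _ (ha.2 x) _ (hb.2 x))
    (fderiv_mem_submodule (differentiableAt_comp_chart_symm hb.1 x) (fun z => hb.2 _) _))
    (fderiv_mem_submodule (differentiableAt_comp_chart_symm ha.1 x) (fun z => ha.2 _) _)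

end Sections

section InfMultiplicative

variable {𝔡 : Type*} [NormedAddCommGroup 𝔡] [NormedSpace ℝ 𝔡]
  {D : Type*} [TopologicalSpace D] [Group D]
  {B : 𝔡 →L[ℝ] 𝔡 →L[ℝ] ℝ} {𝔤 : Submodule ℝ 𝔡} {G : Subgroup D}
  {E : Type*} [NormedAddCommGroup E] [NormedSpace ℝ E]
  [ChartedSpace E (D ⧸ G)] [IsManifold 𝓘(ℝ, E) ∞ (D ⧸ G)]
  {s : ∀ x : D ⧸ G, TangentSpace 𝓘(ℝ, E) x →L[ℝ] 𝔡}

theorem contract_extDerOne_sigmaForm (B : 𝔡 →L[ℝ] 𝔡 →L[ℝ] ℝ)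
    (s : ∀ x : D ⧸ G, TangentSpace 𝓘(ℝ, E) x →L[ℝ] 𝔡) (c : D ⧸ G → 𝔡) (x : D ⧸ G)
    (X Z : TangentSpace 𝓘(ℝ, E) x) :
    contract (extDerOne (fun y => sigmaForm B s y (c y)) x) X Z =
      extDeriv (fun z => toForm ((B.flip (c ((extChartAt 𝓘(ℝ, E) x).symm z))).comp
        (oneRep s x z))) (extChartAt 𝓘(ℝ, E) x x) ![X, Z] := by
  rw [contract_apply, extDerOne, extDer_self_apply]
  rfl

variable [ChartedSpace 𝔡 D]

theorem sigmaForm_dressing_chart (B : 𝔡 →L[ℝ] 𝔡 →L[ℝ] ℝ)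
    (s : ∀ x : D ⧸ G, TangentSpace 𝓘(ℝ, E) x →L[ℝ] 𝔡) (a b : D ⧸ G → 𝔡) (x₀ : D ⧸ G) {z : E}
    (hz : z ∈ (extChartAt 𝓘(ℝ, E) x₀).target) :
    ((fun y => sigmaForm B s y (b y) (dressing E G y (a y))) ∘ (extChartAt 𝓘(ℝ, E) x₀).symm) z =
      B (oneRep s x₀ z (dressingRep E G x₀ z (a ((extChartAt 𝓘(ℝ, E) x₀).symm z))))
        (b ((extChartAt 𝓘(ℝ, E) x₀).symm z)) :=
  congrArg (fun v => B v (b ((extChartAt 𝓘(ℝ, E) x₀).symm z)))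
    (oneRep_fieldRep s (fun y => dressing E G y (a y)) x₀ hz).symm

variable [LieGroup 𝓘(ℝ, 𝔡) ∞ D] [FiniteDimensional ℝ 𝔡] [FiniteDimensional ℝ E]

theorem contMDiff_sigmaForm_dressing (hS : IsQuotientStructure 𝔡 E G)
    (hs : IsIsotropicConnection B s) {a b : D ⧸ G → 𝔡} (ha : ContMDiff 𝓘(ℝ, E) 𝓘(ℝ, 𝔡) ∞ a)
    (hb : ContMDiff 𝓘(ℝ, E) 𝓘(ℝ, 𝔡) ∞ b) :
    ContMDiff 𝓘(ℝ, E) 𝓘(ℝ, ℝ) ∞ (fun y => sigmaForm B s y (b y) (dressing E G y (a y))) := by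
  refine contMDiff_iff_chart.2 fun x₀ =>
    ContDiffOn.congr ?_ fun z => sigmaForm_dressing_chart B s a b x₀
  have smooth_splitting_anchor := (contDiffOn_connectionRep hs x₀).clm_apply
    ((contDiffOn_dressingRep hS hs x₀).clm_apply (contMDiff_iff_chart.1 ha x₀))
  exact (contDiffOn_const.clm_apply smooth_splitting_anchor).clm_apply
    (contMDiff_iff_chart.1 hb x₀)

theorem differential_sigmaForm_dressing (hS : IsQuotientStructure 𝔡 E G)
    (hs : IsIsotropicConnection B s) {a b : D ⧸ G → 𝔡} (ha : ContMDiff 𝓘(ℝ, E) 𝓘(ℝ, 𝔡) ∞ a)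
    (hb : ContMDiff 𝓘(ℝ, E) 𝓘(ℝ, 𝔡) ∞ b) (x : D ⧸ G) (Z : TangentSpace 𝓘(ℝ, E) x) :
    differential (fun y => sigmaForm B s y (b y) (dressing E G y (a y))) x Z =
      fderiv ℝ (fun z => B (oneRep s x z (dressingRep E G x z
        (a ((extChartAt 𝓘(ℝ, E) x).symm z)))) (b ((extChartAt 𝓘(ℝ, E) x).symm z)))
        (extChartAt 𝓘(ℝ, E) x x) Z := by
  rw [differential_apply ((contMDiff_sigmaForm_dressing hS hs ha hb).mdifferentiable (by simp) x)]
  exact DFunLike.congr_fun (Filter.EventuallyEq.fderiv_eq (Filter.mem_of_superset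
    (extChartAt_target_mem_nhds x) fun z => sigmaForm_dressing_chart B s a b x)) Z

theorem mlieBracket_dressing (hS : IsQuotientStructure 𝔡 E G) (hs : IsIsotropicConnection B s)
    {a b : D ⧸ G → 𝔡} (ha : ContMDiff 𝓘(ℝ, E) 𝓘(ℝ, 𝔡) ∞ a)
    (hb : ContMDiff 𝓘(ℝ, E) 𝓘(ℝ, 𝔡) ∞ b) (x : D ⧸ G) :
    VectorField.mlieBracket 𝓘(ℝ, E) (fun y => dressing E G y (a y))
      (fun y => dressing E G y (b y)) x =
      dressing E G x (actionBracket (lieBr D) (dressing E G) a b x) := by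
  have bracket_chart := lieBracket_anchor
    (differentiableAt_dressingRep hS hs x (mem_extChartAt_target x))
    (fderiv_dressingRep hS hs x (mem_extChartAt_target x))
    (differentiableAt_comp_chart_symm ha x) (differentiableAt_comp_chart_symm hb x)
  simp only [Function.comp_apply, extChartAt_to_inv, dressingRep_self] at bracket_chart
  rw [actionBracket_apply _ _ (ha.mdifferentiable (by simp) x) (hb.mdifferentiable (by simp) x),
    mlieBracket_eq_lieBracket]
  exact bracket_chart

theorem sigmaForm_actionBracket (hpair : IsIsotropicGroupPair B 𝔤 G)
    (hS : IsQuotientStructure 𝔡 E G) (hs : IsIsotropicConnection B s) {a b : D ⧸ G → 𝔡}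
    (ha : IsSmoothSection E 𝔤 a) (hb : IsSmoothSection E 𝔤 b) (x : D ⧸ G) :
    sigmaForm B s x (actionBracket (lieBr D) (dressing E G) a b x) =
      lieDer (fun y => dressing E G y (a y)) (fun y => sigmaForm B s y (b y)) x
        - contract (extDerOne (fun y => sigmaForm B s y (a y)) x) (dressing E G x (b x))
        + contract₂ (phiForm B s x) (dressing E G x (a x)) (dressing E G x (b x)) := by
  have differentiable_a := differentiableAt_comp_chart_symm ha.1 x
  have im2_chart := (isIsotropicSplittingAt_dressingRep hpair hS hs x
    (mem_extChartAt_target x)).infMultiplicative hpair.isQuadratic differentiable_a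
    (differentiableAt_comp_chart_symm hb.1 x)
    (fun Z => hpair.isotropic _ (fderiv_mem_submodule differentiable_a (fun z => ha.2 _) Z) _
      (hb.2 _))
  ext Z
  specialize im2_chart Z
  simp only [Function.comp_apply, extChartAt_to_inv, dressingRep_self] at im2_chart
  rw [actionBracket_apply _ _ (ha.1.mdifferentiable (by simp) x)
    (hb.1.mdifferentiable (by simp) x)]
  refine (congrArg (fun v => B v _) (oneRep_self s x Z).symm).trans (im2_chart.trans ?_)
  rw [add_apply, sub_apply, lieDer, add_apply, differential_sigmaForm_dressing hS hs ha.1 hb.1,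
    contract_extDerOne_sigmaForm, contract_extDerOne_sigmaForm, contract₂_apply,
    phiForm_self hs]
  rfl

theorem isInfMultiplicative (hpair : IsIsotropicGroupPair B 𝔤 G)
    (hS : IsQuotientStructure 𝔡 E G) (hs : IsIsotropicConnection B s) :
    IsInfMultiplicative (lieBr D) 𝔤 (dressing E G) (sigmaForm B s) (phiForm B s) where
  smooth u _ := smoothOneFormOn_sigmaForm hs u
  im1 a b ha hb x := by
    have pairing := (isIsotropicSplitting_dressing hpair hS hs x).pairing_splittingMap hpair.symm
      (b x) (a x)
    rw [hpair.isotropic _ (hb.2 x) _ (ha.2 x)] at pairing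
    exact eq_neg_of_add_eq_zero_left pairing
  im2 a b ha hb := sigmaForm_actionBracket hpair hS hs ha hb

end InfMultiplicative

section Dirac

variable {𝔡 : Type*} [NormedAddCommGroup 𝔡] [NormedSpace ℝ 𝔡] [FiniteDimensional ℝ 𝔡]
  {D : Type*} [TopologicalSpace D] [Group D] [ChartedSpace 𝔡 D] [LieGroup 𝓘(ℝ, 𝔡) ∞ D]
  {B : 𝔡 →L[ℝ] 𝔡 →L[ℝ] ℝ} {𝔤 : Submodule ℝ 𝔡} {G : Subgroup D}
  {E : Type*} [NormedAddCommGroup E] [NormedSpace ℝ E] [FiniteDimensional ℝ E]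
  [ChartedSpace E (D ⧸ G)] [IsManifold 𝓘(ℝ, E) ∞ (D ⧸ G)]
  {s : ∀ x : D ⧸ G, TangentSpace 𝓘(ℝ, E) x →L[ℝ] 𝔡}

theorem isSmoothSubbundle_diracL (hpair : IsIsotropicGroupPair B 𝔤 G)
    (hS : IsQuotientStructure 𝔡 E G) (hs : IsIsotropicConnection B s) :
    IsSmoothSubbundle (diracL B 𝔤 s) := by
  intro x₀
  let b := Module.finBasis ℝ 𝔤
  refine ⟨Set.univ, isOpen_univ, Set.mem_univ _, _,
    fun i x => splittingMap B (dressing E G x) (s x) (b i), fun i => ⟨?_, ?_⟩,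
    fun x _ => ⟨?_, ?_⟩⟩
  · exact smoothFieldOn_univ_iff.2
      (contDiffOn_fieldRep_actionField (contMDiff_orbit hS) (dressing_surjective hs) (b i : 𝔡))
  · exact smoothOneFormOn_sigmaForm hs (b i)
  · exact (b.linearIndependent.map' 𝔤.subtype 𝔤.ker_subtype).map' _ (LinearMap.ker_eq_bot.2
      ((isIsotropicSplitting_dressing hpair hS hs x).splittingMap_injective hpair.symm
        hpair.nondegenerate))
  · have range_eq : Set.range (fun i => splittingMap B (dressing E G x) (s x) (b i)) =
        (splittingMap B (dressing E G x) (s x) ∘ₗ 𝔤.subtype) '' Set.range b := by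
      rw [← Set.range_comp]
      rfl
    rw [range_eq, Submodule.span_image, b.span_eq, Submodule.map_comp, Submodule.map_subtype_top,
      diracL_eq_map]

/-- In a chart, `a` is recovered by applying the smooth inverse of `splittingMap`. -/
theorem contMDiff_of_smoothSectionOn (hpair : IsIsotropicGroupPair B 𝔤 G)
    (hS : IsQuotientStructure 𝔡 E G) (hs : IsIsotropicConnection B s) {a : D ⧸ G → 𝔡}
    (ha : SmoothSectionOn (fun x => splittingMap B (dressing E G x) (s x) (a x)) Set.univ) :
    ContMDiff 𝓘(ℝ, E) 𝓘(ℝ, 𝔡) ∞ a := by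
  refine contMDiff_iff_chart.2 fun x₀ => ?_
  have smooth_field := smoothFieldOn_univ_iff.1 ha.1 x₀
  have smooth_form := smoothOneFormOn_iff.1 ha.2 x₀
  rw [Set.preimage_univ, Set.inter_univ] at smooth_form
  let splittingRep (y : E) :=
    LinearMap.toContinuousLinearMap (splittingMap B (dressingRep E G x₀ y) (oneRep s x₀ y))
  have invertible {y : E} (hy : y ∈ (extChartAt 𝓘(ℝ, E) x₀).target) :
      (splittingRep y).IsInvertible :=
    (isIsotropicSplitting_dressingRep hpair hS hs x₀ hy).isInvertible_splittingMap
      hpair.symm hpair.nondegenerate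
  have smooth_inverse : ContDiffOn ℝ ∞ (fun y => (splittingRep y).inverse)
      (extChartAt 𝓘(ℝ, E) x₀).target := fun y hy =>
    ContDiffAt.comp_contDiffWithinAt y (g := ContinuousLinearMap.inverse)
      (invertible hy).contDiffAt_map_inverse
      (contDiffOn_splittingMap (contDiffOn_dressingRep hS hs x₀)
        (contDiffOn_connectionRep hs x₀) y hy)
  exact (smooth_inverse.clm_apply (smooth_field.prodMk smooth_form)).congr fun y hy =>
    ((invertible hy).inverse_apply_self _).symm

theorem isTwistedDirac_diracL (hpair : IsIsotropicGroupPair B 𝔤 G)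
    (hS : IsQuotientStructure 𝔡 E G) (hs : IsIsotropicConnection B s) :
    IsTwistedDirac (phiForm B s) (diracL B 𝔤 s) where
  closed := isClosedForm_phiForm hpair hS hs
  almostDirac := ⟨isSmoothSubbundle_diracL hpair hS hs, diracL_lagrangian hpair hS hs⟩
  involutive e f he hf heL hfL x := by
    choose a a_mem he_eq using heL
    choose b b_mem hf_eq using hfL
    obtain rfl : (fun x => splittingMap B (dressing E G x) (s x) (a x)) = e := funext he_eq
    obtain rfl : (fun x => splittingMap B (dressing E G x) (s x) (b x)) = f := funext hf_eq
    have ha : IsSmoothSection E 𝔤 a := ⟨contMDiff_of_smoothSectionOn hpair hS hs he, a_mem⟩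
    have hb : IsSmoothSection E 𝔤 b := ⟨contMDiff_of_smoothSectionOn hpair hS hs hf, b_mem⟩
    exact ⟨actionBracket (lieBr D) (dressing E G) a b x,
      actionBracket_mem _ (fun _ hu _ => lieBr_mem hpair hS hs hu) ha hb x,
      Prod.ext (mlieBracket_dressing hS hs ha.1 hb.1 x).symm
        (sigmaForm_actionBracket hpair hS hs ha hb x)⟩

end Dirac

end ManinPairs

end

open ManinPairs in
theorem proposition3p3_general
    {𝔡 : Type*} [NormedAddCommGroup 𝔡] [NormedSpace ℝ 𝔡] [FiniteDimensional ℝ 𝔡]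
    {D : Type*} [TopologicalSpace D] [Group D] [ChartedSpace 𝔡 D] [LieGroup 𝓘(ℝ, 𝔡) ∞ D]
    (B : 𝔡 →L[ℝ] 𝔡 →L[ℝ] ℝ) (𝔤 : Submodule ℝ 𝔡) (G : Subgroup D)
    (hpair : IsIsotropicGroupPair B 𝔤 G)
    {E : Type*} [NormedAddCommGroup E] [NormedSpace ℝ E]
    [ChartedSpace E (D ⧸ G)] [IsManifold 𝓘(ℝ, E) ∞ (D ⧸ G)]
    (hS : IsQuotientStructure 𝔡 E G)
    (s : ∀ x : D ⧸ G, TangentSpace 𝓘(ℝ, E) x →L[ℝ] 𝔡)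
    (hs : IsIsotropicConnection B s) :
    IsClosedForm (phiForm B s) ∧
    IsInfMultiplicative (lieBr D) 𝔤 (dressing E G) (sigmaForm B s) (phiForm B s) ∧
    Module.finrank ℝ 𝔤 = Module.finrank ℝ E ∧
    (∀ x : D ⧸ G, ∀ u ∈ 𝔤, dressing E G x u = 0 → sigmaForm B s x u = 0 → u = 0) ∧
    IsTwistedDirac (phiForm B s) (diracL B 𝔤 s) :=
  have : FiniteDimensional ℝ E := FiniteDimensional.of_surjective
    (V₂ := E) (dressing E G ((1 : D) : D ⧸ G)).toLinearMap (dressing_surjective hs _)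
  ⟨isClosedForm_phiForm hpair hS hs, isInfMultiplicative hpair hS hs,
    finrank_subalgebra_eq hpair hS hs,
    fun x _ _ => eq_zero_of_dressing_sigmaForm hpair hS hs x,
    isTwistedDirac_diracL hpair hS hs⟩

open ManinPairs in
theorem proposition3p3
    {𝔡 : Type*} [NormedAddCommGroup 𝔡] [NormedSpace ℝ 𝔡] [FiniteDimensional ℝ 𝔡]
    {D : Type*} [TopologicalSpace D] [Group D] [ChartedSpace 𝔡 D] [LieGroup 𝓘(ℝ, 𝔡) ∞ D]
    (n : ℕ) (B : 𝔡 →L[ℝ] 𝔡 →L[ℝ] ℝ) (𝔤 : Submodule ℝ 𝔡) (G : Subgroup D)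
    (hpair : IsGroupPair n B 𝔤 G)
    {E : Type*} [NormedAddCommGroup E] [NormedSpace ℝ E] [FiniteDimensional ℝ E]
    [ChartedSpace E (D ⧸ G)] [IsManifold 𝓘(ℝ, E) ∞ (D ⧸ G)]
    (hS : IsQuotientStructure 𝔡 E G)
    (s : ∀ x : D ⧸ G, TangentSpace 𝓘(ℝ, E) x →L[ℝ] 𝔡)
    (hs : IsIsotropicConnection B s) :
    IsClosedForm (phiForm B s) ∧
    IsInfMultiplicative (lieBr D) 𝔤 (dressing E G) (sigmaForm B s) (phiForm B s) ∧
    Module.finrank ℝ 𝔤 = Module.finrank ℝ E ∧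
    (∀ x : D ⧸ G, ∀ u ∈ 𝔤, dressing E G x u = 0 → sigmaForm B s x u = 0 → u = 0) ∧
    IsTwistedDirac (phiForm B s) (diracL B 𝔤 s) :=
  proposition3p3_general B 𝔤 G hpair.isIsotropicGroupPair hS s hs
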